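/- **Setting.** Let $E$ be a real vector space with a Hausdorff locally convex topology $\tau$, let $\sigma$ be a pre-symplectic form (an alternating real bilinear form) on $E$, and let $\varsigma$ be a $\tau$-continuous semi-norm on $E$ with $|\sigma(f,g)|\le c\,\varsigma(f)\varsigma(g)$ for all $f,g\in E$ and some constant $c>0$. The phase space is the dual $\mathsf P=E_\tau'$ with the weak-$*$ topology $\sigma(E_\tau',E)$. *Measures.* Measures on $E$ are complex Borel measures for the finest locally convex topology of $E$; $\|\mu\|_1=|\mu|(E)$ is the total variation norm. For a finite dimensional subspace $S\subseteq E$ let $\mathcal M(S)$ be the complex Borel measures concentrated on $S$, $\mathcal M(S)_d$ the discrete ones, $\mathcal M(S)_c$ those without atoms, $\mathcal M(S)_a$ those absolutely continuous with respect to the Haar measure of $S$. Let $\mathcal M(E)$, $\mathcal M(E)_d$, $\mathcal M(E)_c$ be the $\|\cdot\|_1$-closures of $\bigcup_S\mathcal M(S)$, $\bigcup_S\mathcal M(S)_d$, $\bigcup_S\mathcal M(S)_c$, and let $\mathcal M(E)_{df}$ be the linear span of the point measures. For a semi-norm $\kappa$ on $E$ and $n\in\{0,1,2,\dots,\infty\}$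 let $\mathcal M^n_\kappa(E)$ be the set of $\mu\in\mathcal M(E)$ with $\int\kappa^m\,d|\mu|<\infty$ for all integers $0\le m\le n$. Put $\mu^*(\Lambda)=\overline{\mu(-\Lambda)}$ and, for Borel sets $\Lambda$ and $\hbar\in\mathbb R$, $$(\mu\star_\hbar\nu)(\Lambda)=\int d\mu(f)\int d\nu(g)\,e^{-\frac i2\hbar\sigma(f,g)}1_\Lambda(f+g),\qquad \{\mu,\nu\}_0(\Lambda)=\int d\mu(f)\int d\nu(g)\,\sigma(f,g)1_\Lambda(f+g).$$ *Fourier transforms.* For $F\in\mathsf P$ let $W_c(f)[F]=e^{iF(f)}$ and $(\mathbb F\mu)[F]=\hat\mu[F]=\int_E e^{iF(f)}\,d\mu(f)$. The deformed products of Fourier transforms of elements of $\mathcal M(E)$ are $\hat\mu\cdot_\hbar\hat\nu:=\mathbb F(\mu\star_\hbar\nu)$. *Calculus on $\mathsf P$.* Let $E_\varsigma$ be the completion of $E/\ker\varsigma$ in the norm $\|[f]\|_\varsigma=\varsigma(f)$, and $\sigma_\varsigma$ the continuous extension of $\sigma$ to $E_\varsigma$. The dual $E_\varsigma'$ is regarded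 as a subspace of $E_\tau'$ by $G(f)=G([f])$; elements of $E_\varsigma'$ are extended complex linearly to $E_\varsigma+iE_\varsigma$. A function $A:\mathsf P\to\mathbb C$ is $0$ times continuously differentiable in all directions of $E_\varsigma'$ if it is continuous; it is $m+1$ times so if it is continuous and for each $G\in E_\varsigma'$ the derivative $F\mapsto\frac{d}{dt}A[F+tG]|_{t=0}$ exists on $\mathsf P$ and is $m$ times so ($\infty$ times: $m$ times for all $m$). A vector $d_FA\in E_\varsigma+iE_\varsigma$ is the total differential of $A$ at $F$ if $\frac{d}{dt}A[F+c(t)]|_{t=0}=G(d_FA)$ for every $G\in E_\varsigma'$ and every curve $c:\mathbb R\to E_\varsigma'$ with $c(0)=0$ and $c'(0)=G$ in the topology $\sigma(E_\varsigma',E_\varsigma)$ (for example $c(t)=tG$). The Poisson bracket of functions is $\{A,B\}[F]=-\sigma_\varsigma(d_FA,d_FB)$ with $\sigma_\varsigma$ extended complex bilinearly. *Poisson algebras.* A Poisson algebra is a commutative $*$-algebra over $\mathbb C$, dense in a commutative $C^*$-algebra, with a bilinear, antisymmetric, real ($\{A,B\}^*=\{A^*,B^*\}$) bracket satisfying the Jacobi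 identity and the Leibniz rule. Function algebras carry the pointwise product, complex conjugation and the sup-norm. **Theorem.** 1. Let $n\in\{1,2,\dots\}\cup\{\infty\}$ and $\mu\in\mathcal M^n_\varsigma(E)$. Then $\hat\mu$ is $n$ times continuously differentiable in all directions of $E_\varsigma'$. For each $F\in\mathsf P$ the function $f\mapsto e^{iF(f)}[f]$ is Bochner integrable with respect to $\mu$ in $E_\varsigma+iE_\varsigma$, the total differential of $\hat\mu$ at $F$ exists, and $$d_F\hat\mu=i\int_E e^{iF(f)}[f]\,d\mu(f)=\int_E d_FW_c(f)\,d\mu(f).$$ 2. For $\mu,\nu\in\mathcal M^1_\varsigma(E)$ the formula for $\{\mu,\nu\}_0$ defines a measure in $\mathcal M(E)$, and $\{\hat\mu,\hat\nu\}=\mathbb F\{\mu,\nu\}_0$. On $\mathcal M(E)$ the Fourier transformation is complex linear and injective, and for $\mu,\nu\in\mathcal M(E)$ and $\hbar\in\mathbb R$ the formula for $\mu\star_\hbar\nu$ defines a measure in $\mathcal M(E)$, with $\mathbb F(\mu\star_0\nu)=\hat\mu\hat\nu$ and $\mathbb F(\mu^*)=\overline{\hat\mu}$; in particular the products $\cdot_\hbar$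 are well defined. 3. Let $\mathcal P$ be one of the following: (I) $\mathcal M^\infty_\kappa(E)$ for a semi-norm $\kappa$ with $\varsigma\le c'\kappa$ for some $c'\ge0$; (II) $\mathcal M(E)\cap\bigcap_{\kappa\in K}\mathcal M^\infty_\kappa(E)$ for a collection $K$ of semi-norms with $\varsigma\le\sum_{\kappa\in\Gamma}c_\kappa\kappa$ for some finite $\Gamma\subseteq K$ and constants $c_\kappa>0$; (III) an intersection of an admissible $\mathcal P$ with $\mathcal M(E)_d$, with $\mathcal M(E)_c$, or with $\mathcal M(S)_a$ for a finite dimensional subspace $S$; (IV) $\mathcal M(E)_{df}$. Then $\hat{\mathcal P}=\mathbb F\mathcal P$ is contained in $\mathbb F\mathcal M^\infty_\varsigma(E)$, it is a $*$-subalgebra of the bounded continuous functions on $\mathsf P$ which is a Poisson algebra with respect to the Poisson bracket of functions, and it is invariant under all deformed products $\cdot_\hbar$, $\hbar\in\mathbb R$. In particular $\mathbb F\mathcal M^\infty_\varsigma(E)$ is such a Poisson algebra. -/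

import Mathlib

open MeasureTheory
open scoped ENNReal BoundedContinuousFunction

namespace WeylPoisson

/-! ### The finest locally convex topology and its Borel sets -/

/-- The finest locally convex vector space topology on a real vector space (the inductive limit
topology over the finite dimensional subspaces).  In Mathlib's order on topologies "finer" means
"smaller", so the finest one is the infimum. -/
abbrev finestLocallyConvexTopology (E : Type*) [AddCommGroup E] [Module ℝ E] : TopologicalSpace E :=
  sInf {t | @IsTopologicalAddGroup E t _ ∧ @ContinuousSMul ℝ E _ _ t ∧
    @LocallyConvexSpace ℝ E _ _ _ _ t}

/-- The measurable structure on `E` is the Borel `σ`-algebra of the finest locally convex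
topology. -/
class FinestBorelSpace (E : Type*) [AddCommGroup E] [Module ℝ E] [m : MeasurableSpace E] :
    Prop where
  measurable_eq : m = @borel E (finestLocallyConvexTopology E)

/-! ### Spaces of complex measures -/

section Measures

variable {E : Type*} [AddCommGroup E] [Module ℝ E] [MeasurableSpace E]

/-- `μ` vanishes on all measurable sets disjoint from `S`. -/
def ConcentratedOn (μ : ComplexMeasure E) (S : Set E) : Prop :=
  ∀ A, MeasurableSet A → Disjoint A S → μ A = 0

/-- The closure of a set of complex measures in the total variation norm `|μ|(E)`. -/
def tvClosure (X : Set (ComplexMeasure E)) : Set (ComplexMeasure E) :=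
  {μ | ∀ ε : ℝ≥0∞, 0 < ε → ∃ ν ∈ X, (μ - ν).variation Set.univ < ε}

variable (E) in
/-- `𝓜(E)`: the total variation closure of the union of the spaces of complex Borel measures on
finite dimensional subspaces. -/
def regularMeasures : Set (ComplexMeasure E) :=
  tvClosure {ν | ∃ S : Submodule ℝ E, FiniteDimensional ℝ S ∧ ConcentratedOn ν S}

variable (E) in
/-- `𝓜(E)_d`: the total variation closure of the union of the spaces of discrete measures on
finite dimensional subspaces. -/
def discreteMeasures : Set (ComplexMeasure E) :=
  tvClosure {ν | ∃ S : Submodule ℝ E, FiniteDimensional ℝ S ∧ ConcentratedOn ν S ∧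
    ∃ C : Set E, C.Countable ∧ ConcentratedOn ν C}

variable (E) in
/-- `𝓜(E)_c`: the total variation closure of the union of the spaces of continuous (atomless)
measures on finite dimensional subspaces. -/
def continuousMeasures : Set (ComplexMeasure E) :=
  tvClosure {ν | ∃ S : Submodule ℝ E, FiniteDimensional ℝ S ∧ ConcentratedOn ν S ∧
    ∀ f : E, ν {f} = 0}

/-- `𝓜(S)_a`: the measures concentrated on a (finite dimensional) subspace `S` that are absolutely
continuous with respect to the Haar measure of `S`, which is Lebesgue measure in linear
coordinates. -/
def absContMeasures (S : Submodule ℝ E) : Set (ComplexMeasure E) :=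
  {ν | ConcentratedOn ν S ∧
    ∀ e : (Fin (Module.finrank ℝ S) → ℝ) ≃ₗ[ℝ] S, ∀ A : Set E, MeasurableSet A →
      volume {x | (e x : E) ∈ A} = 0 → ν A = 0}

variable (E) in
/-- `𝓜(E)_{df}`: the finite complex linear combinations of point measures. -/
noncomputable def finitelySupportedMeasures : Set (ComplexMeasure E) :=
  (Submodule.span ℂ (Set.range fun f : E => (VectorMeasure.dirac f (1 : ℂ) : ComplexMeasure E)) :
    Set (ComplexMeasure E))

/-- `𝓜ⁿ_κ(E)`: the measures in `𝓜(E)` with finite absolute moments `∫ κᵐ d|μ|` for `0 ≤ m ≤ n`. -/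
def momentMeasures (κ : Seminorm ℝ E) (n : ℕ∞) : Set (ComplexMeasure E) :=
  {μ | μ ∈ regularMeasures E ∧
    ∀ m : ℕ, (m : ℕ∞) ≤ n → ∫⁻ f, ENNReal.ofReal (κ f ^ m) ∂μ.variation < ∞}

/-- The complex measure with prescribed values on measurable sets (zero if there is none). -/
noncomputable def measureOfSetFun (m : Set E → ℂ) : ComplexMeasure E :=
  open Classical in
  if h : ∃ ρ : ComplexMeasure E, ∀ A, MeasurableSet A → ρ A = m A then h.choose else 0

/-- The involution `μ*(A) = conj (μ (-A))`. -/
noncomputable def measureStar (μ : ComplexMeasure E) : ComplexMeasure E :=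
  (μ.map (fun f => -f)).mapRange (starRingEnd ℂ).toAddMonoidHom Complex.continuous_conj

/-- The iterated integral `∫ dμ(f) ∫ dν(g) e^{-(i/2) ħ σ(f,g)} 1_A(f+g)`. -/
noncomputable def twistedConvOn (σ : LinearMap.BilinForm ℝ E) (ħ : ℝ) (μ ν : ComplexMeasure E)
    (A : Set E) : ℂ :=
  μ.integral (fun f => ν.integral
    (fun g => Complex.exp (-(Complex.I / 2) * ħ * σ f g) * A.indicator (fun _ => (1 : ℂ)) (f + g))
    (ContinuousLinearMap.mul ℝ ℂ)) (ContinuousLinearMap.mul ℝ ℂ)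

/-- The twisted convolution `μ ⋆_ħ ν`. -/
noncomputable def twistedConv (σ : LinearMap.BilinForm ℝ E) (ħ : ℝ) (μ ν : ComplexMeasure E) :
    ComplexMeasure E :=
  measureOfSetFun (twistedConvOn σ ħ μ ν)

/-- The iterated integral `∫ dμ(f) ∫ dν(g) σ(f,g) 1_A(f+g)`. -/
noncomputable def measureBracketOn (σ : LinearMap.BilinForm ℝ E) (μ ν : ComplexMeasure E)
    (A : Set E) : ℂ :=
  μ.integral (fun f => ν.integral
    (fun g => (σ f g : ℂ) * A.indicator (fun _ => (1 : ℂ)) (f + g))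
    (ContinuousLinearMap.mul ℝ ℂ)) (ContinuousLinearMap.mul ℝ ℂ)

/-- The Poisson bracket `{μ, ν}₀` of measures. -/
noncomputable def measureBracket (σ : LinearMap.BilinForm ℝ E) (μ ν : ComplexMeasure E) :
    ComplexMeasure E :=
  measureOfSetFun (measureBracketOn σ μ ν)

/-- The admissible choices of the space `𝓟` of measures, for a given semi-norm `ς`. -/
inductive IsMeasurePoissonSpace (ς : Seminorm ℝ E) : Set (ComplexMeasure E) → Prop
  /-- all moments with respect to one semi-norm stronger than (or equivalent to) `ς` -/
  | single (κ : Seminorm ℝ E) (h : ∃ c : ℝ, 0 ≤ c ∧ ∀ f, ς f ≤ c * κ f) :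
      IsMeasurePoissonSpace ς (momentMeasures κ ⊤)
  /-- all moments with respect to each semi-norm of a collection `K`, finitely many of which
  dominate `ς` -/
  | family (K : Set (Seminorm ℝ E)) (Γ : Finset (Seminorm ℝ E)) (hΓ : ↑Γ ⊆ K)
      (c : Seminorm ℝ E → ℝ) (hc : ∀ κ ∈ Γ, 0 < c κ) (h : ∀ f, ς f ≤ ∑ κ ∈ Γ, c κ * κ f) :
      IsMeasurePoissonSpace ς {μ | μ ∈ regularMeasures E ∧ ∀ κ ∈ K, μ ∈ momentMeasures κ ⊤}
  /-- intersection with the discrete measures -/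
  | discrete (P : Set (ComplexMeasure E)) (h : IsMeasurePoissonSpace ς P) :
      IsMeasurePoissonSpace ς (P ∩ discreteMeasures E)
  /-- intersection with the continuous measures -/
  | continuous (P : Set (ComplexMeasure E)) (h : IsMeasurePoissonSpace ς P) :
      IsMeasurePoissonSpace ς (P ∩ continuousMeasures E)
  /-- intersection with the absolutely continuous measures on a finite dimensional subspace -/
  | absCont (P : Set (ComplexMeasure E)) (h : IsMeasurePoissonSpace ς P) (S : Submodule ℝ E)
      (hS : FiniteDimensional ℝ S) : IsMeasurePoissonSpace ς (P ∩ absContMeasures S)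
  /-- the finitely supported measures -/
  | finitelySupported : IsMeasurePoissonSpace ς (finitelySupportedMeasures E)

end Measures

/-! ### The Banach space `E_ς` and its complexification -/

section Completion

variable {E : Type*} [AddCommGroup E] [Module ℝ E]

/-- The vector space `E` regarded as a semi-normed space with the semi-norm `p`. -/
def SeminormSpace (_p : Seminorm ℝ E) : Type _ := E

noncomputable instance (p : Seminorm ℝ E) : SeminormedAddCommGroup (SeminormSpace p) :=
  p.toAddGroupSeminorm.toSeminormedAddCommGroup

noncomputable instance (p : Seminorm ℝ E) : NormedSpace ℝ (SeminormSpace p) where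
  toModule := inferInstanceAs (Module ℝ E)
  norm_smul_le a x := (map_smul_eq_mul p a x).le

/-- `E_p`: the completion of `E / ker p` in the norm induced by `p`.  (`UniformSpace.Completion`
is the Hausdorff completion: it identifies points at distance `p (f - g) = 0`.) -/
abbrev SeminormCompletion (p : Seminorm ℝ E) : Type _ :=
  UniformSpace.Completion (SeminormSpace p)

/-- The class map `f ↦ [f]` from `E` to `E_p`. -/
noncomputable def classMap (p : Seminorm ℝ E) : E →ₗ[ℝ] SeminormCompletion p :=
  (UniformSpace.Completion.toComplL (𝕜 := ℝ) (E := SeminormSpace p)).toLinearMap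

lemma norm_classMap (p : Seminorm ℝ E) (f : E) : ‖classMap p f‖ = p f :=
  UniformSpace.Completion.norm_coe (E := SeminormSpace p) f

/-- A bilinear form bounded by the semi-norm, as a continuous bilinear map. -/
noncomputable def boundedForm (p : Seminorm ℝ E) (σ : LinearMap.BilinForm ℝ E)
    (h : ∃ c : ℝ, 0 < c ∧ ∀ f g, |σ f g| ≤ c * p f * p g) :
    SeminormSpace p →L[ℝ] SeminormSpace p →L[ℝ] ℝ :=
  LinearMap.mkContinuous₂ (σ : SeminormSpace p →ₗ[ℝ] SeminormSpace p →ₗ[ℝ] ℝ) h.choose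
    h.choose_spec.2

/-- The continuous extension `σ_p` of `σ` to `E_p × E_p`. -/
noncomputable def extendedForm (p : Seminorm ℝ E) (σ : LinearMap.BilinForm ℝ E)
    (h : ∃ c : ℝ, 0 < c ∧ ∀ f g, |σ f g| ≤ c * p f * p g) :
    SeminormCompletion p →L[ℝ] SeminormCompletion p →L[ℝ] ℝ :=
  (((boundedForm p σ h).extend UniformSpace.Completion.toComplL).flip.extend
    UniformSpace.Completion.toComplL).flip

lemma extendedForm_classMap (p : Seminorm ℝ E) (σ : LinearMap.BilinForm ℝ E)
    (h : ∃ c : ℝ, 0 < c ∧ ∀ f g, |σ f g| ≤ c * p f * p g) (f g : E) :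
    extendedForm p σ h (classMap p f) (classMap p g) = σ f g := by
  have hd : DenseRange (UniformSpace.Completion.toComplL (𝕜 := ℝ) (E := SeminormSpace p)) :=
    UniformSpace.Completion.denseRange_coe
  have hu : IsUniformInducing
      (UniformSpace.Completion.toComplL (𝕜 := ℝ) (E := SeminormSpace p)) :=
    UniformSpace.Completion.isUniformInducing_coe _
  let f' : SeminormSpace p := f
  let g' : SeminormSpace p := g
  have h1 := ContinuousLinearMap.extend_eq (boundedForm p σ h) hd hu f'
  have h2 := ContinuousLinearMap.extend_eq
    ((boundedForm p σ h).extend UniformSpace.Completion.toComplL).flip hd hu g'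
  have h3 := DFunLike.congr_fun h2 (UniformSpace.Completion.toComplL (𝕜 := ℝ) f')
  rw [ContinuousLinearMap.flip_apply, h1] at h3
  exact h3

/-- The complexification `V + iV` of a real normed space, as pairs (real part, imaginary part)
with the maximum norm. -/
def Complexified (V : Type*) : Type _ := V × V

section Complexified

variable {V : Type*} [NormedAddCommGroup V] [NormedSpace ℝ V]

noncomputable instance : NormedAddCommGroup (Complexified V) :=
  inferInstanceAs (NormedAddCommGroup (V × V))

noncomputable instance : NormedSpace ℝ (Complexified V) :=
  inferInstanceAs (NormedSpace ℝ (V × V))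

/-- Real part. -/
def Complexified.re (Φ : Complexified V) : V := Prod.fst Φ

/-- Imaginary part. -/
def Complexified.im (Φ : Complexified V) : V := Prod.snd Φ

/-- The vector `φ + iψ`. -/
def Complexified.mk (φ ψ : V) : Complexified V := (φ, ψ)

/-- The real vector `φ = φ + i0`. -/
def Complexified.ofReal (φ : V) : Complexified V := Complexified.mk φ 0

noncomputable instance : Module ℂ (Complexified V) where
  smul z Φ := .mk (z.re • Φ.re - z.im • Φ.im) (z.re • Φ.im + z.im • Φ.re)
  one_smul Φ := Prod.ext
    (by change (1 : ℝ) • Φ.1 - (0 : ℝ) • Φ.2 = Φ.1; module)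
    (by change (1 : ℝ) • Φ.2 + (0 : ℝ) • Φ.1 = Φ.2; module)
  mul_smul z w Φ := Prod.ext
    (by
      change (z.re * w.re - z.im * w.im) • Φ.1 - (z.re * w.im + z.im * w.re) • Φ.2 =
        z.re • (w.re • Φ.1 - w.im • Φ.2) - z.im • (w.re • Φ.2 + w.im • Φ.1)
      module)
    (by
      change (z.re * w.re - z.im * w.im) • Φ.2 + (z.re * w.im + z.im * w.re) • Φ.1 =
        z.re • (w.re • Φ.2 + w.im • Φ.1) + z.im • (w.re • Φ.1 - w.im • Φ.2)
      module)
  smul_zero z := Prod.ext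
    (by change z.re • (0 : V) - z.im • (0 : V) = 0; module)
    (by change z.re • (0 : V) + z.im • (0 : V) = 0; module)
  smul_add z Φ Ψ := Prod.ext
    (by
      change z.re • (Φ.1 + Ψ.1) - z.im • (Φ.2 + Ψ.2) =
        (z.re • Φ.1 - z.im • Φ.2) + (z.re • Ψ.1 - z.im • Ψ.2)
      module)
    (by
      change z.re • (Φ.2 + Ψ.2) + z.im • (Φ.1 + Ψ.1) =
        (z.re • Φ.2 + z.im • Φ.1) + (z.re • Ψ.2 + z.im • Ψ.1)
      module)
  add_smul z w Φ := Prod.ext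
    (by
      change (z.re + w.re) • Φ.1 - (z.im + w.im) • Φ.2 =
        (z.re • Φ.1 - z.im • Φ.2) + (w.re • Φ.1 - w.im • Φ.2)
      module)
    (by
      change (z.re + w.re) • Φ.2 + (z.im + w.im) • Φ.1 =
        (z.re • Φ.2 + z.im • Φ.1) + (w.re • Φ.2 + w.im • Φ.1)
      module)
  zero_smul Φ := Prod.ext
    (by change (0 : ℝ) • Φ.1 - (0 : ℝ) • Φ.2 = 0; module)
    (by change (0 : ℝ) • Φ.2 + (0 : ℝ) • Φ.1 = 0; module)

lemma Complexified.norm_smul_le (z : ℂ) (Φ : Complexified V) : ‖z • Φ‖ ≤ 2 * ‖Φ‖ * ‖z‖ := by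
  have h1 : ‖Φ.re‖ ≤ ‖Φ‖ := norm_fst_le (Φ : V × V)
  have h2 : ‖Φ.im‖ ≤ ‖Φ‖ := norm_snd_le (Φ : V × V)
  have hre := Complex.abs_re_le_norm z
  have him := Complex.abs_im_le_norm z
  have key : ∀ a b : ℝ, |a| ≤ ‖z‖ → |b| ≤ ‖z‖ → ∀ x y : V, ‖x‖ ≤ ‖Φ‖ → ‖y‖ ≤ ‖Φ‖ →
      ‖a • x‖ + ‖b • y‖ ≤ 2 * ‖Φ‖ * ‖z‖ := by
    intro a b ha hb x y hx hy
    rw [norm_smul, norm_smul, Real.norm_eq_abs, Real.norm_eq_abs]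
    have := mul_le_mul ha hx (norm_nonneg _) (norm_nonneg _)
    have := mul_le_mul hb hy (norm_nonneg _) (norm_nonneg _)
    linarith
  refine max_le ?_ ?_
  · exact (norm_sub_le _ _).trans (key _ _ hre him _ _ h1 h2)
  · exact (norm_add_le _ _).trans (key _ _ hre him _ _ h2 h1)

variable (V) in
/-- Multiplication of vectors by complex scalars, as the continuous pairing `(Φ, z) ↦ z • Φ` used
to integrate `V + iV`-valued functions against complex measures. -/
noncomputable def Complexified.smulPairing : Complexified V →L[ℝ] ℂ →L[ℝ] Complexified V :=
  LinearMap.mkContinuous₂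
    (LinearMap.mk₂ ℝ (fun (Φ : Complexified V) (z : ℂ) => z • Φ)
      (fun Φ Ψ z => smul_add z Φ Ψ)
      (fun a Φ z => Prod.ext
        (by
          change z.re • (a • Φ.1) - z.im • (a • Φ.2) = a • (z.re • Φ.1 - z.im • Φ.2)
          module)
        (by
          change z.re • (a • Φ.2) + z.im • (a • Φ.1) = a • (z.re • Φ.2 + z.im • Φ.1)
          module))
      (fun Φ z w => add_smul z w Φ)
      (fun a Φ z => Prod.ext
        (by
          change (a • z).re • Φ.1 - (a • z).im • Φ.2 = a • (z.re • Φ.1 - z.im • Φ.2)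
          rw [Complex.smul_re, Complex.smul_im]
          module)
        (by
          change (a • z).re • Φ.2 + (a • z).im • Φ.1 = a • (z.re • Φ.2 + z.im • Φ.1)
          rw [Complex.smul_re, Complex.smul_im]
          module)))
    2 (fun Φ z => Complexified.norm_smul_le z Φ)

/-- The complex linear evaluation `G(φ + iψ) = G φ + i G ψ`. -/
noncomputable def Complexified.eval (G : StrongDual ℝ V) (Φ : Complexified V) : ℂ :=
  (G Φ.re : ℂ) + Complex.I * (G Φ.im : ℂ)

/-- The complex bilinear extension of a real bilinear form. -/
noncomputable def Complexified.bilin (β : V →L[ℝ] V →L[ℝ] ℝ) (Φ Ψ : Complexified V) : ℂ :=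
  (β Φ.re Ψ.re : ℂ) + Complex.I * (β Φ.re Ψ.im : ℂ) + Complex.I * (β Φ.im Ψ.re : ℂ)
    - (β Φ.im Ψ.im : ℂ)

end Complexified

end Completion

/-! ### Calculus on the phase space `E_τ'` -/

section PhaseSpace

variable {E : Type*} [AddCommGroup E] [Module ℝ E] [TopologicalSpace E]

/-- The Weyl function `W_c(f)[F] = e^{iF(f)}`. -/
noncomputable def weylFunction (f : E) (F : WeakDual ℝ E) : ℂ :=
  Complex.exp (Complex.I * (F f : ℂ))

/-- The Fourier transform `μ̂[F] = ∫ e^{iF(f)} dμ(f)`. -/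
noncomputable def measureFourier [MeasurableSpace E] (μ : ComplexMeasure E) (F : WeakDual ℝ E) : ℂ :=
  μ.integral (fun f => weylFunction f F) (ContinuousLinearMap.mul ℝ ℂ)

/-- The deformed product `μ̂ ·_ħ ν̂ = (μ ⋆_ħ ν)^` of Fourier transforms of measures in `𝓜(E)`. -/
noncomputable def deformedProduct [MeasurableSpace E] (σ : LinearMap.BilinForm ℝ E) (ħ : ℝ)
    (A B : WeakDual ℝ E → ℂ) : WeakDual ℝ E → ℂ :=
  measureFourier (twistedConv σ ħ (Function.invFunOn measureFourier (regularMeasures E) A)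
    (Function.invFunOn measureFourier (regularMeasures E) B))

/-- The class map as a continuous linear map, for a continuous semi-norm. -/
noncomputable def classMapL (ς : Seminorm ℝ E) [IsTopologicalAddGroup E] (hς : Continuous ς) :
    E →L[ℝ] SeminormCompletion ς where
  toLinearMap := classMap ς
  cont := by
    refine continuous_of_continuousAt_zero (classMap ς).toAddMonoidHom ?_
    change Filter.Tendsto (classMap ς) (nhds 0) (nhds (classMap ς 0))
    rw [map_zero, tendsto_zero_iff_norm_tendsto_zero]
    simp only [norm_classMap]
    simpa using hς.tendsto 0

/-- The space `E_ς'` of directions, as the dual of `E_ς`, sits inside `E_τ'` by `G(f) = G([f])`. -/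
noncomputable def directionIncl (ς : Seminorm ℝ E) [IsTopologicalAddGroup E] (hς : Continuous ς)
    (G : StrongDual ℝ (SeminormCompletion ς)) : WeakDual ℝ E :=
  StrongDual.toWeakDual (G.comp (classMapL ς hς))

/-- `A` is `m` times continuously differentiable in all directions of `E_ς'`: `A` is continuous and
every directional derivative exists everywhere and is `m - 1` times continuously differentiable. -/
def DirContDiff (ς : Seminorm ℝ E) [IsTopologicalAddGroup E] (hς : Continuous ς) :
    ℕ → (WeakDual ℝ E → ℂ) → Prop
  | 0, A => Continuous A
  | m + 1, A => Continuous A ∧ ∀ G : StrongDual ℝ (SeminormCompletion ς),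
      ∃ A' : WeakDual ℝ E → ℂ,
        (∀ F, HasDerivAt (fun t : ℝ => A (F + t • directionIncl ς hς G)) (A' F) 0) ∧
        DirContDiff ς hς m A'

/-- `Φ ∈ E_ς + iE_ς` is the total differential of `A` at `F`: along each curve `t ↦ F + c(t)` with
`c(t) ∈ E_ς'`, `c(0) = 0`, and `c'(0) = G ∈ E_ς'` in the weak-`*` sense (for instance along
`t ↦ F + tG`), the derivative of `A` at `t = 0` is `G(Φ)`. -/
def HasTotalDifferentialAt (ς : Seminorm ℝ E) [IsTopologicalAddGroup E] (hς : Continuous ς)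
    (A : WeakDual ℝ E → ℂ) (Φ : Complexified (SeminormCompletion ς)) (F : WeakDual ℝ E) : Prop :=
  ∀ (G : StrongDual ℝ (SeminormCompletion ς)) (c : ℝ → StrongDual ℝ (SeminormCompletion ς)),
    c 0 = 0 → (∀ φ, HasDerivAt (fun t => c t φ) (G φ) 0) →
      HasDerivAt (fun t => A (F + directionIncl ς hς (c t))) (Complexified.eval G Φ) 0

/-- The total differential `d_F A` (zero if there is none). -/
noncomputable def totalDifferential (ς : Seminorm ℝ E) [IsTopologicalAddGroup E]
    (hς : Continuous ς) (A : WeakDual ℝ E → ℂ) (F : WeakDual ℝ E) :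
    Complexified (SeminormCompletion ς) :=
  open Classical in
  if h : ∃ Φ, HasTotalDifferentialAt ς hς A Φ F then h.choose else 0

/-- The phase space Poisson bracket `{A, B}[F] = -σ_ς(d_F A, d_F B)`, with `σ_ς` extended complex
bilinearly. -/
noncomputable def phaseBracket (ς : Seminorm ℝ E) [IsTopologicalAddGroup E] (hς : Continuous ς)
    (σ : LinearMap.BilinForm ℝ E) (hσ : ∃ c : ℝ, 0 < c ∧ ∀ f g, |σ f g| ≤ c * ς f * ς g)
    (A B : WeakDual ℝ E → ℂ) (F : WeakDual ℝ E) : ℂ :=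
  -Complexified.bilin (extendedForm ς σ hσ) (totalDifferential ς hς A F)
    (totalDifferential ς hς B F)

end PhaseSpace

/-- A Poisson bracket on a commutative `*`-algebra over `ℂ`. -/
structure IsPoissonBracket {𝒜 : Type*} [NonUnitalCommRing 𝒜] [StarRing 𝒜] [Module ℂ 𝒜]
    (br : 𝒜 → 𝒜 → 𝒜) : Prop where
  add_left : ∀ a b c, br (a + b) c = br a c + br b c
  smul_left : ∀ (z : ℂ) a b, br (z • a) b = z • br a b
  add_right : ∀ a b c, br a (b + c) = br a b + br a c
  smul_right : ∀ (z : ℂ) a b, br a (z • b) = z • br a b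
  antisymm : ∀ a b, br a b = -br b a
  real : ∀ a b, star (br a b) = br (star a) (star b)
  jacobi : ∀ a b c, br a (br b c) + br b (br c a) + br c (br a b) = 0
  leibniz : ∀ a b c, br a (b * c) = br a b * c + b * br a c

/-- The set `X` of functions on the phase space is a Poisson algebra for the bracket `br` of
functions: `X` is a `*`-subalgebra of the commutative `C*`-algebra of bounded weak-`*` continuous
functions on the phase space (hence dense in a commutative `C*`-algebra, its closure), and `br`
restricts to a Poisson bracket `X × X → X`. -/
def IsFunctionPoissonAlgebra {E : Type*} [AddCommGroup E] [Module ℝ E] [TopologicalSpace E]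
    (X : Set (WeakDual ℝ E → ℂ))
    (br : (WeakDual ℝ E → ℂ) → (WeakDual ℝ E → ℂ) → WeakDual ℝ E → ℂ) : Prop :=
  ∃ 𝒜 : NonUnitalStarSubalgebra ℂ (WeakDual ℝ E →ᵇ ℂ),
    (fun A : WeakDual ℝ E →ᵇ ℂ => (A : WeakDual ℝ E → ℂ)) '' (𝒜 : Set (WeakDual ℝ E →ᵇ ℂ)) = X ∧
    ∃ b : 𝒜 → 𝒜 → 𝒜, IsPoissonBracket b ∧
      ∀ A B : 𝒜, ((b A B : WeakDual ℝ E →ᵇ ℂ) : WeakDual ℝ E → ℂ) =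
        br (A : WeakDual ℝ E →ᵇ ℂ) (B : WeakDual ℝ E →ᵇ ℂ)

end WeylPoisson

open WeylPoisson

/-! The polar decomposition `μ = phase · |μ|` turns integrals against complex measures into Bochner
integrals against finite positive measures.

The obstacle is measurability. `E` need not be second countable, so continuity of addition does not
make it measurable for the product σ-algebra, and neither the joint measurability of `σ` nor the
strong measurability of the class map is automatic. The remedy is `mem_regularMeasures_iff`: `μ`
lies in `𝓜(E)` exactly when `|μ|` is carried by a subspace of countable dimension. Algebraic
coordinates of such a subspace are measurable, and through the Polish space of real sequences all
these maps become measurable almost everywhere.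

The calculus is done for the functions `fourierInt M T k`, that is `F ↦ ∫ e^{iF(T x)} k(x) dM(x)`.
This class is closed under directional derivatives, which multiply `k` by `i G([T x])`, and under
the Poisson bracket, which replaces `M`, `T`, `k` by the product measure, the sum and `σ(T, T') k
k'`. Each operation costs moments, counted by `HasMoments`. Differentiation along weak-`*`
differentiable curves is dominated convergence with a Banach–Steinhaus bound. The Jacobi identity
becomes a pointwise identity on a triple product. The other rules for the bracket follow from the
rules for total differentials.

For injectivity, countably many continuous functionals separate the carrying subspace. The image of
`μ` in the sequence space has vanishing characteristic function, hence is zero, and Lusin–Souslin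
carries this back to `E`.

Twisted convolution and Poisson bracket of measures are both convolutions with a kernel `Θ(σ(f,g))`
of at most linear growth. One stability notion, `IsStable`, therefore treats them together. Each
admissible `𝓟` is stable and lies in `𝓜^∞_ς(E)`, and `isFunctionPoissonAlgebra_of_isStable`
concludes. -/

namespace WeylPoisson

/-! ### Polar decomposition, densities and images of complex measures -/

section ComplexMeasures

variable {X Y : Type*} [MeasurableSpace X] [MeasurableSpace Y]

/-- The variation is the least positive measure dominating `|μ A|`, and the total variations of the
real and imaginary parts add up to a finite one. -/
instance isFiniteMeasure_variation (μ : ComplexMeasure X) : IsFiniteMeasure μ.variation := by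
  let p : Measure X := (ComplexMeasure.re μ).totalVariation + (ComplexMeasure.im μ).totalVariation
  have hp : μ.variation ≤ p := by
    refine VectorMeasure.variation_le_of_forall_enorm_le fun A hA => ?_
    have h1 : ‖μ A‖ₑ ≤ ‖(μ A).re‖ₑ + ‖(μ A).im‖ₑ := by
      rw [← ofReal_norm, ← ofReal_norm, ← ofReal_norm,
        ← ENNReal.ofReal_add (norm_nonneg _) (norm_nonneg _)]
      exact ENNReal.ofReal_le_ofReal (Complex.norm_le_abs_re_add_abs_im _)
    refine h1.trans (add_le_add ?_ ?_)
    · exact SignedMeasure.enorm_le_totalVariation (ComplexMeasure.re μ) A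
    · exact SignedMeasure.enorm_le_totalVariation (ComplexMeasure.im μ) A
  exact isFiniteMeasure_of_le p hp

/-- Let `ρ` be the Radon–Nikodym derivative of `μ` with respect to `|μ|`. The variation of `ρ · |μ|`
has density `|ρ|`, but it is `|μ|` itself, so `|ρ| = 1` almost everywhere. -/
lemma exists_phase (μ : ComplexMeasure X) :
    ∃ φ : X → ℂ, Measurable φ ∧ (∀ x, ‖φ x‖ = 1) ∧ μ.variation.withDensityᵥ φ = μ := by
  classical
  have hre : ComplexMeasure.re μ ≪ᵥ μ.variation.toENNRealVectorMeasure ∧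
      ComplexMeasure.im μ ≪ᵥ μ.variation.toENNRealVectorMeasure := by
    rw [← ComplexMeasure.absolutelyContinuous_ennreal_iff]
    refine VectorMeasure.AbsolutelyContinuous.mk fun A hA h => ?_
    rw [Measure.toENNRealVectorMeasure_apply_measurable hA] at h
    exact (VectorMeasure.variation_apply_eq_zero hA).1 h A subset_rfl hA
  let ρ := μ.rnDeriv μ.variation
  have hρ : Integrable ρ μ.variation := ComplexMeasure.integrable_rnDeriv μ μ.variation
  have hμ : μ.variation.withDensityᵥ ρ = μ := by
    have h1 := (SignedMeasure.absolutelyContinuous_iff_withDensityᵥ_rnDeriv_eq _ _).1 hre.1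
    have h2 := (SignedMeasure.absolutelyContinuous_iff_withDensityᵥ_rnDeriv_eq _ _).1 hre.2
    ext A hA
    rw [withDensityᵥ_apply hρ hA]
    apply Complex.ext
    · rw [← RCLike.re_eq_complex_re, ← integral_re hρ.integrableOn]
      have := congrArg (fun ν => ν A) h1
      rw [withDensityᵥ_apply (SignedMeasure.integrable_rnDeriv _ _) hA] at this
      exact this
    · rw [← RCLike.im_eq_complex_im, ← integral_im hρ.integrableOn]
      have := congrArg (fun ν => ν A) h2
      rw [withDensityᵥ_apply (SignedMeasure.integrable_rnDeriv _ _) hA] at this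
      exact this
  have hρm : Measurable ρ := by
    have h1 := SignedMeasure.measurable_rnDeriv (ComplexMeasure.re μ) μ.variation
    have h2 := SignedMeasure.measurable_rnDeriv (ComplexMeasure.im μ) μ.variation
    exact Complex.measurableEquivRealProd.symm.measurable.comp (h1.prodMk h2)
  have hone : ∀ᵐ x ∂μ.variation, ‖ρ x‖ = 1 := by
    have h1 : μ.variation.withDensity (fun x => ‖ρ x‖ₑ) = μ.variation.withDensity 1 := by
      rw [← Measure.variation_withDensityᵥ hρ, hμ, withDensity_one]
    have h2 := (withDensity_eq_iff hρm.enorm.aemeasurable measurable_one.aemeasurable hρ.2.ne).1 h1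
    filter_upwards [h2] with x hx
    rw [← ofReal_norm, Pi.one_apply, ENNReal.ofReal_eq_one] at hx
    exact hx
  -- The value 1 on the exceptional null set gives modulus one at every point, which later makes
  -- division by the phase harmless.
  refine ⟨fun x => if ‖ρ x‖ = 1 then ρ x else 1, ?_, fun x => ?_, ?_⟩
  · exact Measurable.ite (hρm.norm (measurableSet_singleton 1)) hρm measurable_const
  · dsimp only
    split_ifs with h
    exacts [h, norm_one]
  · rw [← WithDensityᵥEq.congr_ae (f := ρ), hμ]
    filter_upwards [hone] with x hx
    rw [if_pos hx]

/-- The density of modulus one in the polar decomposition `μ = phase · |μ|`. -/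
noncomputable def phase (μ : ComplexMeasure X) : X → ℂ := (exists_phase μ).choose

lemma measurable_phase (μ : ComplexMeasure X) : Measurable (phase μ) :=
  (exists_phase μ).choose_spec.1

@[simp] lemma norm_phase (μ : ComplexMeasure X) (x : X) : ‖phase μ x‖ = 1 :=
  (exists_phase μ).choose_spec.2.1 x

lemma withDensity_phase (μ : ComplexMeasure X) : μ.variation.withDensityᵥ (phase μ) = μ :=
  (exists_phase μ).choose_spec.2.2

lemma phase_ne_zero (μ : ComplexMeasure X) (x : X) : phase μ x ≠ 0 := by
  rw [← norm_ne_zero_iff, norm_phase]; exact one_ne_zero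

lemma integrable_mul_phase_iff (μ : ComplexMeasure X) {h : X → ℂ} :
    Integrable (fun x => h x * phase μ x) μ.variation ↔ Integrable h μ.variation := by
  have hb (ψ : X → ℂ) (hψ : Measurable ψ) (hn : ∀ x, ‖ψ x‖ = 1) {g : X → ℂ}
      (hg : Integrable g μ.variation) : Integrable (fun x => g x * ψ x) μ.variation := by
    refine hg.mono (hg.aestronglyMeasurable.mul hψ.aestronglyMeasurable) (ae_of_all _ fun x => ?_)
    rw [norm_mul, hn, mul_one]
  refine ⟨fun hi => ?_, hb _ (measurable_phase μ) (norm_phase μ)⟩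
  have := hb (fun x => (phase μ x)⁻¹) (measurable_phase μ).inv (fun x => by simp) hi
  simpa [mul_assoc, phase_ne_zero] using this

lemma integrable_phase (μ : ComplexMeasure X) : Integrable (phase μ) μ.variation := by
  simpa using (integrable_mul_phase_iff μ (h := fun _ => 1)).2 (integrable_const _)

section Pairing

variable {V G : Type*} [NormedAddCommGroup V] [NormedSpace ℝ V] [NormedAddCommGroup G]
  [NormedSpace ℝ G] [CompleteSpace G]

/-- Integration against a complex measure with a density. -/
lemma integral_withDensityᵥ_pairing {M : Measure X} {k : X → ℂ} (hk : Integrable k M)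
    (B : V →L[ℝ] ℂ →L[ℝ] G) {h : X → V} (hh : (M.withDensityᵥ k).Integrable h) :
    (M.withDensityᵥ k).integral h B = ∫ x, B (h x) (k x) ∂M := by
  set ν : ComplexMeasure X := M.withDensityᵥ k with hν
  have hvar : ν.variation = M.withDensity fun x => ‖k x‖ₑ := Measure.variation_withDensityᵥ hk
  -- Since `|ν| = |k| · M`, the right-hand side is continuous in the `L¹(|ν|)` norm; the induction
  -- then needs the identity only for indicators.
  have key (g : X → V) (hg : Integrable g ν.variation) :
      Integrable (fun x => B (g x) (k x)) M ∧
        ‖∫ x, B (g x) (k x) ∂M‖ₑ ≤ ‖B‖ₑ * ∫⁻ x, ‖g x‖ₑ ∂ν.variation := by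
    obtain ⟨g', hg', hgg'⟩ := hg.aestronglyMeasurable
    -- A `|ν|`-null set need be `M`-null only where `k ≠ 0`; elsewhere the integrand vanishes
    -- anyway.
    have hae : ∀ᵐ x ∂M, k x ≠ 0 → g x = g' x := by
      rw [hvar] at hgg'
      have := (ae_withDensity_iff' hk.aestronglyMeasurable.enorm).1 hgg'
      filter_upwards [this] with x hx hx0
      exact hx (by simpa using hx0)
    have hae' : (fun x => B (g x) (k x)) =ᵐ[M] fun x => B (g' x) (k x) := by
      filter_upwards [hae] with x hx
      by_cases h0 : k x = 0
      · simp [h0]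
      · rw [hx h0]
    have hm : AEStronglyMeasurable (fun x => B (g x) (k x)) M := by
      refine AEStronglyMeasurable.congr ?_ hae'.symm
      exact B.aestronglyMeasurable_comp₂ hg'.aestronglyMeasurable hk.aestronglyMeasurable
    have hle : ∫⁻ x, ‖B (g x) (k x)‖ₑ ∂M ≤ ‖B‖ₑ * ∫⁻ x, ‖g x‖ₑ ∂ν.variation := by
      have e1 : ∫⁻ x, ‖g x‖ₑ ∂ν.variation = ∫⁻ x, ‖k x‖ₑ * ‖g x‖ₑ ∂M := by
        rw [hvar, lintegral_withDensity_eq_lintegral_mul₀' hk.aestronglyMeasurable.enorm]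
        · rfl
        · rw [← hvar]; exact hg.aestronglyMeasurable.enorm
      rw [e1, ← lintegral_const_mul' _ _ (by simp)]
      refine lintegral_mono fun x => ?_
      calc ‖B (g x) (k x)‖ₑ ≤ ‖B‖ₑ * ‖g x‖ₑ * ‖k x‖ₑ := B.le_opENorm₂ _ _
        _ = _ := by ring
    refine ⟨⟨hm, lt_of_le_of_lt hle (ENNReal.mul_lt_top (by simp) hg.2)⟩, ?_⟩
    exact (enorm_integral_le_lintegral_enorm _).trans hle
  refine Integrable.induction (fun g => ν.integral g B = ∫ x, B (g x) (k x) ∂M)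
    ?_ ?_ ?_ ?_ hh
  · intro c A hA _
    rw [VectorMeasure.integral_indicator hA, VectorMeasure.setIntegral_const, hν,
      withDensityᵥ_apply hk hA, ← (B c).integral_comp_comm hk.integrableOn,
      ← integral_indicator hA]
    refine integral_congr_ae (ae_of_all _ fun x => ?_)
    by_cases hx : x ∈ A <;> simp [hx]
  · intro f g _ hf hg h1 h2
    rw [VectorMeasure.integral_add hf hg, h1, h2, ← integral_add (key f hf).1 (key g hg).1]
    simp
  · refine isClosed_eq VectorMeasure.continuous_integral ?_
    let L : (X →₁[ν.variation] V) →+ G :=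
      { toFun := fun f => ∫ x, B (f x) (k x) ∂M
        map_zero' := by
          rw [← enorm_eq_zero, ← nonpos_iff_eq_zero]
          refine (key _ (L1.integrable_coeFn _)).2.trans ?_
          rw [lintegral_congr_ae (g := fun _ => 0)]
          · simp
          · filter_upwards [Lp.coeFn_zero V 1 ν.variation] with x hx
            exact (congrArg enorm hx).trans enorm_zero
        map_add' := fun f g => by
          rw [← integral_add (key _ (L1.integrable_coeFn f)).1 (key _ (L1.integrable_coeFn g)).1,
            ← sub_eq_zero]
          have hd : (fun x => B ((f + g : X →₁[ν.variation] V) x) (k x)) =ᵐ[M]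
              fun x => B (f x) (k x) + B (g x) (k x) := by
            have h1 := Lp.coeFn_add f g
            have hfg : ∀ᵐ x ∂M, k x ≠ 0 → (f + g : X →₁[ν.variation] V) x = f x + g x := by
              have h1' : ∀ᵐ x ∂(M.withDensity fun x => ‖k x‖ₑ),
                  (f + g : X →₁[ν.variation] V) x = f x + g x := by
                rw [← hvar]; exact h1
              filter_upwards [(ae_withDensity_iff' hk.aestronglyMeasurable.enorm).1 h1'] with x hx h0
              exact hx (by simpa using h0)
            filter_upwards [hfg] with x hx
            by_cases h0 : k x = 0
            · simp [h0]
            · rw [hx h0]; simp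
          rw [integral_congr_ae hd, sub_self] }
    refine AddMonoidHomClass.continuous_of_bound L ‖B‖ fun f => ?_
    have h1 := (key _ (L1.integrable_coeFn f)).2
    rw [← L1.ofReal_norm_eq_lintegral, ← ofReal_norm, ← ofReal_norm,
      ← ENNReal.ofReal_mul (norm_nonneg _)] at h1
    exact (ENNReal.ofReal_le_ofReal_iff (by positivity)).1 h1
  · intro f g hfg hf h1
    have h2 : (fun x => B (f x) (k x)) =ᵐ[M] fun x => B (g x) (k x) := by
      rw [hvar] at hfg
      filter_upwards [(ae_withDensity_iff' hk.aestronglyMeasurable.enorm).1 hfg] with x hx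
      by_cases h0 : k x = 0
      · simp [h0]
      · rw [hx (by simpa using h0)]
    rw [← VectorMeasure.integral_congr_ae hfg, h1, integral_congr_ae h2]

lemma integral_pairing_eq (μ : ComplexMeasure X) (B : V →L[ℝ] ℂ →L[ℝ] G) {h : X → V}
    (hh : μ.Integrable h) :
    μ.integral h B = ∫ x, B (h x) (phase μ x) ∂μ.variation := by
  have := integral_withDensityᵥ_pairing (integrable_phase μ) B (h := h)
    (by rw [withDensity_phase]; exact hh)
  rwa [withDensity_phase] at this

end Pairing

lemma integral_mul_eq (μ : ComplexMeasure X) (h : X → ℂ) :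
    μ.integral h (ContinuousLinearMap.mul ℝ ℂ) = ∫ x, h x * phase μ x ∂μ.variation := by
  by_cases hh : μ.Integrable h
  · exact integral_pairing_eq μ _ hh
  · rw [VectorMeasure.integral_undef hh, integral_undef]
    rwa [integrable_mul_phase_iff]

/-- The image under `T` of the complex measure with density `k`. -/
noncomputable def pushDensity (M : Measure X) (k : X → ℂ) {T : X → Y} (hT : AEMeasurable T M) :
    ComplexMeasure Y :=
  (M.withDensityᵥ k).map (hT.mk T)

section pushDensity

variable {M : Measure X} {k : X → ℂ} {T : X → Y} (hT : AEMeasurable T M) (hk : Integrable k M)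

include hk

lemma pushDensity_apply {A : Set Y} (hA : MeasurableSet A) :
    pushDensity M k hT A = ∫ x, A.indicator (fun _ => (1 : ℂ)) (T x) * k x ∂M := by
  rw [pushDensity, VectorMeasure.map_apply _ hT.measurable_mk hA,
    withDensityᵥ_apply hk (hT.measurable_mk hA), ← integral_indicator (hT.measurable_mk hA)]
  refine integral_congr_ae ?_
  filter_upwards [hT.ae_eq_mk] with x hx
  by_cases h : hT.mk T x ∈ A
  · simp [h, hx]
  · simp [h, hx]

/-- Fibres of `T` may produce cancellations, so the variation of the image is only dominated by the
image of the variation. This suffices for moments and null sets. -/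
lemma lintegral_variation_pushDensity_le {h : Y → ℝ≥0∞} (hh : Measurable h) :
    ∫⁻ y, h y ∂(pushDensity M k hT).variation ≤ ∫⁻ x, h (T x) * ‖k x‖ₑ ∂M := by
  calc ∫⁻ y, h y ∂(pushDensity M k hT).variation
      ≤ ∫⁻ y, h y ∂((M.withDensityᵥ k).variation.map (hT.mk T)) :=
        lintegral_mono' VectorMeasure.variation_map_le le_rfl
    _ = ∫⁻ x, ‖k x‖ₑ * h (hT.mk T x) ∂M := by
        rw [lintegral_map hh hT.measurable_mk, Measure.variation_withDensityᵥ hk,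
          lintegral_withDensity_eq_lintegral_mul₀' hk.aestronglyMeasurable.enorm
            (g := fun x => h (hT.mk T x)) (hh.comp hT.measurable_mk).aemeasurable]
        rfl
    _ = ∫⁻ x, h (T x) * ‖k x‖ₑ ∂M := by
        refine lintegral_congr_ae ?_
        filter_upwards [hT.ae_eq_mk] with x hx
        rw [hx, mul_comm]

lemma variation_pushDensity_eq_zero {A : Set Y} (hA : MeasurableSet A)
    (h : ∀ᵐ x ∂M, T x ∉ A) : (pushDensity M k hT).variation A = 0 := by
  rw [← lintegral_indicator_one hA, ← nonpos_iff_eq_zero]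
  refine (lintegral_variation_pushDensity_le hT hk (measurable_one.indicator hA)).trans ?_
  rw [lintegral_congr_ae (g := fun _ => 0)]
  · simp
  · filter_upwards [h] with x hx
    simp [hx]

lemma integral_pushDensity {h : Y → ℂ} (hh : Measurable h)
    (hi : Integrable (fun x => h (T x) * k x) M) :
    (pushDensity M k hT).integral h (ContinuousLinearMap.mul ℝ ℂ) = ∫ x, h (T x) * k x ∂M := by
  have hvi : (M.withDensityᵥ k).Integrable (h ∘ hT.mk T) := by
    refine ⟨(hh.comp hT.measurable_mk).aestronglyMeasurable, ?_⟩
    rw [HasFiniteIntegral, Measure.variation_withDensityᵥ hk,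
      lintegral_withDensity_eq_lintegral_mul₀' hk.aestronglyMeasurable.enorm
        (hh.comp hT.measurable_mk).enorm.aemeasurable]
    refine lt_of_le_of_lt (le_of_eq (lintegral_congr_ae ?_)) hi.2
    filter_upwards [hT.ae_eq_mk] with x hx
    simp only [Pi.mul_apply, Function.comp_apply, enorm_mul]
    rw [hx, mul_comm]
  rw [pushDensity, VectorMeasure.integral_map hT.measurable_mk hh.aestronglyMeasurable hvi]
  refine (integral_withDensityᵥ_pairing hk _ hvi).trans (integral_congr_ae ?_)
  filter_upwards [hT.ae_eq_mk] with x hx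
  simp [hx]

end pushDensity

lemma ext_pushDensity (μ : ComplexMeasure X) :
    pushDensity μ.variation (phase μ) (T := id) aemeasurable_id = μ := by
  ext A hA
  rw [pushDensity_apply _ (integrable_phase μ) hA]
  conv_rhs => rw [← withDensity_phase μ, withDensityᵥ_apply (integrable_phase μ) hA,
    ← integral_indicator hA]
  refine integral_congr_ae (ae_of_all _ fun x => ?_)
  by_cases h : x ∈ A <;> simp [h]

end ComplexMeasures

/-! ### Measurability for the finest locally convex topology -/

section FinestTopology

variable {E : Type*} [AddCommGroup E] [Module ℝ E]

lemma isTopologicalAddGroup_finest : @IsTopologicalAddGroup E (finestLocallyConvexTopology E) _ :=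
  topologicalAddGroup_sInf fun _ ht => ht.1

lemma continuousSMul_finest : @ContinuousSMul ℝ E _ _ (finestLocallyConvexTopology E) :=
  continuousSMul_sInf fun _ ht => ht.2.1

lemma finest_le_seminorm (p : Seminorm ℝ E) :
    finestLocallyConvexTopology E ≤
      (UniformSpace.toTopologicalSpace : TopologicalSpace (SeminormSpace p)) :=
  sInf_le ⟨inferInstanceAs (IsTopologicalAddGroup (SeminormSpace p)),
    inferInstanceAs (ContinuousSMul ℝ (SeminormSpace p)),
    inferInstanceAs (LocallyConvexSpace ℝ (SeminormSpace p))⟩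

/-- The semi-norm `‖L x‖` defines one of the locally convex topologies that the finest one refines.
-/
lemma continuous_linearMap_finest {V : Type*} [SeminormedAddCommGroup V] [NormedSpace ℝ V]
    (L : E →ₗ[ℝ] V) : @Continuous E V (finestLocallyConvexTopology E) _ L := by
  let p : Seminorm ℝ E := (normSeminorm ℝ V).comp L
  refine continuous_le_dom (finest_le_seminorm p) ?_
  let L' : SeminormSpace p →+ V := L.toAddMonoidHom
  refine AddMonoidHomClass.continuous_of_bound L' 1 fun x => ?_
  rw [one_mul]
  exact le_rfl

lemma continuous_seminorm_finest (p : Seminorm ℝ E) :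
    @Continuous E ℝ (finestLocallyConvexTopology E) _ p :=
  continuous_le_dom (finest_le_seminorm p) (continuous_norm (E := SeminormSpace p))

/-- A subspace is the intersection of the kernels of the algebraic functionals that vanish on it,
and all of these are continuous here. -/
lemma isClosed_submodule_finest (S : Submodule ℝ E) :
    @IsClosed E (finestLocallyConvexTopology E) S := by
  let _ := finestLocallyConvexTopology E
  have : (S : Set E) = ⋂ l ∈ S.dualAnnihilator, {x | l x = 0} := by
    ext x
    conv_lhs => rw [← Subspace.dualAnnihilator_dualCoannihilator_eq (W := S)]
    simp only [Submodule.mem_dualCoannihilator, Set.mem_iInter, Set.mem_ofPred_eq, SetLike.mem_coe]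
  rw [this]
  exact isClosed_biInter fun l _ => isClosed_eq (continuous_linearMap_finest l) continuous_const

variable [MeasurableSpace E] [FinestBorelSpace E]

lemma borelSpace_finest : @BorelSpace E (finestLocallyConvexTopology E) _ :=
  @BorelSpace.mk E (finestLocallyConvexTopology E) _ FinestBorelSpace.measurable_eq

lemma measurable_linearMap {V : Type*} [SeminormedAddCommGroup V] [NormedSpace ℝ V]
    [MeasurableSpace V] [BorelSpace V] (L : E →ₗ[ℝ] V) : Measurable L := by
  let _ := finestLocallyConvexTopology E
  have := borelSpace_finest (E := E)
  exact (continuous_linearMap_finest L).measurable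

lemma measurable_seminorm (p : Seminorm ℝ E) : Measurable p := by
  let _ := finestLocallyConvexTopology E
  have := borelSpace_finest (E := E)
  exact (continuous_seminorm_finest p).measurable

lemma measurableSet_submodule (S : Submodule ℝ E) : MeasurableSet (S : Set E) := by
  let _ := finestLocallyConvexTopology E
  have := borelSpace_finest (E := E)
  exact (isClosed_submodule_finest S).measurableSet

lemma measurable_const_add_finest (x : E) : Measurable fun y => x + y := by
  let _ := finestLocallyConvexTopology E
  have := borelSpace_finest (E := E)
  have := isTopologicalAddGroup_finest (E := E)
  exact (continuous_const.add continuous_id).measurable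

lemma measurable_neg_finest : Measurable fun y : E => -y := by
  let _ := finestLocallyConvexTopology E
  have := borelSpace_finest (E := E)
  have := isTopologicalAddGroup_finest (E := E)
  exact continuous_neg.measurable

instance measurableSingletonClass_finest : MeasurableSingletonClass E where
  measurableSet_singleton x := by
    have h := measurable_const_add_finest (-x) (measurableSet_submodule (⊥ : Submodule ℝ E))
    convert h using 1
    ext y
    simp [eq_comm]

lemma measurable_sum_smul (b : ℕ → E) (n : ℕ) :
    Measurable fun x : ℕ → ℝ => ∑ i ∈ Finset.range n, x i • b i := by
  let _ := finestLocallyConvexTopology E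
  have := borelSpace_finest (E := E)
  have := isTopologicalAddGroup_finest (E := E)
  have := continuousSMul_finest (E := E)
  refine Continuous.measurable ?_
  fun_prop

end FinestTopology

/-! ### Measurable coordinates on subspaces of countable dimension -/

section Coordinates

variable {E : Type*} [AddCommGroup E] [Module ℝ E]

/-- A linear section of `x ↦ ∑ xᵢ bᵢ` exists on its range and extends algebraically to `E`. No
continuity for `τ` is needed, because every linear functional is Borel for the finest topology. -/
lemma exists_coordinates (b : ℕ → E) : ∃ c : E →ₗ[ℝ] (ℕ →₀ ℝ),
    ∀ f ∈ Submodule.span ℝ (Set.range b), Finsupp.linearCombination ℝ b (c f) = f := by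
  have hr := Finsupp.range_linearCombination (R := ℝ) (v := b)
  obtain ⟨s, hs⟩ := (Finsupp.linearCombination ℝ b).rangeRestrict.exists_rightInverse_of_surjective
    (LinearMap.range_rangeRestrict _)
  obtain ⟨c, hc⟩ := s.exists_extend
  refine ⟨c, fun f hf => ?_⟩
  rw [← hr] at hf
  have h1 : c f = s ⟨f, hf⟩ := DFunLike.congr_fun hc (⟨f, hf⟩ : LinearMap.range _)
  rw [h1]
  exact congrArg Subtype.val (DFunLike.congr_fun hs ⟨f, hf⟩)

/-- Coordinates of a vector with respect to a spanning sequence `b` of a subspace. -/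
noncomputable def coords (b : ℕ → E) : E →ₗ[ℝ] (ℕ →₀ ℝ) := (exists_coordinates b).choose

lemma linearCombination_coords {b : ℕ → E} {f : E} (hf : f ∈ Submodule.span ℝ (Set.range b)) :
    Finsupp.linearCombination ℝ b (coords b f) = f := (exists_coordinates b).choose_spec f hf

lemma eventually_sum_coords {V : Type*} [AddCommGroup V] [Module ℝ V] (L : E →ₗ[ℝ] V) {b : ℕ → E}
    {f : E} (hf : f ∈ Submodule.span ℝ (Set.range b)) :
    ∀ᶠ n in Filter.atTop, ∑ i ∈ Finset.range n, coords b f i • L (b i) = L f := by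
  obtain ⟨N, hN⟩ := (coords b f).support.exists_nat_subset_range
  filter_upwards [Filter.eventually_ge_atTop N] with n hn
  conv_rhs => rw [← linearCombination_coords hf, Finsupp.linearCombination_apply,
    Finsupp.sum_of_support_subset (s := Finset.range n) _
      (hN.trans (Finset.range_mono hn)) _ (by simp), map_sum]
  simp

open Classical in
/-- A measurable left inverse of the coordinates: it sends a finitely supported sequence `x` to
`∑ xᵢ bᵢ`, and all other sequences to `0`. -/
noncomputable def synthesis (b : ℕ → E) (x : ℕ → ℝ) : E :=
  if h : ∃ n, ∀ i, n ≤ i → x i = 0 then ∑ i ∈ Finset.range h.choose, x i • b i else 0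

lemma synthesis_eq_sum {b : ℕ → E} {x : ℕ → ℝ} {n : ℕ} (hn : ∀ i, n ≤ i → x i = 0) :
    synthesis b x = ∑ i ∈ Finset.range n, x i • b i := by
  have h : ∃ n, ∀ i, n ≤ i → x i = 0 := ⟨n, hn⟩
  rw [synthesis, dif_pos h]
  have key (m : ℕ) (hm : ∀ i, m ≤ i → x i = 0) :
      ∑ i ∈ Finset.range m, x i • b i = ∑ i ∈ Finset.range (max m n), x i • b i := by
    refine Finset.sum_subset (Finset.range_mono (le_max_left _ _)) fun i _ hi => ?_
    rw [hm i (by simpa using hi), zero_smul]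
  rw [key _ h.choose_spec]
  symm
  refine Finset.sum_subset (Finset.range_mono (le_max_right _ _)) fun i _ hi => ?_
  rw [hn i (by simpa using hi), zero_smul]

lemma synthesis_finsupp (b : ℕ → E) (x : ℕ →₀ ℝ) :
    synthesis b x = Finsupp.linearCombination ℝ b x := by
  obtain ⟨N, hN⟩ := x.support.exists_nat_subset_range
  rw [synthesis_eq_sum (n := N), Finsupp.linearCombination_apply,
    Finsupp.sum_of_support_subset (s := Finset.range N) _ hN _ (by simp)]
  intro i hi
  by_contra h
  exact absurd (Finset.mem_range.1 (hN (Finsupp.mem_support_iff.2 h))) (by omega)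

lemma synthesis_mem_span (b : ℕ → E) (x : ℕ → ℝ) :
    synthesis b x ∈ Submodule.span ℝ (Set.range b) := by
  rw [synthesis]
  split_ifs
  · exact Submodule.sum_mem _ fun i _ =>
      Submodule.smul_mem _ _ (Submodule.subset_span ⟨i, rfl⟩)
  · exact Submodule.zero_mem _

variable [MeasurableSpace E] [FinestBorelSpace E]

lemma measurable_coords (b : ℕ → E) : Measurable fun f i => coords b f i :=
  measurable_pi_lambda _ fun i => measurable_linearMap ((Finsupp.lapply i).comp (coords b))

/-- Sequences are sorted by a length beyond which they vanish; for a fixed length the map is a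
finite sum, continuous in the finest topology. -/
lemma measurable_synthesis (b : ℕ → E) : Measurable (synthesis b) := by
  intro A hA
  have hD (n : ℕ) : MeasurableSet {x : ℕ → ℝ | ∀ i, n ≤ i → x i = 0} := by
    simp only [Set.ofPred_forall]
    exact MeasurableSet.iInter fun i => MeasurableSet.iInter fun _ =>
      measurable_pi_apply i (measurableSet_singleton 0)
  have : synthesis b ⁻¹' A =
      (⋃ n, {x | ∀ i, n ≤ i → x i = 0} ∩ (fun x => ∑ i ∈ Finset.range n, x i • b i) ⁻¹' A) ∪
        ((⋃ n, {x | ∀ i, n ≤ i → x i = 0})ᶜ ∩ {_x | (0 : E) ∈ A}) := by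
    ext x
    by_cases h : ∃ n, ∀ i, n ≤ i → x i = 0
    · obtain ⟨n, hn⟩ := h
      simp only [Set.mem_preimage, Set.mem_union, Set.mem_iUnion, Set.mem_inter_iff,
        Set.mem_ofPred_eq, Set.mem_compl_iff]
      constructor
      · intro hx
        rw [synthesis_eq_sum hn] at hx
        exact Or.inl ⟨n, hn, hx⟩
      · rintro (⟨m, hm, hx⟩ | ⟨h1, -⟩)
        · rwa [synthesis_eq_sum hm]
        · exact absurd ⟨n, hn⟩ h1
    · have h0 : synthesis b x = 0 := by rw [synthesis, dif_neg h]
      simp only [Set.mem_preimage, Set.mem_union, Set.mem_iUnion, Set.mem_inter_iff,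
        Set.mem_ofPred_eq, Set.mem_compl_iff, h0]
      push Not at h
      constructor
      · intro hx
        exact Or.inr ⟨by push Not; exact h, hx⟩
      · rintro (⟨m, hm, -⟩ | ⟨-, h1⟩)
        · obtain ⟨i, hi, hi'⟩ := h m
          exact absurd (hm i hi) hi'
        · exact h1
  rw [this]
  exact (MeasurableSet.iUnion fun n => (hD n).inter (measurable_sum_smul b n hA)).union
    ((MeasurableSet.iUnion hD).compl.inter (MeasurableSet.const _))

end Coordinates

/-! ### Maps carried by subspaces of countable dimension -/

section Carried

variable {E : Type*} [AddCommGroup E] [Module ℝ E]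
  {X Y : Type*} [MeasurableSpace X] [MeasurableSpace Y]

/-- `T` takes almost all its values in a subspace of countable dimension. -/
def CountablyCarried (M : Measure X) (T : X → E) : Prop :=
  ∃ b : ℕ → E, ∀ᵐ x ∂M, T x ∈ Submodule.span ℝ (Set.range b)

lemma exists_seq_span_sup (b b' : ℕ → E) : ∃ d : ℕ → E,
    Submodule.span ℝ (Set.range b) ≤ Submodule.span ℝ (Set.range d) ∧
    Submodule.span ℝ (Set.range b') ≤ Submodule.span ℝ (Set.range d) := by
  refine ⟨fun n => Sum.elim b b' (Equiv.natSumNatEquivNat.symm n), ?_, ?_⟩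
  · refine Submodule.span_mono ?_
    rintro _ ⟨i, rfl⟩
    exact ⟨Equiv.natSumNatEquivNat (Sum.inl i), by simp⟩
  · refine Submodule.span_mono ?_
    rintro _ ⟨i, rfl⟩
    exact ⟨Equiv.natSumNatEquivNat (Sum.inr i), by simp⟩

lemma CountablyCarried.exists_common {M : Measure X} {N : Measure Y} {T : X → E} {T' : Y → E}
    (h : CountablyCarried M T) (h' : CountablyCarried N T') :
    ∃ b : ℕ → E, (∀ᵐ x ∂M, T x ∈ Submodule.span ℝ (Set.range b)) ∧
      ∀ᵐ y ∂N, T' y ∈ Submodule.span ℝ (Set.range b) := by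
  obtain ⟨b, hb⟩ := h
  obtain ⟨b', hb'⟩ := h'
  obtain ⟨d, hd, hd'⟩ := exists_seq_span_sup b b'
  exact ⟨d, hb.mono fun _ hx => hd hx, hb'.mono fun _ hx => hd' hx⟩

lemma ae_prod_of_ae {M : Measure X} {N : Measure Y} [SFinite N] {p : X → Prop} {q : Y → Prop}
    (hp : ∀ᵐ x ∂M, p x) (hq : ∀ᵐ y ∂N, q y) : ∀ᵐ z ∂M.prod N, p z.1 ∧ q z.2 :=
  (Measure.quasiMeasurePreserving_fst.ae hp).and (Measure.quasiMeasurePreserving_snd.ae hq)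

lemma CountablyCarried.add {M : Measure X} {N : Measure Y} [SFinite N] {T : X → E}
    {T' : Y → E} (h : CountablyCarried M T) (h' : CountablyCarried N T') :
    CountablyCarried (M.prod N) fun z => T z.1 + T' z.2 := by
  obtain ⟨b, hb, hb'⟩ := h.exists_common h'
  refine ⟨b, ?_⟩
  filter_upwards [ae_prod_of_ae hb hb'] with z hz
  exact Submodule.add_mem _ hz.1 hz.2

variable [MeasurableSpace E] [FinestBorelSpace E]

/-- The sum is formed in coordinates, where addition is measurable, and mapped back by `synthesis`.
This agrees with the sum in `E` almost everywhere. -/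
lemma CountablyCarried.aemeasurable_add {M : Measure X} {N : Measure Y} [SFinite M] [SFinite N]
    {T : X → E} {T' : Y → E} (h : CountablyCarried M T) (h' : CountablyCarried N T')
    (hT : AEMeasurable T M) (hT' : AEMeasurable T' N) :
    AEMeasurable (fun z : X × Y => T z.1 + T' z.2) (M.prod N) := by
  obtain ⟨b, hb, hb'⟩ := h.exists_common h'
  have hm : AEMeasurable (fun z : X × Y => synthesis b fun i =>
      coords b (T z.1) i + coords b (T' z.2) i) (M.prod N) := by
    refine (measurable_synthesis b).comp_aemeasurable (aemeasurable_pi_lambda _ fun i => ?_)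
    have hi := measurable_linearMap ((Finsupp.lapply (R := ℝ) i).comp (coords b))
    exact ((hi.comp_aemeasurable hT).comp_quasiMeasurePreserving
      Measure.quasiMeasurePreserving_fst).add ((hi.comp_aemeasurable hT').comp_quasiMeasurePreserving
      Measure.quasiMeasurePreserving_snd)
  refine hm.congr ?_
  filter_upwards [ae_prod_of_ae hb hb'] with z hz
  have : (fun i => coords b (T z.1) i + coords b (T' z.2) i) =
      ⇑(coords b (T z.1) + coords b (T' z.2)) := rfl
  rw [this, synthesis_finsupp, map_add, linearCombination_coords hz.1,
    linearCombination_coords hz.2]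

/-- Although `V` may be nonseparable, `L (T x)` is almost everywhere the eventually constant limit
of sums of measurable scalars times fixed vectors. -/
lemma CountablyCarried.aestronglyMeasurable_linearMap {M : Measure X} {T : X → E}
    (h : CountablyCarried M T) (hT : AEMeasurable T M) {V : Type*} [NormedAddCommGroup V]
    [NormedSpace ℝ V] (L : E →ₗ[ℝ] V) : AEStronglyMeasurable (fun x => L (T x)) M := by
  obtain ⟨b, hb⟩ := h
  refine aestronglyMeasurable_of_tendsto_ae Filter.atTop
    (f := fun n x => ∑ i ∈ Finset.range n, coords b (T x) i • L (b i)) (fun n => ?_) ?_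
  · refine Finset.aestronglyMeasurable_fun_sum _ fun i _ => ?_
    have hi := measurable_linearMap ((Finsupp.lapply (R := ℝ) i).comp (coords b))
    exact (hi.comp_aemeasurable hT).aestronglyMeasurable.smul_const _
  · filter_upwards [hb] with x hx
    exact tendsto_const_nhds.congr' ((eventually_sum_coords L hx).mono fun _ h => h.symm)

/-- Only the first argument is expanded: the second one enters through the measurable functionals
`σ(bᵢ, ·)`, so `T'` need not be carried. -/
lemma CountablyCarried.aemeasurable_bilin {M : Measure X} {N : Measure Y} [SFinite M] [SFinite N]
    {T : X → E} {T' : Y → E} (h : CountablyCarried M T)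
    (hT : AEMeasurable T M) (hT' : AEMeasurable T' N) (σ : LinearMap.BilinForm ℝ E) :
    AEMeasurable (fun z : X × Y => σ (T z.1) (T' z.2)) (M.prod N) := by
  obtain ⟨b, hb⟩ := h
  refine aemeasurable_of_tendsto_metrizable_ae Filter.atTop
    (f := fun n z => ∑ i ∈ Finset.range n, coords b (T z.1) i • σ (b i) (T' z.2)) (fun n => ?_) ?_
  · refine Finset.aemeasurable_fun_sum _ fun i _ => ?_
    have hi := measurable_linearMap ((Finsupp.lapply (R := ℝ) i).comp (coords b))
    exact ((hi.comp_aemeasurable hT).comp_quasiMeasurePreserving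
      Measure.quasiMeasurePreserving_fst).smul
      (((measurable_linearMap (σ (b i))).comp_aemeasurable hT').comp_quasiMeasurePreserving
      Measure.quasiMeasurePreserving_snd)
  · filter_upwards [Measure.quasiMeasurePreserving_fst.ae hb] with z hz
    refine tendsto_const_nhds.congr' ((eventually_sum_coords (σ.flip (T' z.2)) hz).mono ?_)
    intro n h
    simpa using h.symm

end Carried

/-! ### Intrinsic descriptions of the spaces of measures -/

section Concentrated

variable {E : Type*} [MeasurableSpace E]

lemma concentratedOn_iff {μ : ComplexMeasure E} {S : Set E} (hS : MeasurableSet S) :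
    ConcentratedOn μ S ↔ ∀ᵐ f ∂μ.variation, f ∈ S := by
  rw [ae_iff, show {a | a ∉ S} = Sᶜ from rfl, VectorMeasure.variation_apply_eq_zero hS.compl]
  refine ⟨fun h t ht htm => h t htm ?_, fun h A hA hd => h A ?_ hA⟩
  · exact Set.disjoint_left.2 fun x hx => ht hx
  · exact fun x hx => Set.disjoint_left.1 hd hx

lemma norm_sub_apply_lt {μ ν : ComplexMeasure E} {ε : ℝ≥0∞}
    (h : (μ - ν).variation Set.univ < ε) (A : Set E) : ‖μ A - ν A‖ₑ < ε :=
  calc ‖μ A - ν A‖ₑ = ‖(μ - ν) A‖ₑ := by simp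
    _ ≤ (μ - ν).variation A := VectorMeasure.enorm_measure_le_variation _ _
    _ ≤ (μ - ν).variation Set.univ := measure_mono (Set.subset_univ _)
    _ < ε := h

/-- A measure carried by a set that each approximating measure avoids vanishes there. -/
lemma apply_eq_zero_of_forall_exists {μ : ComplexMeasure E} {A : Set E}
    (h : ∀ ε : ℝ≥0∞, 0 < ε → ∃ ν : ComplexMeasure E, ν A = 0 ∧ (μ - ν).variation Set.univ < ε) :
    μ A = 0 := by
  by_contra h0
  obtain ⟨ν, hν, hlt⟩ := h ‖μ A‖ₑ (by simpa [pos_iff_ne_zero] using h0)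
  have := norm_sub_apply_lt hlt A
  simp [hν] at this

lemma concentratedOn_restrict (μ : ComplexMeasure E) {S : Set E} (hS : MeasurableSet S) :
    ConcentratedOn (μ.restrict S) S := fun A hA hd => by
  rw [VectorMeasure.restrict_apply _ hS hA, hd.inter_eq, VectorMeasure.empty]

end Concentrated

section Regular

variable {E : Type*} [AddCommGroup E] [Module ℝ E]

/-- The span of the first `n` vectors of a sequence. -/
def initialSpan (b : ℕ → E) (n : ℕ) : Submodule ℝ E :=
  Submodule.span ℝ (b '' Set.Iio n)

lemma initialSpan_mono (b : ℕ → E) : Monotone (initialSpan b) := fun _ _ h =>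
  Submodule.span_mono (Set.image_mono (Set.Iio_subset_Iio h))

lemma iUnion_initialSpan (b : ℕ → E) :
    ⋃ n, (initialSpan b n : Set E) = Submodule.span ℝ (Set.range b) := by
  rw [← Submodule.coe_iSup_of_directed _ (initialSpan_mono b).directed_le]
  unfold initialSpan
  rw [← Submodule.span_iUnion]
  congr 2
  ext x
  simp only [Set.mem_iUnion, Set.mem_image, Set.mem_Iio, Set.mem_range]
  exact ⟨fun ⟨_, m, _, h⟩ => ⟨m, h⟩, fun ⟨m, h⟩ => ⟨m + 1, m, by simp, h⟩⟩

instance finiteDimensional_initialSpan (b : ℕ → E) (n : ℕ) :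
    FiniteDimensional ℝ (initialSpan b n) :=
  FiniteDimensional.span_of_finite ℝ ((Set.finite_Iio n).image b)

variable [MeasurableSpace E] [FinestBorelSpace E]

/-- The error is `|μ|` of the complement of the initial span. These complements decrease to a null
set, and `|μ|` is finite. -/
lemma exists_restrict_initialSpan {μ : ComplexMeasure E} {b : ℕ → E}
    (hb : ∀ᵐ f ∂μ.variation, f ∈ Submodule.span ℝ (Set.range b)) {ε : ℝ≥0∞} (hε : 0 < ε) :
    ∃ n, (μ - μ.restrict (initialSpan b n)).variation Set.univ < ε := by
  have hm (n : ℕ) := measurableSet_submodule (initialSpan b n)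
  have hle (n : ℕ) : (μ - μ.restrict (initialSpan b n)).variation Set.univ ≤
      μ.variation (initialSpan b n : Set E)ᶜ := by
    have : μ - μ.restrict (initialSpan b n) = μ.restrict (initialSpan b n : Set E)ᶜ := by
      ext A hA
      have := VectorMeasure.of_union (v := μ) (A := A ∩ initialSpan b n)
        (B := A ∩ (initialSpan b n : Set E)ᶜ)
        (Set.disjoint_left.2 fun x hx hx' => hx'.2 hx.2) (hA.inter (hm n)) (hA.inter (hm n).compl)
      rw [← Set.inter_union_distrib_left, Set.union_compl_self, Set.inter_univ] at this
      rw [sub_apply, VectorMeasure.restrict_apply _ (hm n) hA,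
        VectorMeasure.restrict_apply _ (hm n).compl hA, this]
      ring
    rw [this, VectorMeasure.variation_restrict (hm n).compl, Measure.restrict_apply_univ]
  have ht : Filter.Tendsto (fun n => μ.variation (initialSpan b n : Set E)ᶜ) Filter.atTop
      (nhds (μ.variation (⋂ n, (initialSpan b n : Set E)ᶜ))) := by
    refine tendsto_measure_iInter_atTop (fun n => (hm n).compl.nullMeasurableSet) ?_
      ⟨0, measure_ne_top _ _⟩
    exact fun m n h => Set.compl_subset_compl.2 (initialSpan_mono b h)
  have hb0 : μ.variation (Submodule.span ℝ (Set.range b) : Set E)ᶜ = 0 := hb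
  rw [← Set.compl_iUnion, iUnion_initialSpan, hb0] at ht
  obtain ⟨n, hn⟩ := (ht.eventually (gt_mem_nhds hε)).exists
  exact ⟨n, (hle n).trans_lt hn⟩

/-- The subspaces of a sequence of approximants together span a space of countable dimension; all
approximants vanish off it, hence so does the limit. Conversely, restriction to initial spans
approximates. -/
lemma mem_regularMeasures_iff {μ : ComplexMeasure E} :
    μ ∈ regularMeasures E ↔ CountablyCarried μ.variation fun f => f := by
  constructor
  · intro h
    have h' (n : ℕ) : ∃ ν : ComplexMeasure E, ∃ s : ℕ → E,
        ConcentratedOn ν (Submodule.span ℝ (Set.range s)) ∧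
          (μ - ν).variation Set.univ < (n + 1 : ℝ≥0∞)⁻¹ := by
      obtain ⟨ν, ⟨S, hS, hν⟩, hlt⟩ := h (n + 1 : ℝ≥0∞)⁻¹ (by simp)
      obtain ⟨t, ht⟩ := (Submodule.fg_iff_finiteDimensional S).2 hS
      -- Adding 0 keeps the span and makes the generating set nonempty, hence the range of a
      -- sequence.
      have : ∃ s : ℕ → E, Set.range s = insert 0 (t : Set E) :=
        ((t.countable_toSet.insert 0).exists_eq_range (Set.insert_nonempty _ _)).imp
          fun _ h => h.symm
      obtain ⟨s, hs⟩ := this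
      refine ⟨ν, s, ?_, hlt⟩
      rw [hs, Submodule.span_insert_zero, ht]
      exact hν
    choose ν s hν hlt using h'
    let d : ℕ → E := fun n => s (Nat.unpair n).1 (Nat.unpair n).2
    have hd (n : ℕ) : Submodule.span ℝ (Set.range (s n)) ≤ Submodule.span ℝ (Set.range d) := by
      refine Submodule.span_mono ?_
      rintro _ ⟨i, rfl⟩
      exact ⟨Nat.pair n i, by simp [d]⟩
    refine ⟨d, (concentratedOn_iff (measurableSet_submodule _)).1 fun A hA hdis => ?_⟩
    refine apply_eq_zero_of_forall_exists fun ε hε => ?_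
    obtain ⟨n, hn⟩ := ENNReal.exists_inv_nat_lt hε.ne'
    refine ⟨ν n, hν n A hA (hdis.mono_right (hd n)), (hlt n).trans (lt_of_le_of_lt ?_ hn)⟩
    exact ENNReal.inv_le_inv.2 le_self_add
  · rintro ⟨b, hb⟩ ε hε
    obtain ⟨n, hn⟩ := exists_restrict_initialSpan hb hε
    exact ⟨_, ⟨initialSpan b n, inferInstance,
      concentratedOn_restrict _ (measurableSet_submodule _)⟩, hn⟩

/-- The value at a point is continuous for the variation norm, and restriction to a subspace creates
no atoms. -/
lemma mem_continuousMeasures_iff {μ : ComplexMeasure E} :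
    μ ∈ continuousMeasures E ↔ μ ∈ regularMeasures E ∧ ∀ f : E, μ {f} = 0 := by
  constructor
  · intro h
    refine ⟨fun ε hε => ?_, fun f => apply_eq_zero_of_forall_exists fun ε hε => ?_⟩
    · obtain ⟨ν, ⟨S, hS, hν, -⟩, hlt⟩ := h ε hε
      exact ⟨ν, ⟨S, hS, hν⟩, hlt⟩
    · obtain ⟨ν, ⟨S, hS, -, hν⟩, hlt⟩ := h ε hε
      exact ⟨ν, hν f, hlt⟩
  · rintro ⟨h, h0⟩ ε hε
    obtain ⟨b, hb⟩ := mem_regularMeasures_iff.1 h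
    obtain ⟨n, hn⟩ := exists_restrict_initialSpan hb hε
    refine ⟨_, ⟨initialSpan b n, inferInstance,
      concentratedOn_restrict _ (measurableSet_submodule _), fun f => ?_⟩, hn⟩
    rw [VectorMeasure.restrict_apply _ (measurableSet_submodule _) (measurableSet_singleton f)]
    by_cases hf : f ∈ (initialSpan b n : Set E)
    · rw [Set.inter_eq_left.2 (Set.singleton_subset_iff.2 hf), h0]
    · rw [Set.singleton_inter_eq_empty.2 hf, VectorMeasure.empty]

/-- The countable carriers of a sequence of approximants have a countable union, which carries the
limit. -/
lemma mem_discreteMeasures_iff {μ : ComplexMeasure E} :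
    μ ∈ discreteMeasures E ↔
      μ ∈ regularMeasures E ∧ ∃ C : Set E, C.Countable ∧ ∀ᵐ f ∂μ.variation, f ∈ C := by
  constructor
  · intro h
    refine ⟨fun ε hε => ?_, ?_⟩
    · obtain ⟨ν, ⟨S, hS, hν, -⟩, hlt⟩ := h ε hε
      exact ⟨ν, ⟨S, hS, hν⟩, hlt⟩
    · have h' (n : ℕ) : ∃ ν : ComplexMeasure E, ∃ C : Set E, C.Countable ∧
          ConcentratedOn ν C ∧ (μ - ν).variation Set.univ < (n + 1 : ℝ≥0∞)⁻¹ := by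
        obtain ⟨ν, ⟨S, hS, -, C, hC, hν⟩, hlt⟩ := h (n + 1 : ℝ≥0∞)⁻¹ (by simp)
        exact ⟨ν, C, hC, hν, hlt⟩
      choose ν C hC hν hlt using h'
      have hCc : (⋃ n, C n).Countable := Set.countable_iUnion hC
      refine ⟨⋃ n, C n, hCc, (concentratedOn_iff hCc.measurableSet).1 fun A hA hdis => ?_⟩
      refine apply_eq_zero_of_forall_exists fun ε hε => ?_
      obtain ⟨n, hn⟩ := ENNReal.exists_inv_nat_lt hε.ne'
      refine ⟨ν n, hν n A hA (hdis.mono_right (Set.subset_iUnion C n)),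
        (hlt n).trans (lt_of_le_of_lt ?_ hn)⟩
      exact ENNReal.inv_le_inv.2 le_self_add
  · rintro ⟨h, C, hC, hμ⟩ ε hε
    obtain ⟨b, hb⟩ := mem_regularMeasures_iff.1 h
    obtain ⟨n, hn⟩ := exists_restrict_initialSpan hb hε
    refine ⟨_, ⟨initialSpan b n, inferInstance,
      concentratedOn_restrict _ (measurableSet_submodule _), C, hC, fun A hA hd => ?_⟩, hn⟩
    rw [VectorMeasure.restrict_apply _ (measurableSet_submodule _) hA]
    exact (concentratedOn_iff hC.measurableSet).2 hμ _ (hA.inter (measurableSet_submodule _))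
      (hd.mono_left Set.inter_subset_left)

lemma mem_finitelySupportedMeasures_iff {μ : ComplexMeasure E} :
    μ ∈ finitelySupportedMeasures E ↔ ∃ C : Set E, C.Finite ∧ ∀ᵐ f ∂μ.variation, f ∈ C := by
  constructor
  · intro h
    have h' : ∃ C : Set E, C.Finite ∧ ConcentratedOn μ C := by
      refine Submodule.span_induction (p := fun ν _ => ∃ C : Set E, C.Finite ∧ ConcentratedOn ν C)
        ?_ ?_ ?_ ?_ h
      · rintro _ ⟨f, rfl⟩
        refine ⟨{f}, Set.finite_singleton f, fun A hA hd => ?_⟩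
        rw [VectorMeasure.dirac_apply_of_notMem]
        exact Set.disjoint_singleton_right.1 hd
      · exact ⟨∅, Set.finite_empty, fun A _ _ => rfl⟩
      · rintro ν ν' - - ⟨C, hC, h⟩ ⟨C', hC', h'⟩
        refine ⟨C ∪ C', hC.union hC', fun A hA hd => ?_⟩
        rw [Set.disjoint_union_right] at hd
        rw [add_apply, h A hA hd.1, h' A hA hd.2, add_zero]
      · rintro z ν - ⟨C, hC, h⟩
        refine ⟨C, hC, fun A hA hd => ?_⟩
        rw [smul_apply, h A hA hd, smul_zero]
    obtain ⟨C, hC, h⟩ := h'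
    exact ⟨C, hC, (concentratedOn_iff hC.measurableSet).1 h⟩
  · rintro ⟨C, hC, hμ⟩
    have hc := (concentratedOn_iff hC.measurableSet).2 hμ
    have : μ = ∑ f ∈ hC.toFinset, μ {f} • (VectorMeasure.dirac f (1 : ℂ) : ComplexMeasure E) := by
      classical
      ext A hA
      have h1 : μ A = μ (A ∩ C) := by
        rw [← Set.inter_union_sdiff A C, VectorMeasure.of_union, hc (A \ C),
          add_zero, Set.inter_union_sdiff]
        · exact hA.diff hC.measurableSet
        · exact Set.disjoint_sdiff_left
        · exact Set.disjoint_left.2 fun x hx hx' => hx'.2 hx.2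
        · exact hA.inter hC.measurableSet
        · exact hA.diff hC.measurableSet
      have h2 : A ∩ C = ⋃ f ∈ hC.toFinset.filter (· ∈ A), {f} := by
        ext x; simp [and_comm]
      rw [h1, h2, VectorMeasure.of_biUnion_finset, FunLike.coe_sum,
        Finset.sum_apply, Finset.sum_filter]
      · refine Finset.sum_congr rfl fun f _ => ?_
        rw [smul_apply]
        split_ifs with hf
        · rw [VectorMeasure.dirac_apply_of_mem hA hf]; simp
        · rw [VectorMeasure.dirac_apply_of_notMem hf]; simp
      · exact fun f _ g _ hfg => Set.disjoint_singleton.2 hfg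
      · exact fun f _ => measurableSet_singleton f
    rw [this]
    exact Submodule.sum_mem _ fun f _ => Submodule.smul_mem _ _ (Submodule.subset_span ⟨f, rfl⟩)

end Regular

/-! ### Algebra of the complexified Banach space -/

section ComplexifiedAlgebra

variable {V : Type*} [NormedAddCommGroup V] [NormedSpace ℝ V]

namespace Complexified

lemma eval_add (G : StrongDual ℝ V) (Φ Ψ : Complexified V) :
    eval G (Φ + Ψ) = eval G Φ + eval G Ψ := by
  change ((G (Φ.re + Ψ.re) : ℝ) : ℂ) + Complex.I * (G (Φ.im + Ψ.im) : ℝ) = _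
  simp only [map_add, Complex.ofReal_add, eval]
  ring

lemma eval_smul (G : StrongDual ℝ V) (z : ℂ) (Φ : Complexified V) :
    eval G (z • Φ) = z * eval G Φ := by
  change ((G (z.re • Φ.re - z.im • Φ.im) : ℝ) : ℂ) +
    Complex.I * (G (z.re • Φ.im + z.im • Φ.re) : ℝ) = _
  simp only [map_add, map_sub, map_smul, smul_eq_mul, eval]
  apply Complex.ext <;> simp

lemma eval_ofReal (G : StrongDual ℝ V) (φ : V) : eval G (ofReal φ) = G φ := by
  change (G φ : ℂ) + Complex.I * (G (0 : V) : ℝ) = _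
  simp

/-- Evaluation of a functional as a continuous real linear map. -/
noncomputable def evalCLM (G : StrongDual ℝ V) : Complexified V →L[ℝ] ℂ :=
  (Complex.ofRealCLM.comp G).comp (ContinuousLinearMap.fst ℝ V V) +
    ((ContinuousLinearMap.mul ℝ ℂ Complex.I).comp (Complex.ofRealCLM.comp G)).comp
      (ContinuousLinearMap.snd ℝ V V)

lemma evalCLM_apply (G : StrongDual ℝ V) (Φ : Complexified V) : evalCLM G Φ = eval G Φ := rfl

/-- By Hahn–Banach, applied to real and imaginary parts. This is what makes total differentials
unique. -/
lemma ext_eval {Φ Ψ : Complexified V} (h : ∀ G : StrongDual ℝ V, eval G Φ = eval G Ψ) : Φ = Ψ := by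
  refine Prod.ext ?_ ?_
  · refine (SeparatingDual.eq_iff_forall_dual_eq (R := ℝ)).2 fun G => ?_
    have := congrArg Complex.re (h G)
    simpa [eval, re] using this
  · refine (SeparatingDual.eq_iff_forall_dual_eq (R := ℝ)).2 fun G => ?_
    have := congrArg Complex.im (h G)
    simpa [eval, im] using this

/-- Complex conjugation `φ + iψ ↦ φ - iψ`. -/
def conj (Φ : Complexified V) : Complexified V := mk Φ.re (-Φ.im)

lemma eval_conj (G : StrongDual ℝ V) (Φ : Complexified V) :
    eval G (conj Φ) = starRingEnd ℂ (eval G Φ) := by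
  change (G Φ.re : ℂ) + Complex.I * (G (-Φ.im) : ℝ) = _
  simp [eval]

variable (β : V →L[ℝ] V →L[ℝ] ℝ)

lemma bilin_add_left (Φ Φ' Ψ : Complexified V) :
    bilin β (Φ + Φ') Ψ = bilin β Φ Ψ + bilin β Φ' Ψ := by
  have h1 : (Φ + Φ').re = Φ.re + Φ'.re := rfl
  have h2 : (Φ + Φ').im = Φ.im + Φ'.im := rfl
  simp only [bilin, h1, h2, map_add, add_apply, Complex.ofReal_add]
  ring

lemma bilin_add_right (Φ Ψ Ψ' : Complexified V) :
    bilin β Φ (Ψ + Ψ') = bilin β Φ Ψ + bilin β Φ Ψ' := by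
  have h1 : (Ψ + Ψ').re = Ψ.re + Ψ'.re := rfl
  have h2 : (Ψ + Ψ').im = Ψ.im + Ψ'.im := rfl
  simp only [bilin, h1, h2, map_add, Complex.ofReal_add]
  ring

lemma bilin_smul_left (z : ℂ) (Φ Ψ : Complexified V) :
    bilin β (z • Φ) Ψ = z * bilin β Φ Ψ := by
  have h1 : (z • Φ).re = z.re • Φ.re - z.im • Φ.im := rfl
  have h2 : (z • Φ).im = z.re • Φ.im + z.im • Φ.re := rfl
  simp only [bilin, h1, h2, map_add, map_sub, map_smul, add_apply,
    sub_apply, smul_apply, smul_eq_mul]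
  apply Complex.ext <;> simp <;> ring

lemma bilin_smul_right (z : ℂ) (Φ Ψ : Complexified V) :
    bilin β Φ (z • Ψ) = z * bilin β Φ Ψ := by
  have h1 : (z • Ψ).re = z.re • Ψ.re - z.im • Ψ.im := rfl
  have h2 : (z • Ψ).im = z.re • Ψ.im + z.im • Ψ.re := rfl
  simp only [bilin, h1, h2, map_add, map_sub, map_smul, smul_eq_mul]
  apply Complex.ext <;> simp <;> ring

lemma bilin_ofReal (φ ψ : V) : bilin β (ofReal φ) (ofReal ψ) = β φ ψ := by
  have h1 (χ : V) : (ofReal χ).re = χ := rfl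
  have h2 (χ : V) : (ofReal χ).im = 0 := rfl
  simp [bilin, h1, h2]

lemma bilin_conj (Φ Ψ : Complexified V) :
    bilin β (conj Φ) (conj Ψ) = starRingEnd ℂ (bilin β Φ Ψ) := by
  have h1 (χ : Complexified V) : (conj χ).re = χ.re := rfl
  have h2 (χ : Complexified V) : (conj χ).im = -χ.im := rfl
  apply Complex.ext <;> simp [bilin, h1, h2, neg_add_eq_sub]

lemma bilin_antisymm (hβ : ∀ φ ψ, β φ ψ = -β ψ φ) (Φ Ψ : Complexified V) :
    bilin β Φ Ψ = -bilin β Ψ Φ := by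
  simp only [bilin]
  rw [hβ Φ.re Ψ.re, hβ Φ.re Ψ.im, hβ Φ.im Ψ.re, hβ Φ.im Ψ.im]
  push_cast
  ring

/-- The complex bilinear extension as a continuous real bilinear map. -/
noncomputable def bilinCLM : Complexified V →L[ℝ] Complexified V →L[ℝ] ℂ :=
  LinearMap.mkContinuous₂
    (LinearMap.mk₂ ℝ (bilin β) (bilin_add_left β)
      (fun a Φ Ψ => by
        have h1 : (a • Φ).re = a • Φ.re := rfl
        have h2 : (a • Φ).im = a • Φ.im := rfl
        simp only [bilin, h1, h2, map_smul, smul_apply, smul_eq_mul,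
          Complex.ofReal_mul, Complex.real_smul]
        ring)
      (bilin_add_right β)
      (fun a Φ Ψ => by
        have h1 : (a • Ψ).re = a • Ψ.re := rfl
        have h2 : (a • Ψ).im = a • Ψ.im := rfl
        simp only [bilin, h1, h2, map_smul, smul_eq_mul, Complex.ofReal_mul, Complex.real_smul]
        ring)) (4 * ‖β‖) (fun Φ Ψ => by
      change ‖bilin β Φ Ψ‖ ≤ _
      have h1 : ‖Φ.re‖ ≤ ‖Φ‖ := norm_fst_le (Φ : V × V)
      have h2 : ‖Φ.im‖ ≤ ‖Φ‖ := norm_snd_le (Φ : V × V)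
      have h3 : ‖Ψ.re‖ ≤ ‖Ψ‖ := norm_fst_le (Ψ : V × V)
      have h4 : ‖Ψ.im‖ ≤ ‖Ψ‖ := norm_snd_le (Ψ : V × V)
      have key (x y : V) (hx : ‖x‖ ≤ ‖Φ‖) (hy : ‖y‖ ≤ ‖Ψ‖) :
          ‖(β x y : ℂ)‖ ≤ ‖β‖ * ‖Φ‖ * ‖Ψ‖ := by
        rw [Complex.norm_real]
        refine (β.le_opNorm₂ x y).trans ?_
        gcongr
      have hI (z : ℂ) : ‖Complex.I * z‖ = ‖z‖ := by simp
      refine (norm_sub_le _ _).trans ?_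
      have e1 := norm_add_le ((β Φ.re Ψ.re : ℂ) + Complex.I * (β Φ.re Ψ.im : ℂ))
        (Complex.I * (β Φ.im Ψ.re : ℂ))
      have e2 := norm_add_le (β Φ.re Ψ.re : ℂ) (Complex.I * (β Φ.re Ψ.im : ℂ))
      rw [hI] at e1 e2
      have k1 := key _ _ h1 h3
      have k2 := key _ _ h1 h4
      have k3 := key _ _ h2 h3
      have k4 := key _ _ h2 h4
      linarith)

lemma bilinCLM_apply (Φ Ψ : Complexified V) : bilinCLM β Φ Ψ = bilin β Φ Ψ := rfl

lemma smulPairing_apply (Φ : Complexified V) (z : ℂ) : smulPairing V Φ z = z • Φ := rfl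

instance [CompleteSpace V] : CompleteSpace (Complexified V) :=
  inferInstanceAs (CompleteSpace (V × V))

end Complexified

end ComplexifiedAlgebra

section ExtendedForm

variable {E : Type*} [AddCommGroup E] [Module ℝ E]

lemma extendedForm_antisymm (p : Seminorm ℝ E) (σ : LinearMap.BilinForm ℝ E) (hσ : σ.IsAlt)
    (h : ∃ c : ℝ, 0 < c ∧ ∀ f g, |σ f g| ≤ c * p f * p g) (φ ψ : SeminormCompletion p) :
    extendedForm p σ h φ ψ = -extendedForm p σ h ψ φ := by
  refine UniformSpace.Completion.induction_on₂ (α := SeminormSpace p) (β := SeminormSpace p)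
    φ ψ (isClosed_eq (by fun_prop) (by fun_prop)) fun f g => ?_
  have h1 := extendedForm_classMap p σ h f g
  have h2 := extendedForm_classMap p σ h g f
  exact h1.trans ((hσ.neg_eq g f).symm.trans (congrArg Neg.neg h2.symm))

end ExtendedForm

/-! ### Rules for total differentials -/

section TotalDifferential

variable {E : Type*} [AddCommGroup E] [Module ℝ E] [TopologicalSpace E] [IsTopologicalAddGroup E]
  {ς : Seminorm ℝ E} {hς : Continuous ς}

lemma directionIncl_zero [ContinuousSMul ℝ E] :
    directionIncl ς hς 0 = 0 := rfl

variable {A B : WeakDual ℝ E → ℂ} {F : WeakDual ℝ E} {Φ Ψ : Complexified (SeminormCompletion ς)}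

/-- The straight curves `t ↦ tG` already determine `G(Φ)` for every `G`. -/
lemma HasTotalDifferentialAt.unique (h : HasTotalDifferentialAt ς hς A Φ F)
    (h' : HasTotalDifferentialAt ς hς A Ψ F) : Φ = Ψ := by
  refine Complexified.ext_eval fun G => ?_
  have hc : ∀ φ, HasDerivAt (fun t : ℝ => (t • G) φ) (G φ) 0 := fun φ => by
    simpa using (hasDerivAt_id (0 : ℝ)).mul_const (G φ)
  exact (h G (fun t => t • G) (zero_smul ℝ G) hc).unique (h' G _ (zero_smul ℝ G) hc)

lemma HasTotalDifferentialAt.totalDifferential_eq (h : HasTotalDifferentialAt ς hς A Φ F) :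
    totalDifferential ς hς A F = Φ := by
  have h' : ∃ Φ, HasTotalDifferentialAt ς hς A Φ F := ⟨Φ, h⟩
  rw [totalDifferential, dif_pos h']
  exact h'.choose_spec.unique h

lemma HasTotalDifferentialAt.add (hA : HasTotalDifferentialAt ς hς A Φ F)
    (hB : HasTotalDifferentialAt ς hς B Ψ F) :
    HasTotalDifferentialAt ς hς (A + B) (Φ + Ψ) F := fun G c h0 hc => by
  rw [Complexified.eval_add]
  exact (hA G c h0 hc).add (hB G c h0 hc)

lemma HasTotalDifferentialAt.smul (hA : HasTotalDifferentialAt ς hς A Φ F) (z : ℂ) :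
    HasTotalDifferentialAt ς hς (z • A) (z • Φ) F := fun G c h0 hc => by
  rw [Complexified.eval_smul]
  exact (hA G c h0 hc).const_mul z

lemma HasTotalDifferentialAt.mul [ContinuousSMul ℝ E] (hA : HasTotalDifferentialAt ς hς A Φ F)
    (hB : HasTotalDifferentialAt ς hς B Ψ F) :
    HasTotalDifferentialAt ς hς (A * B) (B F • Φ + A F • Ψ) F := fun G c h0 hc => by
  rw [Complexified.eval_add, Complexified.eval_smul, Complexified.eval_smul]
  have := (hA G c h0 hc).mul (hB G c h0 hc)
  rw [h0, directionIncl_zero, add_zero] at this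
  refine this.congr_deriv ?_
  ring

lemma HasTotalDifferentialAt.conj (hA : HasTotalDifferentialAt ς hς A Φ F) :
    HasTotalDifferentialAt ς hς (star A) Φ.conj F := fun G c h0 hc => by
  rw [Complexified.eval_conj]
  exact (hA G c h0 hc).star

end TotalDifferential

/-! ### Moments of densities -/

section Moments

variable {E : Type*} [AddCommGroup E] [Module ℝ E] [MeasurableSpace E] [FinestBorelSpace E]
  {X Y : Type*} [MeasurableSpace X] [MeasurableSpace Y]

/-- A density `k` and a map `T` with carried image such that `k` has finite moments up to order `n`
of `ς ∘ T`. -/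
structure HasMoments (ς : Seminorm ℝ E) (n : ℕ) (M : Measure X) (T : X → E) (k : X → ℂ) : Prop where
  aemeasurable : AEMeasurable T M
  carried : CountablyCarried M T
  aestronglyMeasurable : AEStronglyMeasurable k M
  moment : Integrable (fun x => (1 + ς (T x)) ^ n * ‖k x‖) M

namespace HasMoments

variable {ς : Seminorm ℝ E} {n : ℕ} {M : Measure X} {T : X → E} {k : X → ℂ}
  {N : Measure Y} {T' : Y → E} {k' : Y → ℂ}

/-- A factor of growth `m` is paid for with `m` moments. -/
lemma mul_of_norm_le {m : ℕ} (h : HasMoments ς (n + m) M T k) {q : X → ℂ}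
    (hq : AEStronglyMeasurable q M) {C : ℝ} (hC : ∀ x, ‖q x‖ ≤ C * (1 + ς (T x)) ^ m) :
    HasMoments ς n M T fun x => q x * k x := by
  refine ⟨h.aemeasurable, h.carried, hq.mul h.aestronglyMeasurable, ?_⟩
  have hς := (measurable_seminorm ς).comp_aemeasurable h.aemeasurable
  refine (h.moment.const_mul C).mono ?_ (ae_of_all _ fun x => ?_)
  · exact ((aemeasurable_const.add hς).pow_const n).aestronglyMeasurable.mul
      (hq.mul h.aestronglyMeasurable).norm
  · have h0 : 0 ≤ ς (T x) := apply_nonneg ς _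
    rw [norm_mul, norm_norm, norm_mul, Real.norm_of_nonneg (by positivity)]
    calc (1 + ς (T x)) ^ n * (‖q x‖ * ‖k x‖)
        ≤ (1 + ς (T x)) ^ n * (C * (1 + ς (T x)) ^ m * ‖k x‖) := by gcongr; exact hC x
      _ = C * ((1 + ς (T x)) ^ (n + m) * ‖k x‖) := by ring
      _ ≤ _ := le_abs_self _

lemma mono (h : HasMoments ς n M T k) {m : ℕ} (hm : m ≤ n) : HasMoments ς m M T k := by
  obtain ⟨j, rfl⟩ := Nat.exists_eq_add_of_le hm
  have := h.mul_of_norm_le (q := fun _ => 1) aestronglyMeasurable_const (C := 1) (fun x => by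
    have h0 : 0 ≤ ς (T x) := apply_nonneg ς _
    rw [norm_one, one_mul]
    exact one_le_pow₀ (by linarith))
  simpa using this

lemma integrable (h : HasMoments ς n M T k) : Integrable k M := by
  have := (h.mono (Nat.zero_le n)).moment
  simp only [pow_zero, one_mul] at this
  exact (integrable_norm_iff h.aestronglyMeasurable).1 this

/-- Subadditivity gives `1 + ς(f + g) ≤ (1 + ς f)(1 + ς g)`, so the weight is dominated by a product
of functions of one variable each, integrable on the product space. -/
lemma prod_mul [SFinite M] [SFinite N] {m : ℕ} (h : HasMoments ς (n + m) M T k)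
    (h' : HasMoments ς (n + m) N T' k') {q : X × Y → ℂ}
    (hq : AEStronglyMeasurable q (M.prod N)) {C : ℝ}
    (hC : ∀ z, ‖q z‖ ≤ C * ((1 + ς (T z.1)) ^ m * (1 + ς (T' z.2)) ^ m)) :
    HasMoments ς n (M.prod N) (fun z => T z.1 + T' z.2) fun z => q z * (k z.1 * k' z.2) := by
  have hT := h.carried.aemeasurable_add h'.carried h.aemeasurable h'.aemeasurable
  have hkk : AEStronglyMeasurable (fun z : X × Y => k z.1 * k' z.2) (M.prod N) :=
    h.aestronglyMeasurable.comp_fst.mul h'.aestronglyMeasurable.comp_snd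
  refine ⟨hT, h.carried.add h'.carried, hq.mul hkk, ?_⟩
  have hς := (measurable_seminorm ς).comp_aemeasurable hT
  refine ((h.moment.mul_prod h'.moment).const_mul C).mono ?_ (ae_of_all _ fun z => ?_)
  · exact ((aemeasurable_const.add hς).pow_const n).aestronglyMeasurable.mul (hq.mul hkk).norm
  · have h1 : 0 ≤ ς (T z.1) := apply_nonneg ς _
    have h2 : 0 ≤ ς (T' z.2) := apply_nonneg ς _
    have h3 : 0 ≤ ς (T z.1 + T' z.2) := apply_nonneg ς _
    have h4 : 1 + ς (T z.1 + T' z.2) ≤ (1 + ς (T z.1)) * (1 + ς (T' z.2)) := by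
      have := map_add_le_add ς (T z.1) (T' z.2)
      nlinarith
    rw [norm_mul, norm_norm, norm_mul, norm_mul, Real.norm_of_nonneg (by positivity)]
    calc (1 + ς (T z.1 + T' z.2)) ^ n * (‖q z‖ * (‖k z.1‖ * ‖k' z.2‖))
        ≤ ((1 + ς (T z.1)) * (1 + ς (T' z.2))) ^ n *
          ((C * ((1 + ς (T z.1)) ^ m * (1 + ς (T' z.2)) ^ m)) * (‖k z.1‖ * ‖k' z.2‖)) := by
          gcongr
          exact hC z
      _ = (1 + ς (T z.1)) ^ n * (1 + ς (T' z.2)) ^ n *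
          ((C * ((1 + ς (T z.1)) ^ m * (1 + ς (T' z.2)) ^ m)) * (‖k z.1‖ * ‖k' z.2‖)) := by
          rw [mul_pow]
      _ = C * ((1 + ς (T z.1)) ^ (n + m) * ‖k z.1‖ * ((1 + ς (T' z.2)) ^ (n + m) * ‖k' z.2‖)) := by
          ring
      _ ≤ _ := le_abs_self _

/-- Moments of the integrand of the Poisson bracket. -/
lemma bracket [SFinite M] [SFinite N] (h : HasMoments ς (n + 1) M T k)
    (h' : HasMoments ς (n + 1) N T' k') {σ : LinearMap.BilinForm ℝ E}
    (hσς : ∃ c : ℝ, 0 < c ∧ ∀ f g, |σ f g| ≤ c * ς f * ς g) :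
    HasMoments ς n (M.prod N) (fun z => T z.1 + T' z.2)
      fun z => (σ (T z.1) (T' z.2) : ℂ) * (k z.1 * k' z.2) := by
  obtain ⟨c, hc, hσ⟩ := hσς
  refine h.prod_mul h' (q := fun z => (σ (T z.1) (T' z.2) : ℂ)) (C := c) ?_ fun z => ?_
  · exact (Complex.measurable_ofReal.comp_aemeasurable (h.carried.aemeasurable_bilin
      h.aemeasurable h'.aemeasurable σ)).aestronglyMeasurable
  · rw [Complex.norm_real, Real.norm_eq_abs, pow_one, pow_one]
    refine (hσ _ _).trans ?_
    have h1 : 0 ≤ ς (T z.1) := apply_nonneg ς _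
    have h2 : 0 ≤ ς (T' z.2) := apply_nonneg ς _
    rw [mul_assoc]
    gcongr <;> linarith

end HasMoments

end Moments

/-! ### Calculus of Fourier integrals -/

section FourierIntegral

variable {E : Type*} [AddCommGroup E] [Module ℝ E] [TopologicalSpace E]
  {X Y Z : Type*} [MeasurableSpace X] [MeasurableSpace Y] [MeasurableSpace Z]

lemma norm_weylFunction (f : E) (F : WeakDual ℝ E) : ‖weylFunction f F‖ = 1 := by
  rw [weylFunction, mul_comm, Complex.norm_exp_ofReal_mul_I]

lemma weylFunction_add (f g : E) (F : WeakDual ℝ E) :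
    weylFunction (f + g) F = weylFunction f F * weylFunction g F := by
  rw [weylFunction, weylFunction, weylFunction, ← Complex.exp_add, map_add]
  push_cast
  rw [mul_add]

lemma weylFunction_neg (f : E) (F : WeakDual ℝ E) :
    weylFunction (-f) F = starRingEnd ℂ (weylFunction f F) := by
  rw [weylFunction, weylFunction, ← Complex.exp_conj, map_neg]
  simp

/-- The function `F ↦ ∫ e^{iF(T x)} k(x) dM(x)` on the phase space. -/
noncomputable def fourierInt (M : Measure X) (T : X → E) (k : X → ℂ) (F : WeakDual ℝ E) : ℂ :=
  ∫ x, weylFunction (T x) F * k x ∂M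

lemma norm_fourierInt_le (M : Measure X) (T : X → E) (k : X → ℂ) (F : WeakDual ℝ E) :
    ‖fourierInt M T k F‖ ≤ ∫ x, ‖k x‖ ∂M := by
  refine (norm_integral_le_integral_norm _).trans (le_of_eq ?_)
  simp [norm_weylFunction]

lemma measureFourier_eq_fourierInt [MeasurableSpace E] (μ : ComplexMeasure E) :
    measureFourier μ = fourierInt μ.variation (fun f => f) (phase μ) :=
  funext fun _ => integral_mul_eq μ _

variable [MeasurableSpace E] [FinestBorelSpace E]

lemma measurable_weylFunction (F : WeakDual ℝ E) : Measurable fun f => weylFunction f F := by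
  have : Measurable fun f => F f :=
    measurable_linearMap (LinearMapClass.linearMap F : E →ₗ[ℝ] ℝ)
  exact Complex.measurable_exp.comp (measurable_const.mul (Complex.measurable_ofReal.comp this))

lemma integrable_weylFunction_mul {M : Measure X} {T : X → E} {k : X → ℂ} (hT : AEMeasurable T M)
    (hk : Integrable k M) (F : WeakDual ℝ E) :
    Integrable (fun x => weylFunction (T x) F * k x) M := by
  refine hk.mono (((measurable_weylFunction F).comp_aemeasurable hT).aestronglyMeasurable.mul
    hk.aestronglyMeasurable) (ae_of_all _ fun x => ?_)
  rw [norm_mul, norm_weylFunction, one_mul]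

/-- Dominated convergence handles sequences, not weak-`*` nets. Almost everywhere the integrand
depends on `F` only through the sequence `F(bᵢ)`, so the function factors continuously through the
first countable space `ℕ → ℝ`, where dominated convergence applies. -/
lemma continuous_fourierInt {M : Measure X} {T : X → E} {k : X → ℂ} (hc : CountablyCarried M T)
    (hT : AEMeasurable T M) (hk : Integrable k M) : Continuous (fourierInt M T k) := by
  obtain ⟨b, hb⟩ := hc
  let L (y : ℕ → ℝ) : E →ₗ[ℝ] ℝ := (Finsupp.linearCombination ℝ y).comp (coords b)
  have hL (f : E) : Continuous fun y => L y f := by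
    change Continuous fun y => Finsupp.linearCombination ℝ y (coords b f)
    simp only [Finsupp.linearCombination_apply, Finsupp.sum]
    fun_prop
  have hg : Continuous fun y : ℕ → ℝ => ∫ x, Complex.exp (Complex.I * (L y (T x) : ℝ)) * k x ∂M := by
    refine continuous_of_dominated (bound := fun x => ‖k x‖) (fun y => ?_) (fun y => ?_) hk.norm ?_
    · have := (measurable_linearMap (L y)).comp_aemeasurable hT
      exact (Complex.measurable_exp.comp_aemeasurable (aemeasurable_const.mul
        (Complex.measurable_ofReal.comp_aemeasurable this))).aestronglyMeasurable.mul
        hk.aestronglyMeasurable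
    · refine ae_of_all _ fun x => ?_
      rw [norm_mul, mul_comm Complex.I, Complex.norm_exp_ofReal_mul_I, one_mul]
    · refine ae_of_all _ fun x => ?_
      have := hL (T x)
      fun_prop
  have hr : Continuous fun (F : WeakDual ℝ E) (i : ℕ) => F (b i) :=
    continuous_pi fun i => WeakDual.eval_continuous (b i)
  refine (hg.comp hr).congr fun F => integral_congr_ae ?_
  filter_upwards [hb] with x hx
  have : F (T x) = L (fun i => F (b i)) (T x) := by
    conv_lhs => rw [← linearCombination_coords hx]
    simp [L, Finsupp.linearCombination_apply, map_finsuppSum]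
  rw [weylFunction, this]

namespace HasMoments

variable {ς : Seminorm ℝ E} {n : ℕ} {M : Measure X} {T : X → E} {k : X → ℂ}
  {N : Measure Y} {T' : Y → E} {k' : Y → ℂ}

lemma integrable_smul_ofReal (h : HasMoments ς 1 M T k) (F : WeakDual ℝ E) :
    Integrable (fun x => (weylFunction (T x) F * k x) •
      Complexified.ofReal (classMap ς (T x))) M := by
  have hm : AEStronglyMeasurable (fun x => Complexified.ofReal (classMap ς (T x))) M := by
    have := h.carried.aestronglyMeasurable_linearMap h.aemeasurable (classMap ς)
    exact this.prodMk aestronglyMeasurable_const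
  refine (h.moment.const_mul 2).mono
    ((Complexified.smulPairing (SeminormCompletion ς)).aestronglyMeasurable_comp₂ hm
      (integrable_weylFunction_mul h.aemeasurable h.integrable F).aestronglyMeasurable)
    (ae_of_all _ fun x => ?_)
  have h1 : 0 ≤ ς (T x) := apply_nonneg ς _
  have h2 : ‖Complexified.ofReal (classMap ς (T x))‖ = ς (T x) := by
    change max ‖classMap ς (T x)‖ ‖(0 : SeminormCompletion ς)‖ = _
    rw [norm_zero, norm_classMap, max_eq_left h1]
  refine (Complexified.norm_smul_le _ _).trans ?_
  rw [h2, norm_mul, norm_weylFunction, one_mul, Real.norm_of_nonneg (by positivity), pow_one]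
  have := norm_nonneg (k x)
  nlinarith

section Calculus

variable [IsTopologicalAddGroup E] [ContinuousSMul ℝ E] {hς : Continuous ς}

/-- The bound `|e^{is} - 1| ≤ |s|` controls the difference quotients of the integrand by those of
the curve. The latter converge pointwise on the Banach space `E_ς`, hence are bounded in norm along
sequences, and one moment provides the dominating function. -/
lemma hasDerivAt_curve (h : HasMoments ς 1 M T k) (F : WeakDual ℝ E)
    (G : StrongDual ℝ (SeminormCompletion ς)) (c : ℝ → StrongDual ℝ (SeminormCompletion ς))
    (h0 : c 0 = 0) (hc : ∀ φ, HasDerivAt (fun t => c t φ) (G φ) 0) :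
    HasDerivAt (fun t => fourierInt M T k (F + directionIncl ς hς (c t)))
      (fourierInt M T (fun x => Complex.I * (G (classMap ς (T x)) : ℂ) * k x) F) 0 := by
  rw [hasDerivAt_iff_tendsto_slope_zero]
  -- Along a sequence, pointwise convergence implies pointwise boundedness, the hypothesis of
  -- Banach–Steinhaus.
  refine Filter.tendsto_of_seq_tendsto fun u hu => ?_
  let D (n : ℕ) : StrongDual ℝ (SeminormCompletion ς) := (u n)⁻¹ • c (u n)
  have hD (φ : SeminormCompletion ς) :
      Filter.Tendsto (fun n => D n φ) Filter.atTop (nhds (G φ)) := by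
    have := ((hasDerivAt_iff_tendsto_slope_zero.1 (hc φ)).comp hu)
    simpa [h0, D, Function.comp_def] using this
  obtain ⟨C, hC⟩ : ∃ C, ∀ n, ‖D n‖ ≤ C := by
    refine banach_steinhaus fun φ => ?_
    obtain ⟨C, hC⟩ := (Metric.isBounded_range_of_tendsto _ (hD φ)).exists_norm_le
    exact ⟨C, fun n => hC _ ⟨n, rfl⟩⟩
  have hC0 : 0 ≤ C := (norm_nonneg _).trans (hC 0)
  have hweyl (f : E) (G' : StrongDual ℝ (SeminormCompletion ς)) :
      weylFunction f (F + directionIncl ς hς G') =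
        weylFunction f F * Complex.exp (Complex.I * (G' (classMap ς f) : ℂ)) := by
    have : (F + directionIncl ς hς G') f = F f + G' (classMap ς f) := rfl
    rw [weylFunction, weylFunction, ← Complex.exp_add, this]
    push_cast
    ring_nf
  have hval (n : ℕ) : (u n)⁻¹ • (fourierInt M T k (F + directionIncl ς hς (c (0 + u n))) -
      fourierInt M T k (F + directionIncl ς hς (c 0))) =
      ∫ x, (u n)⁻¹ • (weylFunction (T x) F *
        (Complex.exp (Complex.I * (c (u n) (classMap ς (T x)) : ℂ)) - 1) * k x) ∂M := by
    rw [integral_smul, h0, directionIncl_zero, add_zero, zero_add]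
    congr 1
    rw [fourierInt, fourierInt, ← integral_sub
      (integrable_weylFunction_mul h.aemeasurable h.integrable _)
      (integrable_weylFunction_mul h.aemeasurable h.integrable _)]
    refine integral_congr_ae (ae_of_all _ fun x => ?_)
    simp only [hweyl]
    ring
  refine Filter.Tendsto.congr (fun n => (hval n).symm) ?_
  have hmeas (G' : StrongDual ℝ (SeminormCompletion ς)) :
      AEMeasurable (fun x => (G' (classMap ς (T x)) : ℂ)) M :=
    Complex.measurable_ofReal.comp_aemeasurable ((measurable_linearMap
      (G'.toLinearMap.comp (classMap ς))).comp_aemeasurable h.aemeasurable)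
  refine tendsto_integral_of_dominated_convergence
    (fun x => C * ((1 + ς (T x)) ^ 1 * ‖k x‖)) (fun n => ?_) (h.moment.const_mul C)
    (fun n => ae_of_all _ fun x => ?_) (ae_of_all _ fun x => ?_)
  · refine AEStronglyMeasurable.const_smul (f := fun x => weylFunction (T x) F *
      (Complex.exp (Complex.I * (c (u n) (classMap ς (T x)) : ℂ)) - 1) * k x) ?_ (u n)⁻¹
    refine AEStronglyMeasurable.mul ?_ h.aestronglyMeasurable
    refine AEStronglyMeasurable.mul
      ((measurable_weylFunction F).comp_aemeasurable h.aemeasurable).aestronglyMeasurable ?_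
    exact ((Complex.measurable_exp.comp_aemeasurable
      (aemeasurable_const.mul (hmeas _))).sub aemeasurable_const).aestronglyMeasurable
  · rw [norm_smul, norm_mul, norm_mul, norm_weylFunction, one_mul, ← mul_assoc, ← mul_assoc]
    refine mul_le_mul_of_nonneg_right ?_ (norm_nonneg _)
    calc ‖(u n)⁻¹‖ * ‖Complex.exp (Complex.I * (c (u n) (classMap ς (T x)) : ℂ)) - 1‖
        ≤ ‖(u n)⁻¹‖ * ‖c (u n) (classMap ς (T x))‖ := by
          gcongr
          exact Real.norm_exp_I_mul_ofReal_sub_one_le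
      _ = ‖D n (classMap ς (T x))‖ := by rw [← norm_smul]; rfl
      _ ≤ ‖D n‖ * ‖classMap ς (T x)‖ := (D n).le_opNorm _
      _ ≤ C * (1 + ς (T x)) ^ 1 := by
          rw [norm_classMap, pow_one]
          have h1 : 0 ≤ ς (T x) := apply_nonneg ς _
          have := mul_le_mul_of_nonneg_right (hC n) h1
          nlinarith
  · have hexp : HasDerivAt (fun t => Complex.exp (Complex.I * (c t (classMap ς (T x)) : ℂ)))
        (Complex.I * (G (classMap ς (T x)) : ℂ)) 0 := by
      have := (((hc (classMap ς (T x))).ofReal_comp).const_mul Complex.I).cexp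
      simpa [h0] using this
    have h1 := (hasDerivAt_iff_tendsto_slope_zero.1 hexp).comp hu
    have h2 := (h1.const_mul (weylFunction (T x) F)).mul_const (k x)
    refine (h2.congr fun n => ?_).trans (le_of_eq (by ring_nf))
    simp only [Function.comp_apply, h0, zero_add, zero_apply, Complex.ofReal_zero,
      mul_zero, Complex.exp_zero, Complex.real_smul]
    ring

/-- A derivative in direction `G` is again a Fourier integral, with density multiplied by `i G([T
x])`; each differentiation uses up one moment. -/
lemma dirContDiff (h : HasMoments ς n M T k) : DirContDiff ς hς n (fourierInt M T k) := by
  induction n generalizing k with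
  | zero => exact continuous_fourierInt h.carried h.aemeasurable h.integrable
  | succ n ih =>
    refine ⟨continuous_fourierInt h.carried h.aemeasurable h.integrable, fun G =>
      ⟨fourierInt M T (fun x => Complex.I * (G (classMap ς (T x)) : ℂ) * k x), fun F => ?_, ?_⟩⟩
    · have := (h.mono (m := 1) (by omega)).hasDerivAt_curve (hς := hς) F G (fun t => t • G)
        (zero_smul ℝ G) fun φ => by simpa using (hasDerivAt_id (0 : ℝ)).mul_const (G φ)
      exact this
    · refine ih (h.mul_of_norm_le (C := ‖G‖) ?_ fun x => ?_)
      · exact (aemeasurable_const.mul (Complex.measurable_ofReal.comp_aemeasurable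
          ((measurable_linearMap (G.toLinearMap.comp (classMap ς))).comp_aemeasurable
            h.aemeasurable))).aestronglyMeasurable
      · rw [norm_mul, Complex.norm_I, one_mul, Complex.norm_real, pow_one]
        refine (G.le_opNorm _).trans ?_
        rw [norm_classMap]
        have := norm_nonneg G
        nlinarith

/-- The functional `G` commutes with the Bochner integral, so the derivative along a curve is `G`
applied to a single vector independent of the curve. -/
lemma hasTotalDifferentialAt (h : HasMoments ς 1 M T k) (F : WeakDual ℝ E) :
    HasTotalDifferentialAt ς hς (fourierInt M T k)
      (Complex.I • ∫ x, (weylFunction (T x) F * k x) • Complexified.ofReal (classMap ς (T x)) ∂M)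
      F := fun G c h0 hc => by
  convert h.hasDerivAt_curve F G c h0 hc using 1
  rw [Complexified.eval_smul, ← Complexified.evalCLM_apply,
    ← ContinuousLinearMap.integral_comp_comm _ (h.integrable_smul_ofReal F), fourierInt,
    ← integral_const_mul]
  refine integral_congr_ae (ae_of_all _ fun x => ?_)
  simp only [Complexified.evalCLM_apply, Complexified.eval_smul, Complexified.eval_ofReal]
  ring

/-- The two factors `i` of the differentials cancel the minus sign of the bracket. Then `σ_ς` moves
inside both Bochner integrals and Fubini combines them. -/
lemma phaseBracket_eq [SFinite M] [SFinite N] (h : HasMoments ς 1 M T k)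
    (h' : HasMoments ς 1 N T' k') {σ : LinearMap.BilinForm ℝ E}
    (hσς : ∃ c : ℝ, 0 < c ∧ ∀ f g, |σ f g| ≤ c * ς f * ς g) :
    phaseBracket ς hς σ hσς (fourierInt M T k) (fourierInt N T' k') =
      fourierInt (M.prod N) (fun z => T z.1 + T' z.2)
        fun z => (σ (T z.1) (T' z.2) : ℂ) * (k z.1 * k' z.2) := by
  funext F
  have hb : HasMoments ς 0 (M.prod N) (fun z => T z.1 + T' z.2)
    fun z => (σ (T z.1) (T' z.2) : ℂ) * (k z.1 * k' z.2) := h.bracket h' hσς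
  rw [phaseBracket, (h.hasTotalDifferentialAt F).totalDifferential_eq,
    (h'.hasTotalDifferentialAt F).totalDifferential_eq, Complexified.bilin_smul_left,
    Complexified.bilin_smul_right, ← mul_assoc, Complex.I_mul_I, neg_mul, one_mul, neg_neg,
    fourierInt, integral_prod _ (integrable_weylFunction_mul hb.aemeasurable hb.integrable F),
    ← Complexified.bilinCLM_apply, ← ContinuousLinearMap.flip_apply,
    ← ContinuousLinearMap.integral_comp_comm _ (h.integrable_smul_ofReal F)]
  refine integral_congr_ae (ae_of_all _ fun x => ?_)
  dsimp only
  rw [ContinuousLinearMap.flip_apply,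
    ← ContinuousLinearMap.integral_comp_comm _ (h'.integrable_smul_ofReal F)]
  refine integral_congr_ae (ae_of_all _ fun y => ?_)
  simp only [Complexified.bilinCLM_apply, Complexified.bilin_smul_left,
    Complexified.bilin_smul_right, Complexified.bilin_ofReal, extendedForm_classMap,
    weylFunction_add]
  ring

end Calculus

end HasMoments

section Jacobi

lemma measurePreserving_cycle (M : Measure X) (N : Measure Y) (R : Measure Z) [SFinite M]
    [SFinite N] [SFinite R] :
    MeasurePreserving (fun p : X × Y × Z => (p.2.1, p.2.2, p.1)) (M.prod (N.prod R))
      (N.prod (R.prod M)) :=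
  (measurePreserving_prodAssoc N R M).comp Measure.measurePreserving_swap

variable [IsTopologicalAddGroup E] [ContinuousSMul ℝ E] {ς : Seminorm ℝ E} {hς : Continuous ς}

/-- After cyclic changes of variables all three terms live on one triple product with the same Weyl
factor and densities. What remains is `σ(x,y+z)σ(y,z) + σ(y,z+x)σ(z,x) + σ(z,x+y)σ(x,y) = 0`, which
follows from antisymmetry. A variable can occur in both the inner and the outer form, whence two
moments. -/
lemma phaseBracket_jacobi {M : Measure X} {N : Measure Y} {R : Measure Z} [SFinite M] [SFinite N]
    [SFinite R] {T : X → E} {T' : Y → E} {T'' : Z → E} {k : X → ℂ} {k' : Y → ℂ} {k'' : Z → ℂ}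
    (h : HasMoments ς 2 M T k) (h' : HasMoments ς 2 N T' k') (h'' : HasMoments ς 2 R T'' k'')
    {σ : LinearMap.BilinForm ℝ E} (hσ : σ.IsAlt)
    (hσς : ∃ c : ℝ, 0 < c ∧ ∀ f g, |σ f g| ≤ c * ς f * ς g) :
    phaseBracket ς hς σ hσς (fourierInt M T k)
        (phaseBracket ς hς σ hσς (fourierInt N T' k') (fourierInt R T'' k'')) +
      phaseBracket ς hς σ hσς (fourierInt N T' k')
        (phaseBracket ς hς σ hσς (fourierInt R T'' k'') (fourierInt M T k)) +
      phaseBracket ς hς σ hσς (fourierInt R T'' k'')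
        (phaseBracket ς hς σ hσς (fourierInt M T k) (fourierInt N T' k')) = 0 := by
  have a := h.mono one_le_two
  have a' := h'.mono one_le_two
  have a'' := h''.mono one_le_two
  have e1 : HasMoments ς 1 _ _ _ := h'.bracket h'' hσς
  have e2 : HasMoments ς 1 _ _ _ := h''.bracket h hσς
  have e3 : HasMoments ς 1 _ _ _ := h.bracket h' hσς
  have d1 : HasMoments ς 0 _ _ _ := a.bracket e1 hσς
  have d2 : HasMoments ς 0 _ _ _ := a'.bracket e2 hσς
  have d3 : HasMoments ς 0 _ _ _ := a''.bracket e3 hσς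
  rw [a'.phaseBracket_eq a'', a''.phaseBracket_eq a, a.phaseBracket_eq a', a.phaseBracket_eq e1,
    a'.phaseBracket_eq e2, a''.phaseBracket_eq e3]
  funext F
  have i1 := integrable_weylFunction_mul d1.aemeasurable d1.integrable F
  have i2 := integrable_weylFunction_mul d2.aemeasurable d2.integrable F
  have i3 := integrable_weylFunction_mul d3.aemeasurable d3.integrable F
  have c1 := measurePreserving_cycle M N R
  have c2 := (measurePreserving_cycle N R M).comp c1
  have emb1 : MeasurableEmbedding fun p : X × Y × Z => (p.2.1, p.2.2, p.1) :=
    (MeasurableEquiv.prodComm.trans MeasurableEquiv.prodAssoc).measurableEmbedding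
  have emb2 : MeasurableEmbedding fun p : Y × Z × X => (p.2.1, p.2.2, p.1) :=
    (MeasurableEquiv.prodComm.trans MeasurableEquiv.prodAssoc).measurableEmbedding
  simp only [Pi.add_apply, Pi.zero_apply, fourierInt]
  have j1 := (c1.integrable_comp_emb emb1).2 i2
  have j2 := (c2.integrable_comp_emb (emb2.comp emb1)).2 i3
  rw [← c1.integral_comp emb1, ← c2.integral_comp (emb2.comp emb1)]
  refine (congrArg (· + _) (integral_add i1 j1).symm).trans ?_
  refine (integral_add (i1.add j1) j2).symm.trans ?_
  refine integral_eq_zero_of_ae (ae_of_all _ fun p => ?_)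
  obtain ⟨x, y, z⟩ := p
  have s1 := hσ.neg_eq (T x) (T' y)
  have s2 := hσ.neg_eq (T' y) (T'' z)
  have s3 := hσ.neg_eq (T'' z) (T x)
  simp only [weylFunction_add, Pi.add_apply, Function.comp_apply, map_add, Complex.ofReal_add,
    Pi.zero_apply, ← s1, ← s2, ← s3, Complex.ofReal_neg]
  ring

end Jacobi

end FourierIntegral

/-! ### Injectivity of the Fourier transformation -/

section SequenceSpace

lemma ext_of_sequence_char_eq {P P' : Measure (ℕ → ℝ)} [IsFiniteMeasure P] [IsFiniteMeasure P']
    (h : ∀ w : ℕ →₀ ℝ, ∫ v, Complex.exp (Complex.I * (Finsupp.linearCombination ℝ v w : ℝ)) ∂P =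
      ∫ v, Complex.exp (Complex.I * (Finsupp.linearCombination ℝ v w : ℝ)) ∂P') : P = P' := by
  let _ := TopologicalSpace.upgradeIsCompletelyMetrizable (ℕ → ℝ)
  -- With the discrete topology, joint continuity of the pairing reduces to continuity in `v` for
  -- each fixed `w`.
  let _ : TopologicalSpace (ℕ →₀ ℝ) := ⊥
  have : DiscreteTopology (ℕ →₀ ℝ) := ⟨rfl⟩
  let L : (ℕ → ℝ) →ₗ[ℝ] (ℕ →₀ ℝ) →ₗ[ℝ] ℝ :=
    LinearMap.mk₂ ℝ (fun v w => Finsupp.linearCombination ℝ v w)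
      (fun v v' w => by
        simp [Finsupp.linearCombination_apply, Finsupp.sum, mul_add, Finset.sum_add_distrib])
      (fun a v w => by
        simp [Finsupp.linearCombination_apply, Finsupp.sum, Finset.mul_sum, mul_left_comm])
      (fun v w w' => map_add _ w w') (fun a v w => map_smul _ a w)
  have hL : Continuous fun p : (ℕ → ℝ) × (ℕ →₀ ℝ) => L p.1 p.2 := by
    refine continuous_prod_of_discrete_right.2 fun w => ?_
    change Continuous fun v => Finsupp.linearCombination ℝ v w
    simp only [Finsupp.linearCombination_apply, Finsupp.sum]
    fun_prop
  refine ext_of_integral_char_eq Real.continuous_probChar Real.probChar_ne_one (L := L)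
    (fun v hv h0 => hv ?_) hL fun w => ?_
  · funext i
    have := DFunLike.congr_fun h0 (Finsupp.single i 1)
    simpa [L] using this
  · simpa [BoundedContinuousFunction.char, L, Real.probChar_apply, mul_comm] using h w

/-- Since `|g| ≤ 1`, the measure `(1 + g) p` is positive and has the same characteristic function as
`p`. Uniqueness for positive measures gives `1 + g = 1` almost everywhere. -/
lemma ae_eq_zero_of_sequence_char {p : Measure (ℕ → ℝ)} [IsFiniteMeasure p] {g : (ℕ → ℝ) → ℝ}
    (hg : Measurable g) (hg1 : ∀ x, |g x| ≤ 1)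
    (h : ∀ w : ℕ →₀ ℝ,
      ∫ v, Complex.exp (Complex.I * (Finsupp.linearCombination ℝ v w : ℝ)) * g v ∂p = 0) :
    g =ᵐ[p] 0 := by
  have hgi : Integrable g p := Integrable.of_bound hg.aestronglyMeasurable 1 (ae_of_all _ hg1)
  have hfin : ∫⁻ x, ENNReal.ofReal (1 + g x) ∂p ≠ ∞ :=
    ((integrable_const 1).add hgi).lintegral_lt_top.ne
  have hm : Measurable fun x => ENNReal.ofReal (1 + g x) := (measurable_const.add hg).ennreal_ofReal
  have : IsFiniteMeasure (p.withDensity fun x => ENNReal.ofReal (1 + g x)) :=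
    isFiniteMeasure_withDensity hfin
  have he (w : ℕ →₀ ℝ) : Measurable fun v : ℕ → ℝ =>
      Complex.exp (Complex.I * (Finsupp.linearCombination ℝ v w : ℝ)) := by
    refine Continuous.measurable ?_
    simp only [Finsupp.linearCombination_apply, Finsupp.sum]
    fun_prop
  have hn (w : ℕ →₀ ℝ) (v : ℕ → ℝ) :
      ‖Complex.exp (Complex.I * (Finsupp.linearCombination ℝ v w : ℝ))‖ ≤ 1 := by
    rw [mul_comm, Complex.norm_exp_ofReal_mul_I]
  have hei (w : ℕ →₀ ℝ) : Integrable (fun v : ℕ → ℝ =>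
      Complex.exp (Complex.I * (Finsupp.linearCombination ℝ v w : ℝ))) p :=
    Integrable.of_bound (he w).aestronglyMeasurable 1 (ae_of_all _ (hn w))
  have heq : p.withDensity (fun x => ENNReal.ofReal (1 + g x)) = p := by
    refine ext_of_sequence_char_eq fun w => ?_
    rw [integral_withDensity_eq_integral_toReal_smul hm (ae_of_all _ fun _ => ENNReal.ofReal_lt_top)]
    have e1 : ∀ v : ℕ → ℝ, (ENNReal.ofReal (1 + g v)).toReal •
        Complex.exp (Complex.I * (Finsupp.linearCombination ℝ v w : ℝ)) =
        Complex.exp (Complex.I * (Finsupp.linearCombination ℝ v w : ℝ)) +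
        Complex.exp (Complex.I * (Finsupp.linearCombination ℝ v w : ℝ)) * g v := fun v => by
      rw [ENNReal.toReal_ofReal (by linarith [(abs_le.1 (hg1 v)).1]), Complex.real_smul]
      push_cast
      ring
    simp only [e1]
    rw [integral_add (hei w), h w, add_zero]
    exact hgi.ofReal.bdd_mul (he w).aestronglyMeasurable (ae_of_all _ (hn w))
  have h1 : p.withDensity (fun x => ENNReal.ofReal (1 + g x)) = p.withDensity 1 := by
    rw [heq, withDensity_one]
  filter_upwards [(withDensity_eq_iff hm.aemeasurable measurable_one.aemeasurable hfin).1 h1]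
    with x hx
  rw [Pi.one_apply, ENNReal.ofReal_eq_one] at hx
  simpa using hx

lemma eq_zero_of_sequence_char {ρ : ComplexMeasure (ℕ → ℝ)}
    (h : ∀ w : ℕ →₀ ℝ,
      ρ.integral (fun v => Complex.exp (Complex.I * (Finsupp.linearCombination ℝ v w : ℝ)))
        (ContinuousLinearMap.mul ℝ ℂ) = 0) : ρ = 0 := by
  simp only [integral_mul_eq] at h
  have he (w : ℕ →₀ ℝ) : Measurable fun v : ℕ → ℝ =>
      Complex.exp (Complex.I * (Finsupp.linearCombination ℝ v w : ℝ)) := by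
    refine Continuous.measurable ?_
    simp only [Finsupp.linearCombination_apply, Finsupp.sum]
    fun_prop
  have hn (w : ℕ →₀ ℝ) (v : ℕ → ℝ) :
      ‖Complex.exp (Complex.I * (Finsupp.linearCombination ℝ v w : ℝ))‖ ≤ 1 := by
    rw [mul_comm, Complex.norm_exp_ofReal_mul_I]
  have hi (w : ℕ →₀ ℝ) := (integrable_phase ρ).bdd_mul (he w).aestronglyMeasurable
    (ae_of_all _ (hn w))
  have hc (w : ℕ →₀ ℝ) : Integrable (fun v : ℕ → ℝ =>
      Complex.exp (Complex.I * (Finsupp.linearCombination ℝ v w : ℝ)) *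
        starRingEnd ℂ (phase ρ v)) ρ.variation := ((Complex.conjLIE.integrable_comp_iff
    (φ := phase ρ)).2 (integrable_phase ρ)).bdd_mul (he w).aestronglyMeasurable
    (ae_of_all _ (hn w))
  -- Conjugating the hypothesis at `-w` yields the conjugate phase, so that real and imaginary parts
  -- can be treated separately.
  have h' (w : ℕ →₀ ℝ) : ∫ v, Complex.exp (Complex.I * (Finsupp.linearCombination ℝ v w : ℝ)) *
      starRingEnd ℂ (phase ρ v) ∂ρ.variation = 0 := by
    have := congrArg (starRingEnd ℂ) (h (-w))
    rw [← integral_conj, map_zero] at this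
    rw [← this]
    refine integral_congr_ae (ae_of_all _ fun v => ?_)
    simp [← Complex.exp_conj]
  have hre := ae_eq_zero_of_sequence_char (p := ρ.variation) (g := fun v => (phase ρ v).re)
    (Complex.measurable_re.comp (measurable_phase ρ))
    (fun v => (Complex.abs_re_le_norm _).trans (norm_phase ρ v).le) fun w => by
      have : ∀ v : ℕ → ℝ, Complex.exp (Complex.I * (Finsupp.linearCombination ℝ v w : ℝ)) *
          ((phase ρ v).re : ℂ) = (1 / 2 : ℂ) *
          (Complex.exp (Complex.I * (Finsupp.linearCombination ℝ v w : ℝ)) * phase ρ v +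
          Complex.exp (Complex.I * (Finsupp.linearCombination ℝ v w : ℝ)) *
            starRingEnd ℂ (phase ρ v)) := fun v => by
        rw [Complex.re_eq_add_conj]; ring
      simp only [this]
      rw [integral_const_mul, integral_add (hi w) (hc w), h, h']
      simp
  have him := ae_eq_zero_of_sequence_char (p := ρ.variation) (g := fun v => (phase ρ v).im)
    (Complex.measurable_im.comp (measurable_phase ρ))
    (fun v => (Complex.abs_im_le_norm _).trans (norm_phase ρ v).le) fun w => by
      have : ∀ v : ℕ → ℝ, Complex.exp (Complex.I * (Finsupp.linearCombination ℝ v w : ℝ)) *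
          ((phase ρ v).im : ℂ) = (1 / (2 * Complex.I) : ℂ) *
          (Complex.exp (Complex.I * (Finsupp.linearCombination ℝ v w : ℝ)) * phase ρ v -
          Complex.exp (Complex.I * (Finsupp.linearCombination ℝ v w : ℝ)) *
            starRingEnd ℂ (phase ρ v)) := fun v => by
        rw [Complex.im_eq_sub_conj]; ring
      simp only [this]
      rw [integral_const_mul, integral_sub (hi w) (hc w), h, h']
      simp
  rw [← withDensity_phase ρ, WithDensityᵥEq.congr_ae (g := 0), withDensityᵥ_zero]
  filter_upwards [hre, him] with v h1 h2
  exact Complex.ext h1 h2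

end SequenceSpace

section Injectivity

lemma apply_congr_ae {X : Type*} [MeasurableSpace X] {μ : ComplexMeasure X} {A B : Set X}
    (hA : MeasurableSet A) (hB : MeasurableSet B) (h : ∀ᵐ x ∂μ.variation, x ∈ A ↔ x ∈ B) :
    μ A = μ B := by
  rw [← withDensity_phase μ, withDensityᵥ_apply (integrable_phase μ) hA,
    withDensityᵥ_apply (integrable_phase μ) hB]
  exact setIntegral_congr_set (h.mono fun x hx => propext hx)

variable {E : Type*} [AddCommGroup E] [Module ℝ E]
  [TopologicalSpace E] [IsTopologicalAddGroup E] [ContinuousSMul ℝ E] [LocallyConvexSpace ℝ E]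
  [T2Space E]

/-- By Hahn–Banach for `τ`, the coordinate functionals of each initial span are restrictions of
continuous functionals on `E`; countably many suffice for all initial spans. -/
lemma exists_separating_sequence (b : ℕ → E) : ∃ G : ℕ → StrongDual ℝ E,
    ∀ f ∈ Submodule.span ℝ (Set.range b), (∀ n, G n f = 0) → f = 0 := by
  have h (n : ℕ) : ∃ G : ℕ → StrongDual ℝ E, ∀ f ∈ initialSpan b n, (∀ i, G i f = 0) → f = 0 := by
    have hs := SeparatingDual.dualMap_surjective_iff (R := ℝ)
      (f := (initialSpan b n).subtype) |>.2 (Submodule.subtype_injective _)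
    choose G hG using fun i => hs ((Module.finBasis ℝ (initialSpan b n)).coord i)
    refine ⟨fun i => if h : i < Module.finrank ℝ (initialSpan b n) then G ⟨i, h⟩ else 0,
      fun f hf h0 => ?_⟩
    have : (⟨f, hf⟩ : initialSpan b n) = 0 := by
      refine (Module.finBasis ℝ (initialSpan b n)).forall_coord_eq_zero_iff.1 fun i => ?_
      have h1 := h0 i
      simp only [dif_pos i.2] at h1
      rw [← hG i]
      exact h1
    exact congrArg Subtype.val this
  choose G hG using h
  refine ⟨fun n => G n.unpair.1 n.unpair.2, fun f hf h0 => ?_⟩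
  rw [← SetLike.mem_coe, ← iUnion_initialSpan, Set.mem_iUnion] at hf
  obtain ⟨n, hn⟩ := hf
  exact hG n f hn fun i => by simpa using h0 (Nat.pair n i)

variable [MeasurableSpace E] [FinestBorelSpace E]

/-- The characteristic function of the image of `μ` under the separating sequence is `μ̂` at finite
combinations of its members. So the image is zero, and injectivity on the carrier lets it determine
`μ`. -/
lemma eq_zero_of_measureFourier_eq_zero {μ : ComplexMeasure E} (hμ : μ ∈ regularMeasures E)
    (h : ∀ F, measureFourier μ F = 0) : μ = 0 := by
  obtain ⟨b, hb⟩ := mem_regularMeasures_iff.1 hμ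
  obtain ⟨G, hG⟩ := exists_separating_sequence b
  let Φ (f : E) (n : ℕ) : ℝ := G n f
  have hΦ : Measurable Φ := measurable_pi_lambda _ fun n => measurable_linearMap (G n).toLinearMap
  have hmap : μ.map Φ = 0 := by
    refine eq_zero_of_sequence_char fun w => ?_
    have he : Continuous fun v : ℕ → ℝ =>
        Complex.exp (Complex.I * (Finsupp.linearCombination ℝ v w : ℝ)) := by
      simp only [Finsupp.linearCombination_apply, Finsupp.sum]
      fun_prop
    rw [VectorMeasure.integral_map hΦ he.aestronglyMeasurable]
    · rw [← h (StrongDual.toWeakDual (Finsupp.linearCombination ℝ G w)), measureFourier]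
      congr 1
      funext f
      have : Finsupp.linearCombination ℝ (Φ f) w =
          StrongDual.toWeakDual (Finsupp.linearCombination ℝ G w) f := by
        change _ = (Finsupp.linearCombination ℝ G w) f
        simp [Finsupp.linearCombination_apply, Finsupp.sum, Φ]
      rw [weylFunction, this]
    · refine Integrable.of_bound (he.measurable.comp hΦ).aestronglyMeasurable 1
        (ae_of_all _ fun f => ?_)
      rw [Function.comp_apply, mul_comm, Complex.norm_exp_ofReal_mul_I]
  -- `K` consists of the coordinate sequences of vectors in the span. It is a Borel copy of the
  -- carrier inside a Polish space, on which Lusin–Souslin makes the images of Borel sets Borel.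
  let K : Set (ℕ → ℝ) := {x | (fun i => coords b (synthesis b x) i) = x}
  have hK : MeasurableSet K := measurableSet_eq_fun
    ((measurable_coords b).comp (measurable_synthesis b)) measurable_id
  have hinj : ∀ f ∈ Submodule.span ℝ (Set.range b), ∀ g ∈ Submodule.span ℝ (Set.range b),
      Φ f = Φ g → f = g := fun f hf g hg hfg => by
    refine sub_eq_zero.1 (hG _ (Submodule.sub_mem _ hf hg) fun n => ?_)
    rw [map_sub, sub_eq_zero]
    exact congrFun hfg n
  have hinjK : Set.InjOn (Φ ∘ synthesis b) K := fun x hx y hy hxy => by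
    have := hinj _ (synthesis_mem_span b x) _ (synthesis_mem_span b y) hxy
    rw [← show _ = x from hx, ← show _ = y from hy, this]
  ext A hA
  have hB : MeasurableSet ((Φ ∘ synthesis b) '' (K ∩ synthesis b ⁻¹' A)) :=
    (hK.inter (measurable_synthesis b hA)).image_of_measurable_injOn
      (hΦ.comp (measurable_synthesis b)) (hinjK.mono Set.inter_subset_left)
  rw [apply_congr_ae hA (hΦ hB), ← VectorMeasure.map_apply _ hΦ hB, hmap]
  · rfl
  · filter_upwards [hb] with f hf
    have hs : synthesis b (fun i => coords b f i) = f := by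
      rw [synthesis_finsupp, linearCombination_coords hf]
    constructor
    · intro hfA
      refine ⟨fun i => coords b f i, ⟨?_, ?_⟩, ?_⟩
      · change (fun i => coords b (synthesis b fun i => coords b f i) i) = _
        rw [hs]
      · rwa [Set.mem_preimage, hs]
      · rw [Function.comp_apply, hs]
    · rintro ⟨x, ⟨-, hx⟩, hxf⟩
      rw [← hinj _ (synthesis_mem_span b x) _ hf hxf]
      exact hx

end Injectivity

lemma integrable_add_pow {X : Type*} [MeasurableSpace X] {M : Measure X} {p q : X → ℝ}
    (hp0 : ∀ f, 0 ≤ p f) (hq0 : ∀ f, 0 ≤ q f) (hpm : Measurable p) (hqm : Measurable q) {m : ℕ} (hp : Integrable (fun f => p f ^ m) M)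
    (hq : Integrable (fun f => q f ^ m) M) : Integrable (fun f => (p f + q f) ^ m) M := by
  refine ((hp.add hq).const_mul (2 ^ (m - 1))).mono
    ((hpm.add hqm).pow_const m).aestronglyMeasurable (ae_of_all _ fun f => ?_)
  have h1 := hp0 f
  have h2 := hq0 f
  rw [Real.norm_of_nonneg (by positivity)]
  exact (add_pow_le h1 h2 m).trans (le_abs_self _)

/-! ### From moments of measures to moments of densities -/

section Moments

variable {E : Type*} [AddCommGroup E] [Module ℝ E] [MeasurableSpace E] [FinestBorelSpace E]

lemma lintegral_pow_lt_top_iff (κ : Seminorm ℝ E) (m : ℕ) (M : Measure E) :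
    ∫⁻ f, ENNReal.ofReal (κ f ^ m) ∂M < ∞ ↔ Integrable (fun f => κ f ^ m) M := by
  have hm := ((measurable_seminorm κ).pow_const m).aestronglyMeasurable (μ := M)
  have h0 : 0 ≤ᵐ[M] fun f => κ f ^ m := ae_of_all _ fun f => pow_nonneg (apply_nonneg κ f) m
  rw [← hasFiniteIntegral_iff_ofReal h0]
  exact ⟨fun h => ⟨hm, h⟩, fun h => h.2⟩

/-- The weight `(1 + κ)^m` is at most `2^(m-1) (1 + κ^m)`. -/
lemma hasMoments_of_mem {κ : Seminorm ℝ E} {n : ℕ∞} {μ : ComplexMeasure E}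
    (hμ : μ ∈ momentMeasures κ n) {m : ℕ} (hm : (m : ℕ∞) ≤ n) :
    HasMoments κ m μ.variation (fun f => f) (phase μ) := by
  refine ⟨aemeasurable_id', mem_regularMeasures_iff.1 hμ.1,
    (measurable_phase μ).aestronglyMeasurable, ?_⟩
  have h1 := (lintegral_pow_lt_top_iff κ m _).1 (hμ.2 m hm)
  simp only [norm_phase, mul_one]
  refine (((integrable_const 1).add h1).const_mul (2 ^ (m - 1))).mono
    ((measurable_const.add (measurable_seminorm κ)).pow_const m).aestronglyMeasurable
    (ae_of_all _ fun f => ?_)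
  have h0 : 0 ≤ κ f := apply_nonneg κ f
  rw [Real.norm_of_nonneg (by positivity)]
  refine (add_pow_le zero_le_one h0 m).trans ?_
  rw [one_pow]
  exact le_abs_self _

lemma integrable_sum_pow {M : Measure E} [IsFiniteMeasure M] (Γ : Finset (Seminorm ℝ E))
    (c : Seminorm ℝ E → ℝ) (hc : ∀ κ ∈ Γ, 0 ≤ c κ)
    (h : ∀ κ ∈ Γ, ∀ m : ℕ, Integrable (fun f => κ f ^ m) M) (m : ℕ) :
    Integrable (fun f => (∑ κ ∈ Γ, c κ * κ f) ^ m) M := by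
  classical
  induction Γ using Finset.induction_on with
  | empty => simp
  | insert κ Γ hκ ih =>
    simp only [Finset.sum_insert hκ]
    have ih' := ih (fun κ' h' => hc κ' (Finset.mem_insert_of_mem h'))
      fun κ' h' => h κ' (Finset.mem_insert_of_mem h')
    have hm (κ' : Seminorm ℝ E) : Measurable fun f => c κ' * κ' f :=
      (measurable_seminorm κ').const_mul _
    refine integrable_add_pow (p := fun f => c κ * κ f) (q := fun f => ∑ κ' ∈ Γ, c κ' * κ' f)
      (fun f => mul_nonneg (hc κ (Finset.mem_insert_self κ Γ)) (apply_nonneg κ f))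
      (fun f => Finset.sum_nonneg fun κ' h' => mul_nonneg
        (hc κ' (Finset.mem_insert_of_mem h')) (apply_nonneg κ' f))
      (hm κ) (Finset.measurable_fun_sum Γ fun κ' _ => hm κ') ?_ ih'
    simp only [mul_pow]
    exact (h κ (Finset.mem_insert_self κ Γ) m).const_mul _

end Moments

/-! ### Convolutions with a kernel, and the involution -/

section Convolution

variable {E : Type*} [AddCommGroup E] [MeasurableSpace E]

/-- The iterated integral `∫ dμ(f) ∫ dν(g) q(f,g) 1_A(f+g)`. -/
noncomputable def kernelConvOn (q : E → E → ℂ) (μ ν : ComplexMeasure E) (A : Set E) : ℂ :=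
  μ.integral (fun f => ν.integral
    (fun g => q f g * A.indicator (fun _ => (1 : ℂ)) (f + g))
    (ContinuousLinearMap.mul ℝ ℂ)) (ContinuousLinearMap.mul ℝ ℂ)

lemma measureOfSetFun_eq {X : Type*} [MeasurableSpace X] {m : Set X → ℂ} {ρ : ComplexMeasure X}
    (h : ∀ A, MeasurableSet A → ρ A = m A) : measureOfSetFun m = ρ := by
  have h' : ∃ ρ : ComplexMeasure X, ∀ A, MeasurableSet A → ρ A = m A := ⟨ρ, h⟩
  rw [measureOfSetFun, dif_pos h']
  ext A hA
  rw [h'.choose_spec A hA, h A hA]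

lemma kernelConvOn_eq_zero_of_ae {q : E → E → ℂ} {μ ν : ComplexMeasure E} {A : Set E}
    (h : ∀ᵐ f ∂μ.variation, ∀ᵐ g ∂ν.variation, f + g ∉ A) : kernelConvOn q μ ν A = 0 := by
  refine VectorMeasure.integral_eq_zero_of_ae ?_
  filter_upwards [h] with f hf
  refine VectorMeasure.integral_eq_zero_of_ae ?_
  filter_upwards [hf] with g hg
  simp [hg]

variable [Module ℝ E] [FinestBorelSpace E]

lemma aemeasurable_add_of_regular {μ ν : ComplexMeasure E} (hμ : μ ∈ regularMeasures E)
    (hν : ν ∈ regularMeasures E) :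
    AEMeasurable (fun z : E × E => z.1 + z.2) (μ.variation.prod ν.variation) :=
  (mem_regularMeasures_iff.1 hμ).aemeasurable_add (mem_regularMeasures_iff.1 hν)
    aemeasurable_id' aemeasurable_id'

/-- The measure `(q · μ × ν)` pushed forward by addition. -/
noncomputable def kernelConv (q : E → E → ℂ) {μ ν : ComplexMeasure E}
    (hμ : μ ∈ regularMeasures E) (hν : ν ∈ regularMeasures E) : ComplexMeasure E :=
  pushDensity (μ.variation.prod ν.variation) (fun z => q z.1 z.2 * (phase μ z.1 * phase ν z.2))
    (aemeasurable_add_of_regular hμ hν)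

section Kernel

variable {q : E → E → ℂ} {μ ν : ComplexMeasure E} (hμ : μ ∈ regularMeasures E)
  (hν : ν ∈ regularMeasures E)
  (hq : Integrable (fun z : E × E => q z.1 z.2 * (phase μ z.1 * phase ν z.2))
    (μ.variation.prod ν.variation))

include hq

/-- Fubini: the iterated integral is the value of a genuine measure, the image under addition of a
density on the product space. -/
lemma kernelConv_apply {A : Set E} (hA : MeasurableSet A) :
    kernelConv q hμ hν A = kernelConvOn q μ ν A := by
  have hadd := aemeasurable_add_of_regular hμ hν
  have hind : Measurable (A.indicator fun _ => (1 : ℂ)) := measurable_const.indicator hA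
  have hi : Integrable (fun z : E × E => A.indicator (fun _ => (1 : ℂ)) (z.1 + z.2) *
      (q z.1 z.2 * (phase μ z.1 * phase ν z.2))) (μ.variation.prod ν.variation) := by
    refine hq.bdd_mul (c := 1) (hind.comp_aemeasurable hadd).aestronglyMeasurable
      (ae_of_all _ fun z => ?_)
    by_cases h : z.1 + z.2 ∈ A <;> simp [h]
  rw [kernelConv, pushDensity_apply _ hq hA, integral_prod _ hi, kernelConvOn, integral_mul_eq]
  refine integral_congr_ae (ae_of_all _ fun f => ?_)
  dsimp only
  rw [integral_mul_eq, ← integral_mul_const]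
  refine integral_congr_ae (ae_of_all _ fun g => ?_)
  ring

lemma measureOfSetFun_kernelConvOn :
    measureOfSetFun (kernelConvOn q μ ν) = kernelConv q hμ hν :=
  measureOfSetFun_eq fun _ hA => kernelConv_apply hμ hν hq hA

lemma ae_variation_kernelConv {p : E → Prop} (hp : MeasurableSet {f | p f})
    (h : ∀ᵐ z ∂μ.variation.prod ν.variation, p (z.1 + z.2)) :
    ∀ᵐ f ∂(kernelConv q hμ hν).variation, p f :=
  variation_pushDensity_eq_zero _ hq hp.compl (h.mono fun _ hz hz' => hz' hz)

lemma kernelConv_mem_regularMeasures : kernelConv q hμ hν ∈ regularMeasures E := by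
  obtain ⟨b, hb⟩ := (mem_regularMeasures_iff.1 hμ).add (mem_regularMeasures_iff.1 hν)
  exact mem_regularMeasures_iff.2
    ⟨b, ae_variation_kernelConv hμ hν hq
      (measurableSet_submodule (Submodule.span ℝ (Set.range b))) hb⟩

lemma measureFourier_kernelConv [TopologicalSpace E] :
    measureFourier (kernelConv q hμ hν) = fourierInt (μ.variation.prod ν.variation)
      (fun z => z.1 + z.2) (fun z => q z.1 z.2 * (phase μ z.1 * phase ν z.2)) :=
  funext fun F => integral_pushDensity _ hq (measurable_weylFunction F)
    (integrable_weylFunction_mul (aemeasurable_add_of_regular hμ hν) hq F)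

end Kernel

/-- Bounded kernels need no moments, so twisted convolution is defined on all of `𝓜(E)`. -/
lemma integrable_bounded_kernel {μ ν : ComplexMeasure E} (hμ : μ ∈ regularMeasures E)
    (σ : LinearMap.BilinForm ℝ E) {Θ : ℝ → ℂ} (hΘ : Measurable Θ) {C : ℝ}
    (hC : ∀ s, ‖Θ s‖ ≤ C) :
    Integrable (fun z : E × E => Θ (σ z.1 z.2) * (phase μ z.1 * phase ν z.2))
      (μ.variation.prod ν.variation) := by
  have h := (mem_regularMeasures_iff.1 hμ).aemeasurable_bilin (N := ν.variation)
    aemeasurable_id' aemeasurable_id' σ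
  exact ((integrable_phase μ).mul_prod (integrable_phase ν)).bdd_mul
    (hΘ.comp_aemeasurable h).aestronglyMeasurable (ae_of_all _ fun z => hC _)

end Convolution

section Variation

variable {X : Type*} [MeasurableSpace X]

lemma integrable_conj_phase (μ : ComplexMeasure X) :
    Integrable (fun f => starRingEnd ℂ (phase μ f)) μ.variation :=
  (Complex.conjLIE.integrable_comp_iff (φ := phase μ)).2 (integrable_phase μ)

lemma ae_variation_add {μ ν : ComplexMeasure X} {p : X → Prop} (h : ∀ᵐ f ∂μ.variation, p f)
    (h' : ∀ᵐ f ∂ν.variation, p f) : ∀ᵐ f ∂(μ + ν).variation, p f :=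
  ae_mono VectorMeasure.variation_add_le (ae_add_measure_iff.2 ⟨h, h'⟩)

lemma ae_variation_smul {μ : ComplexMeasure X} {p : X → Prop} (z : ℂ)
    (h : ∀ᵐ f ∂μ.variation, p f) : ∀ᵐ f ∂(z • μ).variation, p f := by
  rw [VectorMeasure.variation_smul]
  exact Measure.ae_smul_measure h _

end Variation

section Star

variable {E : Type*} [AddCommGroup E] [Module ℝ E] [MeasurableSpace E] [FinestBorelSpace E]

lemma measureStar_apply (μ : ComplexMeasure E) {A : Set E} (hA : MeasurableSet A) :
    measureStar μ A = starRingEnd ℂ (μ ((fun f => -f) ⁻¹' A)) := by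
  rw [measureStar, VectorMeasure.mapRange_apply, VectorMeasure.map_apply _ measurable_neg_finest hA]
  rfl

lemma measureStar_eq_pushDensity (μ : ComplexMeasure E) :
    measureStar μ = pushDensity μ.variation (fun f => starRingEnd ℂ (phase μ f))
      (T := fun f => -f) measurable_neg_finest.aemeasurable := by
  ext A hA
  rw [measureStar_apply μ hA, pushDensity_apply _ (integrable_conj_phase μ) hA]
  conv_lhs => rw [← withDensity_phase μ, withDensityᵥ_apply (integrable_phase μ)
    (measurable_neg_finest hA), ← integral_indicator (measurable_neg_finest hA), ← integral_conj]
  refine integral_congr_ae (ae_of_all _ fun f => ?_)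
  by_cases h : -f ∈ A <;> simp [h]

lemma ae_variation_measureStar {μ : ComplexMeasure E} {p : E → Prop} (hp : MeasurableSet {f | p f})
    (h : ∀ᵐ f ∂μ.variation, p (-f)) : ∀ᵐ f ∂(measureStar μ).variation, p f := by
  rw [measureStar_eq_pushDensity]
  exact variation_pushDensity_eq_zero _ (integrable_conj_phase μ) hp.compl
    (h.mono fun _ hz hz' => hz' hz)

end Star

lemma exists_kernel_bound {E : Type*} [AddCommGroup E] [Module ℝ E] {σ : LinearMap.BilinForm ℝ E}
    {ς : Seminorm ℝ E} (hσς : ∃ c : ℝ, 0 < c ∧ ∀ f g, |σ f g| ≤ c * ς f * ς g)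
    {Θ : ℝ → ℂ} (hb : ∀ s, ‖Θ s‖ ≤ 1 + |s|) :
    ∃ C : ℝ, 0 ≤ C ∧ ∀ f g, ‖Θ (σ f g)‖ ≤ C * ((1 + ς f) * (1 + ς g)) := by
  obtain ⟨c, hc, hσ⟩ := hσς
  refine ⟨1 + c, by positivity, fun f g => (hb _).trans ?_⟩
  have h1 : 0 ≤ ς f := apply_nonneg ς f
  have h2 : 0 ≤ ς g := apply_nonneg ς g
  have := hσ f g
  have h3 : 0 ≤ ς f * ς g := mul_nonneg h1 h2
  nlinarith [mul_nonneg hc.le h1, mul_nonneg hc.le h2]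

/-! ### Stability of the admissible spaces -/

section StableSets

variable {E : Type*} [AddCommGroup E] [Module ℝ E] [MeasurableSpace E]

/-- Sets of measures that are stable under the algebraic operations and, within
`𝓜^∞_ς(E)`, under all convolutions with kernels `Θ(σ(f,g))` of at most linear growth. -/
structure IsStable (σ : LinearMap.BilinForm ℝ E) (ς : Seminorm ℝ E) (Q : Set (ComplexMeasure E)) :
    Prop where
  zero : 0 ∈ Q
  add : ∀ μ ∈ Q, ∀ ν ∈ Q, μ + ν ∈ Q
  smul : ∀ (z : ℂ), ∀ μ ∈ Q, z • μ ∈ Q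
  star : ∀ μ ∈ Q, measureStar μ ∈ Q
  conv : ∀ μ ∈ Q, ∀ ν ∈ Q, μ ∈ momentMeasures ς ⊤ → ν ∈ momentMeasures ς ⊤ →
    ∀ Θ : ℝ → ℂ, Measurable Θ → (∀ s, ‖Θ s‖ ≤ 1 + |s|) →
      measureOfSetFun (kernelConvOn (fun f g => Θ (σ f g)) μ ν) ∈ Q

variable {σ : LinearMap.BilinForm ℝ E} {ς : Seminorm ℝ E}

lemma IsStable.inter {Q Q' : Set (ComplexMeasure E)} (h : IsStable σ ς Q) (h' : IsStable σ ς Q') :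
    IsStable σ ς (Q ∩ Q') where
  zero := ⟨h.zero, h'.zero⟩
  add μ hμ ν hν := ⟨h.add μ hμ.1 ν hν.1, h'.add μ hμ.2 ν hν.2⟩
  smul z μ hμ := ⟨h.smul z μ hμ.1, h'.smul z μ hμ.2⟩
  star μ hμ := ⟨h.star μ hμ.1, h'.star μ hμ.2⟩
  conv μ hμ ν hν h1 h2 Θ hΘ hb :=
    ⟨h.conv μ hμ.1 ν hν.1 h1 h2 Θ hΘ hb, h'.conv μ hμ.2 ν hν.2 h1 h2 Θ hΘ hb⟩

lemma IsStable.iInter {ι : Sort*} {Q : ι → Set (ComplexMeasure E)} (h : ∀ i, IsStable σ ς (Q i)) :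
    IsStable σ ς (⋂ i, Q i) where
  zero := Set.mem_iInter.2 fun i => (h i).zero
  add μ hμ ν hν := Set.mem_iInter.2 fun i =>
    (h i).add μ (Set.mem_iInter.1 hμ i) ν (Set.mem_iInter.1 hν i)
  smul z μ hμ := Set.mem_iInter.2 fun i => (h i).smul z μ (Set.mem_iInter.1 hμ i)
  star μ hμ := Set.mem_iInter.2 fun i => (h i).star μ (Set.mem_iInter.1 hμ i)
  conv μ hμ ν hν h1 h2 Θ hΘ hb := Set.mem_iInter.2 fun i =>
    (h i).conv μ (Set.mem_iInter.1 hμ i) ν (Set.mem_iInter.1 hν i) h1 h2 Θ hΘ hb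

variable [FinestBorelSpace E]

lemma mem_regularMeasures_of_finite {μ : ComplexMeasure E} {C : Set E} (hC : C.Finite)
    (h : ∀ᵐ f ∂μ.variation, f ∈ C) : μ ∈ regularMeasures E := by
  obtain ⟨b, hb⟩ := (hC.countable.insert 0).exists_eq_range (Set.insert_nonempty 0 C)
  exact mem_regularMeasures_iff.2 ⟨b, h.mono fun f hf =>
    Submodule.subset_span (hb ▸ Set.mem_insert_of_mem 0 hf)⟩

section Growth

variable (hσς : ∃ c : ℝ, 0 < c ∧ ∀ f g, |σ f g| ≤ c * ς f * ς g)

include hσς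

lemma integrable_kernel {μ ν : ComplexMeasure E} (hμ : μ ∈ momentMeasures ς ⊤)
    (hν : ν ∈ momentMeasures ς ⊤) {Θ : ℝ → ℂ} (hΘ : Measurable Θ) (hb : ∀ s, ‖Θ s‖ ≤ 1 + |s|) :
    Integrable (fun z : E × E => Θ (σ z.1 z.2) * (phase μ z.1 * phase ν z.2))
      (μ.variation.prod ν.variation) := by
  obtain ⟨C, -, hC⟩ := exists_kernel_bound hσς hb
  have h1 := hasMoments_of_mem hμ (m := 0 + 1) le_top
  have h2 := hasMoments_of_mem hν (m := 0 + 1) le_top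
  refine (h1.prod_mul h2 (q := fun z => Θ (σ z.1 z.2)) (C := C) ?_ fun z => ?_).integrable
  · exact (hΘ.comp_aemeasurable (h1.carried.aemeasurable_bilin h1.aemeasurable h2.aemeasurable
      σ)).aestronglyMeasurable
  · rw [pow_one, pow_one]
    exact hC _ _

/-- Stability of the measures carried by a set from a directed family. -/
lemma isStable_carried (p : Set E → Prop) (hm : ∀ C, p C → MeasurableSet C) (h0 : ∃ C, p C)
    (hdir : ∀ C C', p C → p C' → ∃ D, p D ∧ C ⊆ D ∧ C' ⊆ D ∧ (∀ f ∈ C, -f ∈ D) ∧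
      ∀ f ∈ C, ∀ g ∈ C', f + g ∈ D) :
    IsStable σ ς {μ | μ ∈ regularMeasures E ∧ ∃ C, p C ∧ ∀ᵐ f ∂μ.variation, f ∈ C} := by
  have hreg (μ : ComplexMeasure E) (h : ∃ b : ℕ → E,
      ∀ᵐ f ∂μ.variation, f ∈ Submodule.span ℝ (Set.range b)) : μ ∈ regularMeasures E :=
    mem_regularMeasures_iff.2 h
  constructor
  · obtain ⟨C, hC⟩ := h0
    exact ⟨hreg _ ⟨0, by simp⟩, C, hC, by simp⟩
  · rintro μ ⟨hμ, C, hC, hμC⟩ ν ⟨hν, C', hC', hνC⟩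
    obtain ⟨D, hD, h1, h2, -, -⟩ := hdir C C' hC hC'
    obtain ⟨b, hb, hb'⟩ := (mem_regularMeasures_iff.1 hμ).exists_common (mem_regularMeasures_iff.1 hν)
    exact ⟨hreg _ ⟨b, ae_variation_add hb hb'⟩, D, hD,
      ae_variation_add (hμC.mono fun _ h => h1 h) (hνC.mono fun _ h => h2 h)⟩
  · rintro z μ ⟨hμ, C, hC, hμC⟩
    obtain ⟨b, hb⟩ := mem_regularMeasures_iff.1 hμ
    exact ⟨hreg _ ⟨b, ae_variation_smul z hb⟩, C, hC, ae_variation_smul z hμC⟩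
  · rintro μ ⟨hμ, C, hC, hμC⟩
    obtain ⟨b, hb⟩ := mem_regularMeasures_iff.1 hμ
    obtain ⟨D, hD, -, -, h3, -⟩ := hdir C C hC hC
    exact ⟨hreg _ ⟨b, ae_variation_measureStar
      (measurableSet_submodule (Submodule.span ℝ (Set.range b)))
      (hb.mono fun _ h => Submodule.neg_mem _ h)⟩, D, hD,
      ae_variation_measureStar (hm D hD) (hμC.mono fun _ h => h3 _ h)⟩
  · rintro μ ⟨hμ, C, hC, hμC⟩ ν ⟨hν, C', hC', hνC⟩ hμ' hν' Θ hΘ hb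
    obtain ⟨D, hD, -, -, -, h4⟩ := hdir C C' hC hC'
    have hq := integrable_kernel hσς hμ' hν' hΘ hb
    rw [measureOfSetFun_kernelConvOn hμ hν hq]
    refine ⟨kernelConv_mem_regularMeasures hμ hν hq, D, hD,
      ae_variation_kernelConv hμ hν hq (hm D hD) ?_⟩
    exact (ae_prod_of_ae hμC hνC).mono fun z hz => h4 _ hz.1 _ hz.2

lemma isStable_regularMeasures : IsStable σ ς (regularMeasures E) := by
  have := isStable_carried hσς (fun C => C = Set.univ) (fun C h => h ▸ MeasurableSet.univ)
    ⟨_, rfl⟩ fun C C' _ _ => ⟨Set.univ, rfl, by simp⟩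
  simpa using this

lemma isStable_discreteMeasures : IsStable σ ς (discreteMeasures E) := by
  have := isStable_carried hσς Set.Countable (fun C h => h.measurableSet)
    ⟨∅, Set.countable_empty⟩ fun C C' h h' =>
      ⟨C ∪ C' ∪ (fun f => -f) '' C ∪ Set.image2 (· + ·) C C',
        ((h.union h').union (h.image _)).union (h.image2 h' _),
        fun f hf => Or.inl (Or.inl (Or.inl hf)), fun f hf => Or.inl (Or.inl (Or.inr hf)),
        fun f hf => Or.inl (Or.inr ⟨f, hf, rfl⟩), fun f hf g hg => Or.inr ⟨f, hf, g, hg, rfl⟩⟩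
  convert this using 1
  ext μ
  exact mem_discreteMeasures_iff

lemma isStable_finitelySupportedMeasures : IsStable σ ς (finitelySupportedMeasures E) := by
  have := isStable_carried hσς Set.Finite (fun C h => h.measurableSet)
    ⟨∅, Set.finite_empty⟩ fun C C' h h' =>
      ⟨C ∪ C' ∪ (fun f => -f) '' C ∪ Set.image2 (· + ·) C C',
        ((h.union h').union (h.image _)).union (h.image2 _ h'),
        fun f hf => Or.inl (Or.inl (Or.inl hf)), fun f hf => Or.inl (Or.inl (Or.inr hf)),
        fun f hf => Or.inl (Or.inr ⟨f, hf, rfl⟩), fun f hf g hg => Or.inr ⟨f, hf, g, hg, rfl⟩⟩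
  convert this using 1
  ext μ
  rw [mem_finitelySupportedMeasures_iff]
  exact ⟨fun ⟨C, hC, h⟩ => ⟨mem_regularMeasures_of_finite hC h, C, hC, h⟩, fun h => h.2⟩

/-- For the convolution, an atom at `f` would require `ν` to charge some point `f - g`. -/
lemma isStable_continuousMeasures : IsStable σ ς (continuousMeasures E) := by
  have hreg := isStable_regularMeasures hσς
  constructor
  · exact mem_continuousMeasures_iff.2 ⟨hreg.zero, fun f => rfl⟩
  · intro μ hμ ν hν
    rw [mem_continuousMeasures_iff] at *
    refine ⟨hreg.add _ hμ.1 _ hν.1, fun f => ?_⟩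
    rw [add_apply, hμ.2, hν.2, add_zero]
  · intro z μ hμ
    rw [mem_continuousMeasures_iff] at *
    refine ⟨hreg.smul z _ hμ.1, fun f => ?_⟩
    rw [smul_apply, hμ.2, smul_zero]
  · intro μ hμ
    rw [mem_continuousMeasures_iff] at *
    refine ⟨hreg.star _ hμ.1, fun f => ?_⟩
    have : (fun g : E => -g) ⁻¹' {f} = {-f} := by
      ext g
      simp
    rw [measureStar_apply μ (measurableSet_singleton f), this, hμ.2, map_zero]
  · intro μ hμ ν hν hμ' hν' Θ hΘ hb
    rw [mem_continuousMeasures_iff] at *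
    have hq := integrable_kernel hσς hμ' hν' hΘ hb
    refine ⟨hreg.conv _ hμ.1 _ hν.1 hμ' hν' Θ hΘ hb, fun f => ?_⟩
    rw [measureOfSetFun_kernelConvOn hμ.1 hν.1 hq, kernelConv_apply hμ.1 hν.1 hq
      (measurableSet_singleton f)]
    refine kernelConvOn_eq_zero_of_ae (ae_of_all _ fun g => ?_)
    have hat : ν.variation {f - g} = 0 := by
      rw [VectorMeasure.variation_apply_eq_zero (measurableSet_singleton _)]
      intro t ht _
      rcases Set.subset_singleton_iff_eq.1 ht with h | h
      · rw [h, VectorMeasure.empty]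
      · rw [h, hν.2]
    refine measure_mono_null (fun g' hg' => ?_) hat
    have : g + g' = f := by simpa using hg'
    rw [Set.mem_singleton_iff, ← this]
    abel

/-- The kernel grows with `ς` while the moments to be bounded are those of `κ`. Mixed moments are
controlled by `ab ≤ a² + b²`, so `2m` moments of `κ` and two of `ς` suffice, without any comparison
of `κ` and `ς`. -/
lemma isStable_momentCondition (κ : Seminorm ℝ E) :
    IsStable σ ς {μ | μ ∈ momentMeasures κ ⊤} := by
  have hreg := isStable_regularMeasures hσς
  have hmeas (m : ℕ) : Measurable fun f => ENNReal.ofReal (κ f ^ m) :=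
    ((measurable_seminorm κ).pow_const m).ennreal_ofReal
  constructor
  · refine ⟨hreg.zero, fun m _ => ?_⟩
    simp
  · rintro μ ⟨hμ, h⟩ ν ⟨hν, h'⟩
    refine ⟨hreg.add _ hμ _ hν, fun m hm => ?_⟩
    refine (lintegral_mono' VectorMeasure.variation_add_le le_rfl).trans_lt ?_
    rw [lintegral_add_measure]
    exact ENNReal.add_lt_top.2 ⟨h m hm, h' m hm⟩
  · rintro z μ ⟨hμ, h⟩
    refine ⟨hreg.smul z _ hμ, fun m hm => ?_⟩
    rw [VectorMeasure.variation_smul, lintegral_smul_measure]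
    exact ENNReal.mul_lt_top (by simp) (h m hm)
  · rintro μ ⟨hμ, h⟩
    refine ⟨hreg.star _ hμ, fun m hm => ?_⟩
    rw [measureStar_eq_pushDensity]
    refine (lintegral_variation_pushDensity_le _ (integrable_conj_phase μ) (hmeas m)).trans_lt ?_
    refine lt_of_le_of_lt (lintegral_mono fun f => ?_) (h m hm)
    rw [map_neg_eq_map, ← ofReal_norm, RCLike.norm_conj, norm_phase, ENNReal.ofReal_one, mul_one]
  · rintro μ hμ ν hν hμ' hν' Θ hΘ hb
    have hq := integrable_kernel hσς hμ' hν' hΘ hb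
    obtain ⟨C, hC0, hC⟩ := exists_kernel_bound hσς hb
    refine ⟨hreg.conv _ hμ.1 _ hν.1 hμ' hν' Θ hΘ hb, fun m hm => ?_⟩
    rw [measureOfSetFun_kernelConvOn hμ.1 hν.1 hq]
    refine (lintegral_variation_pushDensity_le _ hq (hmeas m)).trans_lt ?_
    have key {ρ : ComplexMeasure E} (hρ : ρ ∈ momentMeasures κ ⊤) (hρ' : ρ ∈ momentMeasures ς ⊤) :
        Integrable (fun f => (1 + κ f) ^ m * (1 + ς f)) ρ.variation := by
      have h1 := (hasMoments_of_mem hρ (m := 2 * m) le_top).moment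
      have h2 := (hasMoments_of_mem hρ' (m := 2) le_top).moment
      simp only [norm_phase, mul_one] at h1 h2
      refine (h1.add h2).mono (((measurable_const.add (measurable_seminorm κ)).pow_const m).mul
        (measurable_const.add (measurable_seminorm ς))).aestronglyMeasurable
        (ae_of_all _ fun f => ?_)
      have h3 : 0 ≤ κ f := apply_nonneg κ f
      have h4 : 0 ≤ ς f := apply_nonneg ς f
      rw [Real.norm_of_nonneg (by positivity)]
      refine le_trans ?_ (le_abs_self _)
      simp only [Pi.add_apply, mul_comm 2 m, pow_mul]
      nlinarith [sq_nonneg ((1 + κ f) ^ m - (1 + ς f)), sq_nonneg ((1 + κ f) ^ m),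
        sq_nonneg (1 + ς f)]
    have hint := (((key hμ hμ').mul_prod (key hν hν')).const_mul C).lintegral_lt_top
    refine lt_of_le_of_lt (lintegral_mono fun z => ?_) hint
    have h1 : 0 ≤ κ z.1 := apply_nonneg κ _
    have h2 : 0 ≤ κ z.2 := apply_nonneg κ _
    have h3 : 0 ≤ κ (z.1 + z.2) := apply_nonneg κ _
    have h4 : κ (z.1 + z.2) ≤ (1 + κ z.1) * (1 + κ z.2) := by
      have := map_add_le_add κ z.1 z.2
      nlinarith
    rw [← ofReal_norm, norm_mul, norm_mul, norm_phase, norm_phase, mul_one, mul_one,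
      ← ENNReal.ofReal_mul (by positivity)]
    refine ENNReal.ofReal_le_ofReal ?_
    calc κ (z.1 + z.2) ^ m * ‖Θ (σ z.1 z.2)‖
        ≤ ((1 + κ z.1) * (1 + κ z.2)) ^ m * (C * ((1 + ς z.1) * (1 + ς z.2))) := by
          gcongr
          exact hC _ _
      _ = C * ((1 + κ z.1) ^ m * (1 + ς z.1) * ((1 + κ z.2) ^ m * (1 + ς z.2))) := by
          rw [mul_pow]
          ring

lemma isStable_regular_inter_absContMeasures (S : Submodule ℝ E) :
    IsStable σ ς (regularMeasures E ∩ absContMeasures S) := by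
  have hreg := isStable_regularMeasures hσς
  have hS := measurableSet_submodule S
  constructor
  · exact ⟨hreg.zero, fun A _ _ => rfl, fun e A _ _ => rfl⟩
  · rintro μ ⟨hμ, h1, h2⟩ ν ⟨hν, h1', h2'⟩
    refine ⟨hreg.add _ hμ _ hν, fun A hA hd => ?_, fun e A hA h0 => ?_⟩
    · rw [add_apply, h1 A hA hd, h1' A hA hd, add_zero]
    · rw [add_apply, h2 e A hA h0, h2' e A hA h0, add_zero]
  · rintro z μ ⟨hμ, h1, h2⟩
    refine ⟨hreg.smul z _ hμ, fun A hA hd => ?_, fun e A hA h0 => ?_⟩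
    · rw [smul_apply, h1 A hA hd, smul_zero]
    · rw [smul_apply, h2 e A hA h0, smul_zero]
  · rintro μ ⟨hμ, h1, h2⟩
    refine ⟨hreg.star _ hμ, ?_, fun e A hA h0 => ?_⟩
    · rw [concentratedOn_iff hS] at h1 ⊢
      exact ae_variation_measureStar hS (h1.mono fun _ h => Submodule.neg_mem S h)
    -- Reflecting the set amounts to reflecting the coordinate system, and absolute continuity is
    -- known in every one.
    · rw [measureStar_apply μ hA, h2 (e.trans (LinearEquiv.neg ℝ)) _ (measurable_neg_finest hA),
        map_zero]
      simpa using h0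
  · rintro μ ⟨hμ, h1, h2⟩ ν ⟨hν, h1', h2'⟩ hμ' hν' Θ hΘ hb
    have hq := integrable_kernel hσς hμ' hν' hΘ hb
    have hc := (concentratedOn_iff hS).1 h1
    have hc' := (concentratedOn_iff hS).1 h1'
    refine ⟨hreg.conv _ hμ _ hν hμ' hν' Θ hΘ hb, ?_, fun e A hA h0 => ?_⟩
    · rw [measureOfSetFun_kernelConvOn hμ hν hq, concentratedOn_iff hS]
      exact ae_variation_kernelConv hμ hν hq hS
        ((ae_prod_of_ae hc hc').mono fun z hz => Submodule.add_mem S hz.1 hz.2)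
    · rw [measureOfSetFun_kernelConvOn hμ hν hq, kernelConv_apply hμ hν hq hA]
      refine kernelConvOn_eq_zero_of_ae ?_
      filter_upwards [hc] with f hf
      have hB : MeasurableSet {g | f + g ∈ A} := measurable_const_add_finest f hA
      -- For `f` in `S`, translation invariance of Lebesgue measure makes the translate of a null
      -- set null.
      have : ν.variation {g | f + g ∈ A} = 0 := by
        rw [VectorMeasure.variation_apply_eq_zero hB]
        intro t ht htm
        refine h2' e t htm (measure_mono_null (fun x hx => ?_)
          ((measure_preimage_add_right volume (e.symm ⟨f, hf⟩) _).trans h0))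
        have hx' := ht hx
        simpa [add_comm] using hx'
      rw [ae_iff]
      simpa using this

end Growth

lemma IsMeasurePoissonSpace.subset_and_isStable
    (hσς : ∃ c : ℝ, 0 < c ∧ ∀ f g, |σ f g| ≤ c * ς f * ς g) {P : Set (ComplexMeasure E)}
    (hP : IsMeasurePoissonSpace ς P) : P ⊆ momentMeasures ς ⊤ ∧ IsStable σ ς P := by
  have family (K : Set (Seminorm ℝ E)) (Γ : Finset (Seminorm ℝ E)) (hΓ : ↑Γ ⊆ K)
      (c : Seminorm ℝ E → ℝ) (hc : ∀ κ ∈ Γ, 0 < c κ) (h : ∀ f, ς f ≤ ∑ κ ∈ Γ, c κ * κ f) :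
      {μ | μ ∈ regularMeasures E ∧ ∀ κ ∈ K, μ ∈ momentMeasures κ ⊤} ⊆ momentMeasures ς ⊤ ∧
        IsStable σ ς {μ | μ ∈ regularMeasures E ∧ ∀ κ ∈ K, μ ∈ momentMeasures κ ⊤} := by
    constructor
    · rintro μ ⟨hμ, hμK⟩
      refine ⟨hμ, fun m _ => ?_⟩
      rw [lintegral_pow_lt_top_iff]
      refine (integrable_sum_pow Γ c (fun κ hκ => (hc κ hκ).le) (fun κ hκ m =>
        (lintegral_pow_lt_top_iff κ m _).1 ((hμK κ (hΓ hκ)).2 m le_top)) m).mono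
        ((measurable_seminorm ς).pow_const m).aestronglyMeasurable (ae_of_all _ fun f => ?_)
      have h0 : 0 ≤ ς f := apply_nonneg ς f
      rw [Real.norm_of_nonneg (by positivity)]
      exact (pow_le_pow_left₀ h0 (h f) m).trans (le_abs_self _)
    · have := (isStable_regularMeasures hσς).inter
        (IsStable.iInter fun κ : K => isStable_momentCondition hσς κ.1)
      convert this using 1
      ext μ
      simp
  induction hP with
  | single κ h =>
    obtain ⟨c, hc, h⟩ := h
    -- One semi-norm is a one-element family; `c + 1` replaces `c` because weights of a family must
    -- be strictly positive.
    have := family {κ} {κ} (by simp) (fun _ => c + 1) (fun _ _ => by positivity) fun f => by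
      have := apply_nonneg κ f
      rw [Finset.sum_singleton]
      linarith [h f]
    have hs : {μ | μ ∈ regularMeasures E ∧ ∀ κ' ∈ ({κ} : Set (Seminorm ℝ E)),
        μ ∈ momentMeasures κ' ⊤} = momentMeasures κ ⊤ := by
      ext μ
      simp only [Set.mem_singleton_iff, forall_eq, Set.mem_ofPred_eq]
      exact ⟨fun h => h.2, fun h => ⟨h.1, h⟩⟩
    rwa [hs] at this
  | family K Γ hΓ c hc h => exact family K Γ hΓ c hc h
  | discrete P _ ih =>
    exact ⟨Set.inter_subset_left.trans ih.1, ih.2.inter (isStable_discreteMeasures hσς)⟩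
  | continuous P _ ih =>
    exact ⟨Set.inter_subset_left.trans ih.1, ih.2.inter (isStable_continuousMeasures hσς)⟩
  | absCont P _ S _ ih =>
    refine ⟨Set.inter_subset_left.trans ih.1, ?_⟩
    -- The extra factor `𝓜(E)` is absorbed, since `P` is already contained in it.
    have := ih.2.inter (isStable_regular_inter_absContMeasures hσς S)
    rwa [← Set.inter_assoc, Set.inter_eq_left.2 fun μ hμ => (ih.1 hμ).1] at this
  | finitelySupported =>
    refine ⟨fun μ hμ => ?_, isStable_finitelySupportedMeasures hσς⟩
    obtain ⟨C, hC, h⟩ := mem_finitelySupportedMeasures_iff.1 hμ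
    refine ⟨mem_regularMeasures_of_finite hC h, fun m _ => ?_⟩
    rw [lintegral_pow_lt_top_iff]
    obtain ⟨B, hB⟩ := (hC.image fun f => ς f ^ m).bddAbove
    refine Integrable.of_bound ((measurable_seminorm ς).pow_const m).aestronglyMeasurable B ?_
    filter_upwards [h] with f hf
    rw [Real.norm_of_nonneg (pow_nonneg (apply_nonneg ς f) m)]
    exact hB ⟨f, hf, rfl⟩

end StableSets

/-! ### Pointwise rules for the bracket of functions -/

section BracketAlgebra

variable {E : Type*} [AddCommGroup E] [Module ℝ E] [TopologicalSpace E] [IsTopologicalAddGroup E]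
  {ς : Seminorm ℝ E} {hς : Continuous ς} {σ : LinearMap.BilinForm ℝ E}
  {hσς : ∃ c : ℝ, 0 < c ∧ ∀ f g, |σ f g| ≤ c * ς f * ς g} {A A' B C : WeakDual ℝ E → ℂ}

lemma phaseBracket_antisymm (hσ : σ.IsAlt) :
    phaseBracket ς hς σ hσς A B = -phaseBracket ς hς σ hσς B A :=
  funext fun _ => congrArg Neg.neg
    (Complexified.bilin_antisymm _ (extendedForm_antisymm ς σ hσ hσς) _ _)

lemma phaseBracket_add_left (hA : ∀ F, ∃ Φ, HasTotalDifferentialAt ς hς A Φ F)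
    (hA' : ∀ F, ∃ Φ, HasTotalDifferentialAt ς hς A' Φ F) :
    phaseBracket ς hς σ hσς (A + A') B =
      phaseBracket ς hς σ hσς A B + phaseBracket ς hς σ hσς A' B := by
  funext F
  obtain ⟨Φ, hΦ⟩ := hA F
  obtain ⟨Φ', hΦ'⟩ := hA' F
  rw [Pi.add_apply, phaseBracket, phaseBracket, phaseBracket, (hΦ.add hΦ').totalDifferential_eq,
    hΦ.totalDifferential_eq, hΦ'.totalDifferential_eq, Complexified.bilin_add_left, neg_add]

lemma phaseBracket_smul_left (hA : ∀ F, ∃ Φ, HasTotalDifferentialAt ς hς A Φ F) (z : ℂ) :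
    phaseBracket ς hς σ hσς (z • A) B = z • phaseBracket ς hς σ hσς A B := by
  funext F
  obtain ⟨Φ, hΦ⟩ := hA F
  rw [Pi.smul_apply, phaseBracket, phaseBracket, (hΦ.smul z).totalDifferential_eq,
    hΦ.totalDifferential_eq, Complexified.bilin_smul_left, smul_eq_mul, mul_neg]

lemma phaseBracket_star (hA : ∀ F, ∃ Φ, HasTotalDifferentialAt ς hς A Φ F)
    (hB : ∀ F, ∃ Φ, HasTotalDifferentialAt ς hς B Φ F) :
    phaseBracket ς hς σ hσς (star A) (star B) = star (phaseBracket ς hς σ hσς A B) := by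
  funext F
  obtain ⟨Φ, hΦ⟩ := hA F
  obtain ⟨Ψ, hΨ⟩ := hB F
  rw [Pi.star_apply, phaseBracket, phaseBracket, hΦ.conj.totalDifferential_eq,
    hΨ.conj.totalDifferential_eq, hΦ.totalDifferential_eq, hΨ.totalDifferential_eq,
    Complexified.bilin_conj, star_neg]
  rfl

lemma phaseBracket_leibniz [ContinuousSMul ℝ E]
    (hB : ∀ F, ∃ Φ, HasTotalDifferentialAt ς hς B Φ F)
    (hC : ∀ F, ∃ Φ, HasTotalDifferentialAt ς hς C Φ F) :
    phaseBracket ς hς σ hσς A (B * C) =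
      phaseBracket ς hς σ hσς A B * C + B * phaseBracket ς hς σ hσς A C := by
  funext F
  obtain ⟨Φ, hΦ⟩ := hB F
  obtain ⟨Ψ, hΨ⟩ := hC F
  rw [Pi.add_apply, Pi.mul_apply, Pi.mul_apply, phaseBracket, phaseBracket, phaseBracket,
    (hΦ.mul hΨ).totalDifferential_eq, hΦ.totalDifferential_eq, hΨ.totalDifferential_eq,
    Complexified.bilin_add_right, Complexified.bilin_smul_right, Complexified.bilin_smul_right]
  ring

end BracketAlgebra

/-! ### Twisted convolution -/

section Twist

/-- The phase factor of the twisted convolution. -/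
noncomputable def twist (ħ s : ℝ) : ℂ := Complex.exp (-(Complex.I / 2) * ħ * s)

lemma measurable_twist (ħ : ℝ) : Measurable (twist ħ) :=
  Complex.measurable_exp.comp (measurable_const.mul Complex.measurable_ofReal)

lemma norm_twist (ħ s : ℝ) : ‖twist ħ s‖ = 1 := by
  have : -(Complex.I / 2) * ħ * s = ((-(ħ * s / 2) : ℝ) : ℂ) * Complex.I := by
    push_cast
    ring
  rw [twist, this, Complex.norm_exp_ofReal_mul_I]

variable {E : Type*} [AddCommGroup E] [Module ℝ E] [MeasurableSpace E]

lemma momentMeasures_anti {E : Type*} [AddCommGroup E] [Module ℝ E] [MeasurableSpace E]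
    {κ : Seminorm ℝ E} {m n : ℕ∞} (h : m ≤ n) :
    momentMeasures κ n ⊆ momentMeasures κ m :=
  fun _ hμ => ⟨hμ.1, fun j hj => hμ.2 j (hj.trans h)⟩

variable [FinestBorelSpace E]

lemma integrable_twist {μ ν : ComplexMeasure E} (hμ : μ ∈ regularMeasures E)
    (σ : LinearMap.BilinForm ℝ E) (ħ : ℝ) :
    Integrable (fun z : E × E => twist ħ (σ z.1 z.2) * (phase μ z.1 * phase ν z.2))
      (μ.variation.prod ν.variation) :=
  integrable_bounded_kernel hμ σ (measurable_twist ħ) fun s => (norm_twist ħ s).le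

variable {σ : LinearMap.BilinForm ℝ E} {μ ν : ComplexMeasure E} (hμ : μ ∈ regularMeasures E)
  (hν : ν ∈ regularMeasures E)

lemma twistedConv_eq (ħ : ℝ) :
    twistedConv σ ħ μ ν = kernelConv (fun f g => twist ħ (σ f g)) hμ hν :=
  measureOfSetFun_kernelConvOn hμ hν (integrable_twist hμ σ ħ)

include hμ hν

lemma twistedConv_mem_regularMeasures (ħ : ℝ) : twistedConv σ ħ μ ν ∈ regularMeasures E :=
  twistedConv_eq hμ hν ħ ▸ kernelConv_mem_regularMeasures hμ hν (integrable_twist hμ σ ħ)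

lemma twistedConv_apply (ħ : ℝ) {A : Set E} (hA : MeasurableSet A) :
    twistedConv σ ħ μ ν A = twistedConvOn σ ħ μ ν A := by
  rw [twistedConv_eq hμ hν, kernelConv_apply hμ hν (integrable_twist hμ σ ħ) hA]
  rfl

end Twist

/-! ### The Fourier transformation and the Poisson algebras -/

section Fourier

variable {E : Type*} [AddCommGroup E] [Module ℝ E] [TopologicalSpace E] [MeasurableSpace E]
  [FinestBorelSpace E]

lemma integrable_weylFunction (μ : ComplexMeasure E) (F : WeakDual ℝ E) :
    μ.Integrable fun f => weylFunction f F :=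
  Integrable.of_bound (measurable_weylFunction F).aestronglyMeasurable 1
    (ae_of_all _ fun f => (norm_weylFunction f F).le)

lemma measureFourier_add (μ ν : ComplexMeasure E) :
    measureFourier (μ + ν) = measureFourier μ + measureFourier ν :=
  funext fun F => VectorMeasure.integral_add_vectorMeasure (integrable_weylFunction μ F)
    (integrable_weylFunction ν F)

lemma measureFourier_smul (z : ℂ) (μ : ComplexMeasure E) :
    measureFourier (z • μ) = z • measureFourier μ := by
  funext F
  have hk : Integrable (fun f => z * phase μ f) μ.variation := (integrable_phase μ).const_mul z
  have h : z • μ = pushDensity μ.variation (fun f => z * phase μ f) (T := id) aemeasurable_id := by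
    ext A hA
    rw [pushDensity_apply _ hk hA, smul_apply]
    conv_lhs => rw [← ext_pushDensity μ, pushDensity_apply _ (integrable_phase μ) hA]
    rw [smul_eq_mul, ← integral_const_mul]
    refine integral_congr_ae (ae_of_all _ fun f => ?_)
    ring
  rw [h, measureFourier, integral_pushDensity _ hk (measurable_weylFunction F)
    (integrable_weylFunction_mul aemeasurable_id hk F), Pi.smul_apply, measureFourier,
    integral_mul_eq, smul_eq_mul, ← integral_const_mul]
  refine integral_congr_ae (ae_of_all _ fun f => ?_)
  simp only [id]
  ring

lemma measureFourier_star (μ : ComplexMeasure E) :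
    measureFourier (measureStar μ) = star (measureFourier μ) := by
  funext F
  have hk := integrable_conj_phase μ
  rw [measureStar_eq_pushDensity, measureFourier, integral_pushDensity _ hk
    (measurable_weylFunction F) (integrable_weylFunction_mul
      measurable_neg_finest.aemeasurable hk F), Pi.star_apply, measureFourier, integral_mul_eq]
  refine Eq.trans ?_ integral_conj
  refine integral_congr_ae (ae_of_all _ fun f => ?_)
  simp only [weylFunction_neg, map_mul]

/-- The density `phase⁻¹ · phase = 1` reduces integrability against `|μ|` to the case of a general
density. -/
lemma integrable_weylFunction_smul {ς : Seminorm ℝ E} {μ : ComplexMeasure E}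
    (hμ : HasMoments ς 1 μ.variation (fun f => f) (phase μ))
    (F : WeakDual ℝ E) :
    μ.Integrable fun f => weylFunction f F • Complexified.ofReal (classMap ς f) := by
  have := (hμ.mul_of_norm_le (n := 1) (m := 0) (q := fun f => (phase μ f)⁻¹) (C := 1)
    (measurable_phase μ).inv.aestronglyMeasurable (by simp)).integrable_smul_ofReal F
  simpa [phase_ne_zero] using this

/-- The scalar serves two purposes: `z = 1` for the vector integral itself, `z = i` for the integral
of the differentials of Weyl functions. -/
lemma integral_smulPairing {ς : Seminorm ℝ E} {μ : ComplexMeasure E}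
    (hμ : HasMoments ς 1 μ.variation (fun f => f) (phase μ))
    (F : WeakDual ℝ E) (z : ℂ) :
    μ.integral (fun f => z • weylFunction f F • Complexified.ofReal (classMap ς f))
      (Complexified.smulPairing _) =
      z • ∫ f, (weylFunction f F * phase μ f) • Complexified.ofReal (classMap ς f)
        ∂μ.variation := by
  let L : Complexified (SeminormCompletion ς) →L[ℝ] Complexified (SeminormCompletion ς) :=
    (Complexified.smulPairing _).flip z
  have hL (Φ : Complexified (SeminormCompletion ς)) : L Φ = z • Φ := rfl
  have hi := integrable_weylFunction_smul hμ F
  simp only [← hL]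
  rw [integral_pairing_eq μ _ (L.integrable_comp hi),
    ← L.integral_comp_comm (hμ.integrable_smul_ofReal F)]
  refine integral_congr_ae (ae_of_all _ fun f => ?_)
  simp only [hL, Complexified.smulPairing_apply, smul_smul]
  congr 1
  ring

lemma continuous_measureFourier {μ : ComplexMeasure E} (hμ : μ ∈ regularMeasures E) :
    Continuous (measureFourier μ) := by
  rw [measureFourier_eq_fourierInt]
  exact continuous_fourierInt (mem_regularMeasures_iff.1 hμ) aemeasurable_id' (integrable_phase μ)

/-- The Fourier transform of a measure in `𝓜(E)` as a bounded continuous function. -/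
noncomputable def fourierBCF {μ : ComplexMeasure E} (hμ : μ ∈ regularMeasures E) :
    WeakDual ℝ E →ᵇ ℂ :=
  BoundedContinuousFunction.ofNormedAddCommGroup (measureFourier μ) (continuous_measureFourier hμ)
    (∫ f, ‖phase μ f‖ ∂μ.variation)
    fun F => by
      rw [measureFourier_eq_fourierInt]
      exact norm_fourierInt_le _ _ _ F

lemma measureFourier_twistedConv_zero {σ : LinearMap.BilinForm ℝ E} {μ ν : ComplexMeasure E}
    (hμ : μ ∈ regularMeasures E) (hν : ν ∈ regularMeasures E) :
    measureFourier (twistedConv σ 0 μ ν) = measureFourier μ * measureFourier ν := by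
  rw [twistedConv_eq hμ hν, measureFourier_kernelConv hμ hν (integrable_twist hμ σ 0),
    measureFourier_eq_fourierInt μ, measureFourier_eq_fourierInt ν]
  funext F
  rw [Pi.mul_apply, fourierInt, fourierInt, fourierInt, ← integral_prod_mul]
  refine integral_congr_ae (ae_of_all _ fun z => ?_)
  simp only [twist, weylFunction_add, Complex.ofReal_zero, mul_zero, zero_mul, Complex.exp_zero]
  ring

section Injectivity

variable [IsTopologicalAddGroup E] [ContinuousSMul ℝ E] [LocallyConvexSpace ℝ E] [T2Space E]

lemma measureFourier_injOn : Set.InjOn (measureFourier (E := E)) (regularMeasures E) := by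
  intro μ hμ ν hν h
  -- Only the linear structure of `𝓜(E)` is wanted, so trivial data suffice.
  have hs := isStable_regularMeasures (σ := (0 : LinearMap.BilinForm ℝ E)) (ς := 0)
    ⟨1, one_pos, by simp⟩
  have h0 := eq_zero_of_measureFourier_eq_zero (hs.add _ hμ _ (hs.smul (-1) _ hν)) fun F => by
    rw [measureFourier_add, measureFourier_smul, h]
    simp
  rwa [show (-1 : ℂ) • ν = -ν by ext A; simp, ← sub_eq_add_neg, sub_eq_zero] at h0

lemma deformedProduct_measureFourier {μ ν : ComplexMeasure E} (hμ : μ ∈ regularMeasures E)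
    (hν : ν ∈ regularMeasures E) (σ : LinearMap.BilinForm ℝ E) (ħ : ℝ) :
    deformedProduct σ ħ (measureFourier μ) (measureFourier ν) =
      measureFourier (twistedConv σ ħ μ ν) := by
  rw [deformedProduct, measureFourier_injOn.leftInvOn_invFunOn hμ,
    measureFourier_injOn.leftInvOn_invFunOn hν]

end Injectivity

section Calculus

variable [IsTopologicalAddGroup E] [ContinuousSMul ℝ E] {ς : Seminorm ℝ E} {hς : Continuous ς}
  {μ ν : ComplexMeasure E}

/-- A Weyl function is the Fourier integral over a one-point space with constant map `f`. -/
lemma totalDifferential_weylFunction (f : E) (F : WeakDual ℝ E) :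
    totalDifferential ς hς (weylFunction f) F =
      Complex.I • weylFunction f F • Complexified.ofReal (classMap ς f) := by
  have h : HasMoments ς 1 (Measure.dirac ()) (fun _ => f) fun _ => 1 := by
    refine ⟨aemeasurable_const, ⟨fun _ => f, ?_⟩, aestronglyMeasurable_const, integrable_const _⟩
    exact ae_of_all _ fun _ => Submodule.subset_span ⟨0, rfl⟩
  have := (h.hasTotalDifferentialAt (hς := hς) F).totalDifferential_eq
  simp only [mul_one, integral_dirac] at this
  rw [← this]
  congr 1
  funext F
  simp [fourierInt]

lemma hasTotalDifferentialAt_measureFourier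
    (hμ : HasMoments ς 1 μ.variation (fun f => f) (phase μ)) (F : WeakDual ℝ E) :
    HasTotalDifferentialAt ς hς (measureFourier μ)
      (Complex.I • μ.integral (fun f => weylFunction f F • Complexified.ofReal (classMap ς f))
        (Complexified.smulPairing _)) F := by
  have := integral_smulPairing hμ F 1
  simp only [one_smul] at this
  rw [this, measureFourier_eq_fourierInt]
  exact hμ.hasTotalDifferentialAt F

lemma totalDifferential_measureFourier
    (hμ : HasMoments ς 1 μ.variation (fun f => f) (phase μ)) (F : WeakDual ℝ E) :
    totalDifferential ς hς (measureFourier μ) F =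
      μ.integral (fun f => totalDifferential ς hς (weylFunction f) F)
        (Complexified.smulPairing _) := by
  simp only [totalDifferential_weylFunction, integral_smulPairing hμ]
  rw [measureFourier_eq_fourierInt]
  exact (hμ.hasTotalDifferentialAt F).totalDifferential_eq

variable {σ : LinearMap.BilinForm ℝ E}

lemma measureBracket_spec (hσς : ∃ c : ℝ, 0 < c ∧ ∀ f g, |σ f g| ≤ c * ς f * ς g)
    (hμ : μ ∈ momentMeasures ς 1) (hν : ν ∈ momentMeasures ς 1) :
    measureBracket σ μ ν ∈ regularMeasures E ∧
      (∀ A, MeasurableSet A → measureBracket σ μ ν A = measureBracketOn σ μ ν A) ∧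
      phaseBracket ς hς σ hσς (measureFourier μ) (measureFourier ν) =
        measureFourier (measureBracket σ μ ν) := by
  have h := hasMoments_of_mem hμ (m := 1) le_rfl
  have h' := hasMoments_of_mem hν (m := 1) le_rfl
  have hq : Integrable (fun z : E × E => (σ z.1 z.2 : ℂ) * (phase μ z.1 * phase ν z.2))
      (μ.variation.prod ν.variation) := (HasMoments.bracket (n := 0) h h' hσς).integrable
  have he : measureBracket σ μ ν = kernelConv (fun f g => (σ f g : ℂ)) hμ.1 hν.1 :=
    measureOfSetFun_kernelConvOn hμ.1 hν.1 hq
  rw [he]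
  refine ⟨kernelConv_mem_regularMeasures hμ.1 hν.1 hq, fun A hA => ?_, ?_⟩
  · rw [kernelConv_apply hμ.1 hν.1 hq hA]
    rfl
  · rw [measureFourier_kernelConv hμ.1 hν.1 hq, measureFourier_eq_fourierInt,
      measureFourier_eq_fourierInt]
    exact h.phaseBracket_eq h' hσς

/-- Stability gives closure under product and bracket. Identities between brackets are identities
between functions, read off from total differentials, except Jacobi, which uses the integral formula
for iterated brackets. -/
lemma isFunctionPoissonAlgebra_of_isStable (hσ : σ.IsAlt)
    (hσς : ∃ c : ℝ, 0 < c ∧ ∀ f g, |σ f g| ≤ c * ς f * ς g) {P : Set (ComplexMeasure E)}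
    (hP : P ⊆ momentMeasures ς ⊤) (hs : IsStable σ ς P) :
    IsFunctionPoissonAlgebra (measureFourier '' P) (phaseBracket ς hς σ hσς) := by
  -- The kernels are `Θ = 1` for the pointwise product and, below, `Θ(s) = s` for the bracket.
  have hconv : ∀ μ ∈ P, ∀ ν ∈ P, twistedConv σ 0 μ ν ∈ P := fun μ hμ ν hν =>
    hs.conv μ hμ ν hν (hP hμ) (hP hν) (twist 0) (measurable_twist 0) fun s => by
      rw [norm_twist]
      linarith [abs_nonneg s]
  have hbr : ∀ μ ∈ P, ∀ ν ∈ P, measureBracket σ μ ν ∈ P := fun μ hμ ν hν =>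
    hs.conv μ hμ ν hν (hP hμ) (hP hν) (fun s => (s : ℂ)) Complex.measurable_ofReal fun s => by
      rw [Complex.norm_real, Real.norm_eq_abs]
      linarith
  let 𝒜 : NonUnitalStarSubalgebra ℂ (WeakDual ℝ E →ᵇ ℂ) :=
    { carrier := {A | (A : WeakDual ℝ E → ℂ) ∈ measureFourier '' P}
      add_mem' := by
        rintro A B ⟨μ, hμ, hA⟩ ⟨ν, hν, hB⟩
        exact ⟨μ + ν, hs.add _ hμ _ hν, by
          rw [measureFourier_add, hA, hB, BoundedContinuousFunction.coe_add]⟩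
      zero_mem' := ⟨0, hs.zero, by
        rw [← zero_smul ℂ (0 : ComplexMeasure E), measureFourier_smul, zero_smul,
          BoundedContinuousFunction.coe_zero]⟩
      mul_mem' := by
        rintro A B ⟨μ, hμ, hA⟩ ⟨ν, hν, hB⟩
        exact ⟨twistedConv σ 0 μ ν, hconv μ hμ ν hν, by
          rw [measureFourier_twistedConv_zero (hP hμ).1 (hP hν).1, hA, hB,
            BoundedContinuousFunction.coe_mul]⟩
      smul_mem' := by
        rintro z A ⟨μ, hμ, hA⟩
        exact ⟨z • μ, hs.smul z _ hμ, by
          rw [measureFourier_smul, hA, BoundedContinuousFunction.coe_smul]; rfl⟩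
      star_mem' := by
        rintro A ⟨μ, hμ, hA⟩
        exact ⟨measureStar μ, hs.star _ hμ, by
          rw [measureFourier_star, hA, BoundedContinuousFunction.coe_star]⟩ }
  have hmem (A : 𝒜) : ∃ μ ∈ P, measureFourier μ = ((A : WeakDual ℝ E →ᵇ ℂ) : WeakDual ℝ E → ℂ) :=
    A.2
  have hdiff (A : 𝒜) (F : WeakDual ℝ E) :
      ∃ Φ, HasTotalDifferentialAt ς hς ((A : WeakDual ℝ E →ᵇ ℂ) : WeakDual ℝ E → ℂ) Φ F := by
    obtain ⟨μ, hμ, hA⟩ := hmem A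
    rw [← hA]
    exact ⟨_, hasTotalDifferentialAt_measureFourier (hasMoments_of_mem (hP hμ) le_top) F⟩
  have hb (A B : 𝒜) : ∃ D : 𝒜, ((D : WeakDual ℝ E →ᵇ ℂ) : WeakDual ℝ E → ℂ) =
      phaseBracket ς hς σ hσς (A : WeakDual ℝ E →ᵇ ℂ) (B : WeakDual ℝ E →ᵇ ℂ) := by
    obtain ⟨μ, hμ, hA⟩ := hmem A
    obtain ⟨ν, hν, hB⟩ := hmem B
    rw [← hA, ← hB, (measureBracket_spec hσς (momentMeasures_anti le_top (hP hμ))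
      (momentMeasures_anti le_top (hP hν))).2.2]
    exact ⟨⟨fourierBCF (hP (hbr μ hμ ν hν)).1, _, hbr μ hμ ν hν, rfl⟩, rfl⟩
  choose b hb using hb
  have hinj {A B : 𝒜} (h : ((A : WeakDual ℝ E →ᵇ ℂ) : WeakDual ℝ E → ℂ) =
      (B : WeakDual ℝ E →ᵇ ℂ)) : A = B := Subtype.ext (DFunLike.coe_injective h)
  have anti (A B : 𝒜) : b A B = -b B A := hinj <| by
    rw [hb, phaseBracket_antisymm hσ, ← hb]; rfl
  have add (A A' B : 𝒜) : b (A + A') B = b A B + b A' B := hinj <| by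
    refine (hb _ _).trans ((phaseBracket_add_left (hdiff A) (hdiff A')).trans ?_)
    rw [← hb, ← hb]; rfl
  have smul (z : ℂ) (A B : 𝒜) : b (z • A) B = z • b A B := hinj <| by
    refine (hb _ _).trans ((phaseBracket_smul_left (hdiff A) z).trans ?_)
    rw [← hb]; rfl
  refine ⟨𝒜, ?_, b, ⟨add, smul, fun A B C => ?_, fun z A B => ?_, anti, fun A B => hinj ?_,
    fun A B C => hinj ?_, fun A B C => hinj ?_⟩, hb⟩
  · ext A
    constructor
    · rintro ⟨B, hB, rfl⟩
      exact hB
    · rintro ⟨μ, hμ, rfl⟩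
      exact ⟨fourierBCF (hP hμ).1, ⟨μ, hμ, rfl⟩, rfl⟩
  -- Linearity in the second slot is inherited from the first through antisymmetry.
  · rw [anti, add, neg_add, ← anti, ← anti]
  · rw [anti, smul, ← smul_neg, ← anti]
  · refine Eq.trans ?_ (Eq.trans (phaseBracket_star (hς := hς) (hσς := hσς) (hdiff A) (hdiff B)).symm
      (hb (star A) (star B)).symm)
    rw [← hb]; rfl
  · obtain ⟨μ, hμ, hA⟩ := hmem A
    obtain ⟨ν, hν, hB⟩ := hmem B
    obtain ⟨ρ, hρ, hC⟩ := hmem C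
    have key := phaseBracket_jacobi (hς := hς) (hasMoments_of_mem (hP hμ) (m := 2) le_top)
      (hasMoments_of_mem (hP hν) (m := 2) le_top) (hasMoments_of_mem (hP hρ) (m := 2) le_top) hσ hσς
    rw [← measureFourier_eq_fourierInt, ← measureFourier_eq_fourierInt,
      ← measureFourier_eq_fourierInt, hA, hB, hC, ← hb, ← hb, ← hb, ← hb, ← hb, ← hb] at key
    exact key
  · refine (hb _ _).trans ((phaseBracket_leibniz (hdiff B) (hdiff C)).trans ?_)
    rw [← hb, ← hb]; rfl

end Calculus

end Fourier

end WeylPoisson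

theorem mainTheorem3 {E : Type*} [AddCommGroup E] [Module ℝ E]
    -- the locally convex Hausdorff topology `τ` on `E`
    [TopologicalSpace E] [IsTopologicalAddGroup E] [ContinuousSMul ℝ E] [LocallyConvexSpace ℝ E]
    [T2Space E] [MeasurableSpace E] [FinestBorelSpace E]
    -- the pre-symplectic form `σ` and the `τ`-continuous semi-norm `ς`
    (σ : LinearMap.BilinForm ℝ E) (hσ : σ.IsAlt)
    (ς : Seminorm ℝ E) (hς : Continuous ς)
    (hσς : ∃ c : ℝ, 0 < c ∧ ∀ f g, |σ f g| ≤ c * ς f * ς g) :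
    -- differentiability and the total differential
    (∀ n : ℕ∞, 1 ≤ n → ∀ μ ∈ momentMeasures ς n,
      (∀ m : ℕ, (m : ℕ∞) ≤ n → DirContDiff ς hς m (measureFourier μ)) ∧
      ∀ F : WeakDual ℝ E,
        μ.Integrable (fun f => weylFunction f F • Complexified.ofReal (classMap ς f)) ∧
        HasTotalDifferentialAt ς hς (measureFourier μ)
          (Complex.I • μ.integral
            (fun f => weylFunction f F • Complexified.ofReal (classMap ς f))
            (Complexified.smulPairing _)) F ∧
        totalDifferential ς hς (measureFourier μ) F =
          Complex.I • μ.integral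
            (fun f => weylFunction f F • Complexified.ofReal (classMap ς f))
            (Complexified.smulPairing _) ∧
        totalDifferential ς hς (measureFourier μ) F =
          μ.integral (fun f => totalDifferential ς hς (weylFunction f) F)
            (Complexified.smulPairing _)) ∧
    -- the Poisson bracket of measures is well defined and is carried to that of functions
    (∀ μ ∈ momentMeasures ς 1, ∀ ν ∈ momentMeasures ς 1,
      measureBracket σ μ ν ∈ regularMeasures E ∧
      (∀ A, MeasurableSet A → measureBracket σ μ ν A = measureBracketOn σ μ ν A) ∧
      phaseBracket ς hς σ hσς (measureFourier μ) (measureFourier ν) = measureFourier (measureBracket σ μ ν)) ∧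
    -- the Fourier transformation is an injective `*`-homomorphism on `𝓜(E)`, and the deformed
    -- products are well defined
    Set.InjOn (measureFourier (E := E)) (regularMeasures E) ∧
    (∀ μ ∈ regularMeasures E, ∀ ν ∈ regularMeasures E,
      (∀ a b : ℂ, measureFourier (a • μ + b • ν) = a • measureFourier μ + b • measureFourier ν) ∧
      measureFourier (measureStar μ) = star (measureFourier μ) ∧
      measureFourier (twistedConv σ 0 μ ν) = measureFourier μ * measureFourier ν ∧
      ∀ ħ : ℝ, twistedConv σ ħ μ ν ∈ regularMeasures E ∧
        (∀ A, MeasurableSet A → twistedConv σ ħ μ ν A = twistedConvOn σ ħ μ ν A) ∧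
        deformedProduct σ ħ (measureFourier μ) (measureFourier ν) = measureFourier (twistedConv σ ħ μ ν)) ∧
    -- the Poisson algebras of functions
    (∀ P : Set (ComplexMeasure E), IsMeasurePoissonSpace ς P →
      measureFourier '' P ⊆ measureFourier '' momentMeasures ς ⊤ ∧
      IsFunctionPoissonAlgebra (measureFourier '' P) (phaseBracket ς hς σ hσς) ∧
      ∀ ħ : ℝ, ∀ A ∈ measureFourier '' P, ∀ B ∈ measureFourier '' P,
        deformedProduct σ ħ A B ∈ measureFourier '' P) ∧
    IsFunctionPoissonAlgebra (measureFourier '' momentMeasures ς ⊤) (phaseBracket ς hς σ hσς) := by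
  have parts {P : Set (ComplexMeasure E)} (hP : IsMeasurePoissonSpace ς P) :=
    hP.subset_and_isStable hσς
  refine ⟨fun n hn μ hμ => ?_, fun μ hμ ν hν => measureBracket_spec hσς hμ hν,
    measureFourier_injOn, fun μ hμ ν hν => ⟨fun a b => ?_, measureFourier_star μ,
      measureFourier_twistedConv_zero hμ hν, fun ħ => ⟨twistedConv_mem_regularMeasures hμ hν ħ,
        fun A hA => twistedConv_apply hμ hν ħ hA, deformedProduct_measureFourier hμ hν σ ħ⟩⟩,
    fun P hP => ⟨Set.image_mono (parts hP).1,
      isFunctionPoissonAlgebra_of_isStable hσ hσς (parts hP).1 (parts hP).2, ?_⟩, ?_⟩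
  · have h1 := hasMoments_of_mem hμ (m := 1) (by exact_mod_cast hn)
    refine ⟨fun m hm => ?_, fun F => ?_⟩
    · rw [measureFourier_eq_fourierInt]
      exact (hasMoments_of_mem hμ hm).dirContDiff
    · have h2 := hasTotalDifferentialAt_measureFourier (hς := hς) h1 F
      exact ⟨integrable_weylFunction_smul h1 F, h2, h2.totalDifferential_eq,
        totalDifferential_measureFourier h1 F⟩
  · rw [measureFourier_add, measureFourier_smul, measureFourier_smul]
  · rintro ħ _ ⟨μ, hμ, rfl⟩ _ ⟨ν, hν, rfl⟩
    have hμ' := (parts hP).1 hμ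
    have hν' := (parts hP).1 hν
    rw [deformedProduct_measureFourier hμ'.1 hν'.1]
    -- The twist has modulus one, so it satisfies the growth bound `1 + |s|`.
    refine ⟨_, (parts hP).2.conv μ hμ ν hν hμ' hν' (twist ħ) (measurable_twist ħ) fun s => ?_, rfl⟩
    rw [norm_twist]
    linarith [abs_nonneg s]
  · have hP : IsMeasurePoissonSpace ς (momentMeasures ς ⊤) :=
      .single ς ⟨1, zero_le_one, fun f => (one_mul _).ge⟩
    exact isFunctionPoissonAlgebra_of_isStable hσ hσς (parts hP).1 (parts hP).2
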